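/- Consider metrics on a domain with adapted coordinates $(t^1,t^2,z^1,z^2)$ of the form $$\mathbf g=\tilde g_{ij}\,dt^i dt^j+h_{kl}(dz^k+f^k_i\,dt^i)(dz^l+f^l_j\,dt^j),$$ where the symmetric $\tilde g_{ij}$, $h_{kl}$ and the $f^k_i$ ($i,j,k,l\in\{1,2\}$) depend on $t=(t^1,t^2)$ only, and $\det\tilde g\neq0$, $\det h\neq0$ (any signature). Let $\tau$ be the bundle of such metrics; $J^2\tau$ has coordinates $t,z$, the ten coefficients $\tilde g_{ij},f^k_i,h_{kl}$, and their first and second derivatives along $t$. The pseudogroup of transformations $\bar t^{\,i}=\phi^i(t)$, $\bar z^{\,i}=\alpha^i_jz^j+\psi^i(t)$ is infinitesimally generated by the fields $U=\Phi^i(t)\,\partial_{t^i}+(A^k_lz^l+\Psi^k(t))\,\partial_{z^k}$, with $\Phi^i,\Psi^k$ arbitrary smooth functions and $A^k_l$ arbitrary constants. A (scalar differential) invariant of order less than $3$ on an open subset of $J^2\tau$ is a smooth function annihilated by the natural prolongations to $J^2\tau$ of all these fields. Let $D_1,D_2$ be the total derivatives, let a comma denote them, and put $\sigma_i=(\det h)_{,i}/\det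 h$, $\rho_{ij}=\sigma_i\sigma_j$, $\chi_{ij}=\frac1{\det h}\bigl(\tfrac12(h_{11,i}h_{22,j}+h_{11,j}h_{22,i})-h_{12,i}h_{12,j}\bigr)$, $\gamma=\chi-\frac14\rho$, and, for a symmetric form $\mu$, $C_\mu=\mu_{ij}\tilde g^{ij}$, $Q_\mu=\det\mu/\det\tilde g$. Further let $$\mathcal C^k=\frac{f^k_{1,2}-f^k_{2,1}}{\sqrt{|\det\tilde g|}},\qquad \ell_{\mathcal C}=h_{kl}\mathcal C^k\mathcal C^l,\qquad \Theta_{\mathrm I}=\frac{1}{\sqrt{|\det h|}\sqrt{|\det\tilde g|}}\begin{vmatrix}h_{11,1}&h_{12,1}&h_{22,1}\\ h_{11,2}&h_{12,2}&h_{22,2}\\ (\mathcal C^2)^2&-\mathcal C^1\mathcal C^2&(\mathcal C^1)^2\end{vmatrix},$$ and let $(I_1,\dots,I_6)=(C_\rho,\,C_\chi,\,Q_\chi,\,Q_\gamma,\,\ell_{\mathcal C},\,\Theta_{\mathrm I}^2)$. Let $$X=\tilde g^{is}\sigma_sD_i,\qquad X^\perp=\frac{\sigma_2D_1-\sigma_1D_2}{\sqrt{|\det\tilde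 g|}}.$$ Let $C_{\mathrm{ric}}$ be the scalar curvature of the orbit metric $\tilde g$, let $C_\nu$ be the Laplacian of $\ln|\det h|$ with respect to $\tilde g$, and put $C_\nu'=C_\nu-2C_\chi+C_\rho$. **Proposition.** The $20$ functions $I_j$, $XI_j$, $X^\perp I_j$ ($j=1,\dots,6$), $C_{\mathrm{ric}}$ and $C_\nu$ form a maximal system of generically functionally independent invariants of order less than $3$. That is, they are invariants on all of $J^2\tau$, and there is an open dense subset $O$ of $J^2\tau$ such that at every point of $O$ their differentials are linearly independent, and every invariant of order less than $3$ defined on an open set $W\subseteq J^2\tau$ is, near each point of $W\cap O$, a smooth function of these $20$. The same holds with $C_\nu'$ in place of $C_\nu$. -/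

import Mathlib

open scoped ContDiff Topology

noncomputable section

namespace KillingJet

/-!
We work in adapted coordinates `(t¹, t², z¹, z²)`. A metric invariant under the translations in
`z¹, z²`, with nondegenerate Killing leaves, is written
`g̃_ij dtⁱ dtʲ + h_kl (dzᵏ + fᵏ_i dtⁱ) (dzˡ + fˡ_j dtʲ)`,
where `g̃`, `h` are symmetric and all coefficients depend on `t` only. The coefficients `g̃_ij`,
`fᵏ_i`, `h_kl` are the fibre coordinates of the bundle of such metrics, and these coordinates
together with their derivatives along `t` of order at most two are the fibre coordinates of its
second jet bundle.
-/

/-- Labels of the ten fibre coordinates: `g̃_ij` (symmetric in `i, j`), `fᵏ_i` (labelled by the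
pair `(i, k)`), and `h_kl` (symmetric in `k, l`). -/
abbrev FibreIdx : Type := Sym2 (Fin 2) ⊕ (Fin 2 × Fin 2) ⊕ Sym2 (Fin 2)

/-- Points `(t, z, u)` of the bundle of metrics. -/
abbrev Jet0 : Type := (Fin 2 → ℝ) × (Fin 2 → ℝ) × (FibreIdx → ℝ)

/-- First jets: `j.2 s a` is the derivative along `tˢ` of the fibre coordinate `a`. -/
abbrev Jet1 : Type := Jet0 × (Fin 2 → FibreIdx → ℝ)

/-- Second jets: `j.2 s(r, s) a` is the second derivative along `tʳ, tˢ` of the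
fibre coordinate `a`. -/
abbrev Jet2 : Type := Jet1 × (Sym2 (Fin 2) → FibreIdx → ℝ)

/-! ### Total derivatives -/

/-- The total derivative `D_s` at a first jet, as a tangent vector at the underlying point. -/
def totalVec0 (s : Fin 2) (j : Jet1) : Jet0 := (Pi.single s 1, 0, j.2 s)

/-- The total derivative `D_s` at a second jet, as a tangent vector at the underlying
first jet. -/
def totalVec1 (s : Fin 2) (j : Jet2) : Jet1 := (totalVec0 s j.1, fun r => j.2 s(r, s))

/-- The total derivative `D_s F` of a function of order zero. -/
def D0 (s : Fin 2) (F : Jet0 → ℝ) (j : Jet1) : ℝ := fderiv ℝ F j.1 (totalVec0 s j)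

/-- The total derivative `D_s F` of a function of order one. -/
def D1 (s : Fin 2) (F : Jet1 → ℝ) (j : Jet2) : ℝ := fderiv ℝ F j.1 (totalVec1 s j)

/-! ### The pseudogroup, infinitesimally -/

/-- Partial derivative along `tˢ` of a function of `t`. -/
def pd (s : Fin 2) (φ : (Fin 2 → ℝ) → ℝ) (t : Fin 2 → ℝ) : ℝ := fderiv ℝ φ t (Pi.single s 1)

/-- The coefficient `g̃_ij` at a point of the bundle of metrics. -/
def gt (i j : Fin 2) (x : Jet0) : ℝ := x.2.2 (Sum.inl s(i, j))

/-- The coefficient `fᵏ_i` at a point of the bundle of metrics. -/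
def ff (i k : Fin 2) (x : Jet0) : ℝ := x.2.2 (Sum.inr (Sum.inl (i, k)))

/-- The coefficient `h_kl` at a point of the bundle of metrics. -/
def hh (k l : Fin 2) (x : Jet0) : ℝ := x.2.2 (Sum.inr (Sum.inr s(k, l)))

/-- Fibre components of the lift `Uτ` to the bundle of metrics of the vector field
`U = Φⁱ ∂/∂tⁱ + (Aᵏ_l zˡ + Ψᵏ) ∂/∂zᵏ` (with `A k l = Aᵏ_l`). The formulas for `g̃` and `h` are
symmetric in the two indices, so it does not matter that they are listed in increasing order. -/
def liftComp (Φ Ψ : Fin 2 → (Fin 2 → ℝ) → ℝ) (A : Matrix (Fin 2) (Fin 2) ℝ) :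
    FibreIdx → Jet0 → ℝ
  | Sum.inl p => fun x =>
      -∑ s, (gt p.inf s x * pd p.sup (Φ s) x.1 + gt p.sup s x * pd p.inf (Φ s) x.1)
  | Sum.inr (Sum.inl (i, k)) => fun x =>
      ∑ s, ff i s x * A k s - pd i (Ψ k) x.1 - ∑ s, ff s k x * pd i (Φ s) x.1
  | Sum.inr (Sum.inr p) => fun x =>
      -∑ s, (A s p.sup * hh p.inf s x + A s p.inf * hh s p.sup x)

/-- First prolongation: the component along the coordinate `u^a_s`, namely
`D_s (U u^a) - (∂Φʳ/∂tˢ) u^a_r`. -/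
def prolongComp1 (Φ Ψ : Fin 2 → (Fin 2 → ℝ) → ℝ) (A : Matrix (Fin 2) (Fin 2) ℝ)
    (a : FibreIdx) (s : Fin 2) (j : Jet1) : ℝ :=
  D0 s (liftComp Φ Ψ A a) j - ∑ r, pd s (Φ r) j.1.1 * j.2 r a

/-- Second prolongation: the component along the coordinate `u^a_rs`, namely
`D_s (U u^a_r) - (∂Φ^q/∂tˢ) u^a_rq`; it is symmetric in `r, s`. -/
def prolongComp2 (Φ Ψ : Fin 2 → (Fin 2 → ℝ) → ℝ) (A : Matrix (Fin 2) (Fin 2) ℝ)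
    (a : FibreIdx) (r s : Fin 2) (j : Jet2) : ℝ :=
  D1 s (prolongComp1 Φ Ψ A a r) j - ∑ q, pd s (Φ q) j.1.1.1 * j.2 s(r, q) a

/-- The vector field on the second jets generated by `U`. -/
def prolongedField (Φ Ψ : Fin 2 → (Fin 2 → ℝ) → ℝ) (A : Matrix (Fin 2) (Fin 2) ℝ)
    (j : Jet2) : Jet2 :=
  (((fun i => Φ i j.1.1.1,
     fun k => ∑ l, A k l * j.1.1.2.1 l + Ψ k j.1.1.1,
     fun a => liftComp Φ Ψ A a j.1.1),
    fun s a => prolongComp1 Φ Ψ A a s j.1),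
   fun p a => prolongComp2 Φ Ψ A a p.inf p.sup j)

/-- The second jets of nondegenerate metrics with nondegenerate Killing leaves. -/
def regular : Set Jet2 :=
  {j | gt 0 0 j.1.1 * gt 1 1 j.1.1 - gt 0 1 j.1.1 ^ 2 ≠ 0 ∧
       hh 0 0 j.1.1 * hh 1 1 j.1.1 - hh 0 1 j.1.1 ^ 2 ≠ 0}

/-- `F` is a (scalar) differential invariant of order less than three on the set `W` of second
jets: it is smooth there and is annihilated by all the prolonged fields. -/
def IsInvariantOn (F : Jet2 → ℝ) (W : Set Jet2) : Prop :=
  ContDiffOn ℝ ∞ F W ∧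
  ∀ (Φ Ψ : Fin 2 → (Fin 2 → ℝ) → ℝ) (A : Matrix (Fin 2) (Fin 2) ℝ),
    (∀ i, ContDiff ℝ ∞ (Φ i)) → (∀ k, ContDiff ℝ ∞ (Ψ k)) →
    ∀ j ∈ W, fderiv ℝ F j (prolongedField Φ Ψ A j) = 0

/-- `F` is, near the jet `j`, a smooth function of the functions `I a`. -/
def FunctionallyDependsAt {ι : Type} [Fintype ι] (F : Jet2 → ℝ) (I : ι → Jet2 → ℝ)
    (j : Jet2) : Prop :=
  ∃ V ∈ 𝓝 j, ∃ Y : Set (ι → ℝ), IsOpen Y ∧ ∃ Θ : (ι → ℝ) → ℝ, ContDiffOn ℝ ∞ Θ Y ∧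
    ∀ x ∈ V, (fun a => I a x) ∈ Y ∧ F x = Θ (fun a => I a x)

/-- The functions `I a` form a maximal system of generically functionally independent invariants
of order less than three: they are invariants and, at all points of an open dense set of
regular jets, their differentials are linearly independent and every invariant defined nearby
is locally a function of them. -/
structure IsMaximalSystem {ι : Type} [Fintype ι] (I : ι → Jet2 → ℝ) : Prop where
  invariant : ∀ a, IsInvariantOn (I a) regular
  generic : ∃ O : Set Jet2, IsOpen O ∧ O ⊆ regular ∧ regular ⊆ closure O ∧
    (∀ j ∈ O, LinearIndependent ℝ (fun a => fderiv ℝ (I a) j)) ∧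
    ∀ (W : Set Jet2) (F : Jet2 → ℝ), IsOpen W → IsInvariantOn F W →
      ∀ j ∈ W ∩ O, FunctionallyDependsAt F I j

/-! ### First-order invariants -/

/-- `det g̃`. -/
def detG (x : Jet0) : ℝ := gt 0 0 x * gt 1 1 x - gt 0 1 x ^ 2

/-- `det h`. -/
def detH (x : Jet0) : ℝ := hh 0 0 x * hh 1 1 x - hh 0 1 x ^ 2

/-- The orbit metric as a matrix. -/
def orbitMetric (x : Jet0) : Matrix (Fin 2) (Fin 2) ℝ := Matrix.of fun i j => gt i j x

/-- The coefficients `g̃^ij` of the inverse of the orbit metric. -/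
def gInv (i j : Fin 2) (x : Jet0) : ℝ := (orbitMetric x)⁻¹ i j

/-- The derivatives `h_kl,s`. -/
def hd (k l s : Fin 2) (j : Jet1) : ℝ := D0 s (hh k l) j

/-- The one-form `σ = d ln |det h|`. -/
def sigma (s : Fin 2) (j : Jet1) : ℝ := D0 s detH j / detH j.1

/-- The form `ρ = σ²`. -/
def rho (j : Jet1) : Matrix (Fin 2) (Fin 2) ℝ := Matrix.of fun a b => sigma a j * sigma b j

/-- The form `χ = (dh₁₁ dh₂₂ - dh₁₂ dh₁₂) / det h`. -/
def chi (j : Jet1) : Matrix (Fin 2) (Fin 2) ℝ := Matrix.of fun a b =>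
  ((hd 0 0 a j * hd 1 1 b j + hd 0 0 b j * hd 1 1 a j) / 2 - hd 0 1 a j * hd 0 1 b j) / detH j.1

/-- The form `γ = χ - ρ / 4`. -/
def gammaForm (j : Jet1) : Matrix (Fin 2) (Fin 2) ℝ := chi j - (1 / 4 : ℝ) • rho j

/-- The trace `C_μ = μ_ij g̃^ij` of a symmetric form on the orbit space. -/
def traceInv (μ : Matrix (Fin 2) (Fin 2) ℝ) (x : Jet0) : ℝ := ∑ i, ∑ j, μ i j * gInv i j x

/-- The determinant `Q_μ = det μ / det g̃` of a symmetric form on the orbit space. -/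
def detInv (μ : Matrix (Fin 2) (Fin 2) ℝ) (x : Jet0) : ℝ := μ.det / detG x

/-- The components `𝒞ᵏ` of the curvature vector field. -/
def curv (k : Fin 2) (j : Jet1) : ℝ := (D0 1 (ff 0 k) j - D0 0 (ff 1 k) j) / √|detG j.1|

/-- The squared length of the curvature vector field. -/
def ellC (j : Jet1) : ℝ := ∑ k, ∑ l, hh k l j.1 * curv k j * curv l j

/-- The semi-invariant `Θ_I`. -/
def thetaI (j : Jet1) : ℝ :=
  1 / (√|detH j.1| * √|detG j.1|) *
    Matrix.det !![hd 0 0 0 j, hd 0 1 0 j, hd 1 1 0 j;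
                  hd 0 0 1 j, hd 0 1 1 j, hd 1 1 1 j;
                  curv 1 j ^ 2, -(curv 0 j * curv 1 j), curv 0 j ^ 2]

/-- The six first-order invariants `C_ρ, C_χ, Q_χ, Q_γ, ℓ_𝒞, Θ_I²`. -/
def firstOrder : Fin 6 → Jet1 → ℝ :=
  ![fun j => traceInv (rho j) j.1,
    fun j => traceInv (chi j) j.1,
    fun j => detInv (chi j) j.1,
    fun j => detInv (gammaForm j) j.1,
    ellC,
    fun j => thetaI j ^ 2]

/-! ### Second-order invariants -/

/-- The invariant differentiation `X = g̃^is σ_s D_i`. -/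
def XD (F : Jet1 → ℝ) (j : Jet2) : ℝ := ∑ i, ∑ s, gInv i s j.1.1 * sigma s j.1 * D1 i F j

/-- The semi-invariant differentiation `X^⊥ = (σ₂ D₁ - σ₁ D₂) / √|det g̃|`. -/
def XperpD (F : Jet1 → ℝ) (j : Jet2) : ℝ :=
  (sigma 1 j.1 * D1 0 F j - sigma 0 j.1 * D1 1 F j) / √|detG j.1.1|

/-- Christoffel symbols `Γᵏ_ij` of the orbit metric. -/
def christoffel (k i j : Fin 2) (x : Jet1) : ℝ :=
  (1 / 2) * ∑ l, gInv k l x.1 * (D0 i (gt j l) x + D0 j (gt i l) x - D0 l (gt i j) x)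

/-- The Ricci tensor of the orbit metric. -/
def ricci (x : Jet2) : Matrix (Fin 2) (Fin 2) ℝ := Matrix.of fun i j =>
  ∑ k, (D1 k (christoffel k i j) x - D1 j (christoffel k i k) x) +
  ∑ k, ∑ l, (christoffel k k l x.1 * christoffel l i j x.1 -
    christoffel k j l x.1 * christoffel l i k x.1)

/-- `C_ric`, the scalar curvature of the orbit metric. -/
def Cric (x : Jet2) : ℝ := traceInv (ricci x) x.1.1

/-- The Hessian `ν` of `ln |det h|` with respect to the orbit metric. -/
def hessian (x : Jet2) : Matrix (Fin 2) (Fin 2) ℝ := Matrix.of fun i j =>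
  D1 i (D0 j (fun y => Real.log |detH y|)) x -
    ∑ k, christoffel k i j x.1 * D0 k (fun y => Real.log |detH y|) x.1

/-- `C_ν`, the Laplacian of `ln |det h|` with respect to the orbit metric. -/
def Cnu (x : Jet2) : ℝ := traceInv (hessian x) x.1.1

/-- `C_ν' = C_ν - 2 C_χ + C_ρ`. -/
def Cnu' (x : Jet2) : ℝ := Cnu x - 2 * traceInv (chi x.1) x.1.1 + traceInv (rho x.1) x.1.1

/-- The twenty functions `I_j`, `X I_j`, `X^⊥ I_j` (six of each), `C_ric`, and a further
function `c`. -/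
def twenty (c : Jet2 → ℝ) : Fin 6 ⊕ Fin 6 ⊕ Fin 6 ⊕ Fin 2 → Jet2 → ℝ
  | Sum.inl a => fun j => firstOrder a j.1
  | Sum.inr (Sum.inl a) => XD (firstOrder a)
  | Sum.inr (Sum.inr (Sum.inl a)) => XperpD (firstOrder a)
  | Sum.inr (Sum.inr (Sum.inr b)) => ![Cric, c] b

end KillingJet

end

/-!
Each of the functions is built from tensors on the orbit space by natural operations: along the
prolongation of a generating field, `g̃`, `σ` and `χ` change by the Jacobian of `Φ`, while the
Christoffel symbols also pick up its second derivatives, which cancel in `C_ric` and `C_ν`.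

At a jet where the `3 × 3` matrix of `h, h_{,1}, h_{,2}` is invertible and `σ ≠ 0`, a generating
field with vanishing second prolongation has vanishing `A` and three-jets of `Φ`, `Ψ`. The fields
with cubic `Φ` and `Ψ` therefore span a space of dimension `44` in the `64`-dimensional space of
second jets, and twenty invariants with independent differentials leave no room for another one: its
differential vanishes on the kernel of theirs, so it factors through the submersion they define.

For the independence one differentiates along second derivatives only. The direction of `f` sees
only the derivatives of `ℓ_𝒞` and `Θ_I²`, that of `g̃` then only `C_ric`, and in the direction of
`h` the coefficients of `dχ` form an array which is symmetric in one pair of indices and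
antisymmetric in another, hence zero. All genericity conditions amount to one polynomial in the
first jet being nonzero, so that it is enough to exhibit one jet at which it does not vanish.
-/

noncomputable section

namespace KillingJet

/-! ### Functional dependence -/

theorem pi_surjective_of_linearIndependent {ι K M : Type*} [Finite ι] [Field K] [AddCommGroup M]
    [Module K M] {f : ι → M →ₗ[K] K} (hf : LinearIndependent K f) :
    Function.Surjective (LinearMap.pi f) := by
  classical
  have := Fintype.ofFinite ι
  rw [← LinearMap.dualMap_injective_iff, ← LinearMap.ker_eq_bot, LinearMap.ker_eq_bot']
  intro φ hφ
  have hsum : ∑ a, φ (Pi.single a 1) • f a = 0 := by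
    ext m
    have hφm := LinearMap.congr_fun hφ m
    rw [LinearMap.dualMap_apply, ← Finset.univ_sum_single (LinearMap.pi f m), map_sum] at hφm
    rw [← hφm, LinearMap.sum_apply]
    refine Finset.sum_congr rfl fun a _ => ?_
    rw [LinearMap.smul_apply, smul_eq_mul, mul_comm, ← smul_eq_mul, ← map_smul, ← Pi.single_smul,
      smul_eq_mul, mul_one, LinearMap.pi_apply]
  refine LinearMap.pi_ext' fun a => LinearMap.ext_ring ?_
  simpa using Fintype.linearIndependent_iff.1 hf _ hsum a

/- Mathlib gives the smoothness of a local inverse at one point only. For `n = ∞` this does not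
spread to a neighbourhood, so the domain is first shrunk to where the derivative is invertible. -/
theorem exists_openPartialHomeomorph_contDiffOn_symm {𝕜 E F : Type*} [RCLike 𝕜]
    [NormedAddCommGroup E] [NormedSpace 𝕜 E] [CompleteSpace E] [NormedAddCommGroup F]
    [NormedSpace 𝕜 F] {N : E → F} {n : WithTop ℕ∞} (hn : n ≠ 0) {O : Set E} (hO : IsOpen O)
    (hN : ContDiffOn 𝕜 n N O) {x₀ : E} (hx₀ : x₀ ∈ O) {N' : E ≃L[𝕜] F}
    (hN' : HasFDerivAt N (N' : E →L[𝕜] F) x₀) :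
    ∃ e : OpenPartialHomeomorph E F, x₀ ∈ e.source ∧ e.source ⊆ O ∧ (∀ x, e x = N x) ∧
      ContDiffOn 𝕜 n e.symm e.target := by
  have hNat : ∀ x ∈ O, ContDiffAt 𝕜 n N x := fun x hx => hN.contDiffAt (hO.mem_nhds hx)
  let e := (hNat x₀ hx₀).toOpenPartialHomeomorph N hN' hn
  let S : Set E := O ∩ fderiv 𝕜 N ⁻¹' Set.range fun T : E ≃L[𝕜] F => (T : E →L[𝕜] F)
  have hS : IsOpen S := (hN.continuousOn_fderiv_of_isOpen hO
    (ENat.one_le_iff_ne_zero_withTop.2 hn)).isOpen_inter_preimage hO ContinuousLinearEquiv.isOpen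
  have hx₀S : x₀ ∈ S := ⟨hx₀, N', hN'.fderiv.symm⟩
  refine ⟨e.restrOpen S hS, ⟨(hNat x₀ hx₀).mem_toOpenPartialHomeomorph_source hN' hn, hx₀S⟩,
    fun x hx => hx.2.1, fun _ => rfl, fun y hy => ?_⟩
  obtain ⟨-, hyO, T, hT⟩ := (e.restrOpen S hS).map_target hy
  have hder := ((hNat _ hyO).differentiableAt hn).hasFDerivAt
  rw [← hT] at hder
  exact ((e.restrOpen S hS).contDiffAt_symm hy hder (hNat _ hyO)).contDiffWithinAt

theorem exists_openPartialHomeomorph_fst_eq {𝕜 E F : Type*} [RCLike 𝕜] [NormedAddCommGroup E]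
    [NormedSpace 𝕜 E] [CompleteSpace E] [NormedAddCommGroup F] [NormedSpace 𝕜 F]
    [FiniteDimensional 𝕜 F] {I : E → F} {n : WithTop ℕ∞} (hn : n ≠ 0) {O : Set E} (hO : IsOpen O)
    (hI : ContDiffOn 𝕜 n I O) {x₀ : E} (hx₀ : x₀ ∈ O)
    (hsurj : Function.Surjective (fderiv 𝕜 I x₀)) :
    ∃ e : OpenPartialHomeomorph E (F × (fderiv 𝕜 I x₀).ker), x₀ ∈ e.source ∧ e.source ⊆ O ∧
      (∀ x, (e x).1 = I x) ∧ ContDiffOn 𝕜 n e.symm e.target := by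
  have := FiniteDimensional.complete 𝕜 F
  obtain ⟨p, hp⟩ :=
    (fderiv 𝕜 I x₀).ker_closedComplemented_of_finiteDimensional_range
  have hprange : p.range = ⊤ := LinearMap.range_eq_top.2 fun v => ⟨v, hp v⟩
  let N' := (fderiv 𝕜 I x₀).equivProdOfSurjectiveOfIsCompl p (LinearMap.range_eq_top.2 hsurj)
    hprange (LinearMap.isCompl_of_proj hp)
  have hN' : HasFDerivAt (fun x => (I x, p x)) (N' : E →L[𝕜] F × (fderiv 𝕜 I x₀).ker) x₀ :=
    ((hI.contDiffAt (hO.mem_nhds hx₀)).differentiableAt hn).hasFDerivAt.prodMk p.hasFDerivAt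
  obtain ⟨e, hx₀e, heO, he, hsymm⟩ := exists_openPartialHomeomorph_contDiffOn_symm hn hO
    (hI.prodMk p.contDiff.contDiffOn) hx₀ hN'
  exact ⟨e, hx₀e, heO, fun x => by rw [he], hsymm⟩

theorem eqOn_const_of_fderiv_ker_le {E F G K : Type*} [NormedAddCommGroup E] [NormedSpace ℝ E]
    [NormedAddCommGroup F] [NormedSpace ℝ F] [NormedAddCommGroup G] [NormedSpace ℝ G]
    [NormedAddCommGroup K] [NormedSpace ℝ K] {I : E → F} {f : E → G} {c : K → E} {S : Set K}
    (hS : Convex ℝ S) (hSo : IsOpen S) (hc : DifferentiableOn ℝ c S)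
    (hI : ∀ k ∈ S, DifferentiableAt ℝ I (c k)) (hf : ∀ k ∈ S, DifferentiableAt ℝ f (c k))
    (hker : ∀ k ∈ S, ∀ v, fderiv ℝ I (c k) v = 0 → fderiv ℝ f (c k) v = 0)
    {y : F} (hconst : ∀ k ∈ S, I (c k) = y) {k l : K} (hk : k ∈ S) (hl : l ∈ S) :
    f (c k) = f (c l) := by
  have hcat : ∀ k ∈ S, DifferentiableAt ℝ c k := fun k hk => hc.differentiableAt (hSo.mem_nhds hk)
  refine hSo.is_const_of_fderiv_eq_zero (𝕜 := ℝ) (f := fun k => f (c k)) hS.isPreconnected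
    (fun k hk => ((hf k hk).comp k (hcat k hk)).differentiableWithinAt) (fun k hk => ?_) hk hl
  have hzero : (fderiv ℝ I (c k)).comp (fderiv ℝ c k) = 0 := by
    refine ((hI k hk).hasFDerivAt.comp k (hcat k hk).hasFDerivAt).unique ?_
    exact (hasFDerivAt_const y k).congr_of_eventuallyEq
      ((hSo.eventually_mem hk).mono fun l hl => hconst l hl)
  refine ((hf k hk).hasFDerivAt.comp k (hcat k hk).hasFDerivAt).fderiv.trans ?_
  ext v
  exact hker k hk _ (DFunLike.congr_fun hzero v)

theorem exists_contDiffOn_factor {E F G : Type*} [NormedAddCommGroup E] [NormedSpace ℝ E]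
    [CompleteSpace E] [NormedAddCommGroup F] [NormedSpace ℝ F] [FiniteDimensional ℝ F]
    [NormedAddCommGroup G] [NormedSpace ℝ G] {I : E → F} {f : E → G} {n : WithTop ℕ∞} (hn : n ≠ 0)
    {O : Set E} (hO : IsOpen O) {x₀ : E} (hx₀ : x₀ ∈ O) (hI : ContDiffOn ℝ n I O)
    (hf : ContDiffOn ℝ n f O) (hsurj : Function.Surjective (fderiv ℝ I x₀))
    (hker : ∀ x ∈ O, ∀ v, fderiv ℝ I x v = 0 → fderiv ℝ f x v = 0) :
    ∃ V ∈ 𝓝 x₀, ∃ Y : Set F, IsOpen Y ∧ ∃ Θ : F → G, ContDiffOn ℝ n Θ Y ∧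
      ∀ x ∈ V, I x ∈ Y ∧ f x = Θ (I x) := by
  obtain ⟨e, hx₀e, heO, he, hsymm⟩ := exists_openPartialHomeomorph_fst_eq hn hO hI hx₀ hsurj
  obtain ⟨ε, hε, hball⟩ := Metric.isOpen_iff.1 e.open_target (e x₀) (e.map_source hx₀e)
  let Y := Metric.ball (e x₀).1 ε
  let Z := Metric.ball (e x₀).2 ε
  have hYZ : Y ×ˢ Z ⊆ e.target := by rwa [ball_prod_same]
  have hmem : ∀ y ∈ Y, ∀ z ∈ Z, e.symm (y, z) ∈ O := fun y hy z hz =>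
    heO (e.map_target (hYZ ⟨hy, hz⟩))
  have hIsymm : ∀ y ∈ Y, ∀ z ∈ Z, I (e.symm (y, z)) = y := fun y hy z hz => by
    rw [← he, e.right_inv (hYZ ⟨hy, hz⟩)]
  have hIdiff : ∀ x ∈ O, DifferentiableAt ℝ I x := fun x hx =>
    (hI.contDiffAt (hO.mem_nhds hx)).differentiableAt hn
  have hfdiff : ∀ x ∈ O, DifferentiableAt ℝ f x := fun x hx =>
    (hf.contDiffAt (hO.mem_nhds hx)).differentiableAt hn
  have hslice : ∀ y ∈ Y, ContDiffOn ℝ n (fun z => e.symm (y, z)) Z := fun y hy =>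
    hsymm.comp (by fun_prop) fun z hz => hYZ ⟨hy, hz⟩
  have hz₀ : (e x₀).2 ∈ Z := Metric.mem_ball_self hε
  refine ⟨e.source ∩ e ⁻¹' (Y ×ˢ Z), e.isOpen_inter_preimage
    (Metric.isOpen_ball.prod Metric.isOpen_ball) |>.mem_nhds
    ⟨hx₀e, Metric.mem_ball_self hε, hz₀⟩, Y, Metric.isOpen_ball,
    fun y => f (e.symm (y, (e x₀).2)), ?_, ?_⟩
  · exact hf.comp (hsymm.comp (by fun_prop) fun y hy => hYZ ⟨hy, hz₀⟩) fun y hy => hmem y hy _ hz₀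
  · rintro x ⟨hx, hxY, hxZ⟩
    refine ⟨he x ▸ hxY, ?_⟩
    calc f x = f (e.symm ((e x).1, (e x).2)) := by rw [Prod.mk.eta, e.left_inv hx]
      _ = f (e.symm ((e x).1, (e x₀).2)) :=
        eqOn_const_of_fderiv_ker_le (convex_ball _ _) Metric.isOpen_ball
          ((hslice _ hxY).differentiableOn hn)
          (fun z hz => hIdiff _ (hmem _ hxY z hz)) (fun z hz => hfdiff _ (hmem _ hxY z hz))
          (fun z hz => hker _ (hmem _ hxY z hz)) (hIsymm _ hxY) hxZ hz₀
      _ = f (e.symm (I x, (e x₀).2)) := by rw [he]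

/-! ### Directional derivatives -/

/-- `F` is differentiable at `x` and its derivative along `v` is `d`. Unlike with `HasLineDerivAt`,
differentiability is part of the notion, so that it is stable under composition. -/
def HasDerivAlong {E G : Type*} [NormedAddCommGroup E] [NormedSpace ℝ E] [NormedAddCommGroup G]
    [NormedSpace ℝ G] (F : E → G) (x v : E) (d : G) : Prop :=
  DifferentiableAt ℝ F x ∧ fderiv ℝ F x v = d

namespace HasDerivAlong

variable {E E' G G' : Type*} [NormedAddCommGroup E] [NormedSpace ℝ E] [NormedAddCommGroup E']
  [NormedSpace ℝ E'] [NormedAddCommGroup G] [NormedSpace ℝ G] [NormedAddCommGroup G']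
  [NormedSpace ℝ G']

section Normed

variable {F F₁ : E → G} {x v : E} {a b : G}

theorem differentiableAt (h : HasDerivAlong F x v a) : DifferentiableAt ℝ F x := h.1

theorem fderiv_eq (h : HasDerivAlong F x v a) : fderiv ℝ F x v = a := h.2

theorem eq_zero (h : HasDerivAlong F x 0 a) : a = 0 := h.2.symm.trans (map_zero _)

theorem of_hasFDerivAt {F' : E →L[ℝ] G} (h : HasFDerivAt F F' x) (ha : F' v = a) :
    HasDerivAlong F x v a :=
  ⟨h.differentiableAt, by rw [h.fderiv, ha]⟩

theorem congr (h : HasDerivAlong F x v a) (hab : a = b) : HasDerivAlong F x v b := hab ▸ h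

theorem congr_of_eventuallyEq (h : HasDerivAlong F x v a) (hF : F₁ =ᶠ[𝓝 x] F) :
    HasDerivAlong F₁ x v a :=
  of_hasFDerivAt (h.differentiableAt.hasFDerivAt.congr_of_eventuallyEq hF) h.fderiv_eq

theorem const (c : G) : HasDerivAlong (fun _ => c) x v 0 :=
  of_hasFDerivAt (hasFDerivAt_const c x) rfl

theorem id (x v : E) : HasDerivAlong (fun y => y) x v v :=
  of_hasFDerivAt (hasFDerivAt_id x) rfl

theorem fst {F : E → G × G'} {a : G × G'} (h : HasDerivAlong F x v a) :
    HasDerivAlong (fun y => (F y).1) x v a.1 :=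
  of_hasFDerivAt h.1.hasFDerivAt.fst (by rw [← h.2]; rfl)

theorem snd {F : E → G × G'} {a : G × G'} (h : HasDerivAlong F x v a) :
    HasDerivAlong (fun y => (F y).2) x v a.2 :=
  of_hasFDerivAt h.1.hasFDerivAt.snd (by rw [← h.2]; rfl)

theorem apply {ι : Type*} [Fintype ι] {F : E → ι → G} {a : ι → G} (h : HasDerivAlong F x v a)
    (i : ι) : HasDerivAlong (fun y => F y i) x v (a i) :=
  of_hasFDerivAt (hasFDerivAt_pi'.1 h.1.hasFDerivAt i) (by rw [← h.2]; rfl)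

theorem add (hF : HasDerivAlong F x v a) (hF₁ : HasDerivAlong F₁ x v b) :
    HasDerivAlong (fun y => F y + F₁ y) x v (a + b) :=
  of_hasFDerivAt (hF.1.hasFDerivAt.add hF₁.1.hasFDerivAt) (by simp [hF.2, hF₁.2])

theorem sub (hF : HasDerivAlong F x v a) (hF₁ : HasDerivAlong F₁ x v b) :
    HasDerivAlong (fun y => F y - F₁ y) x v (a - b) :=
  of_hasFDerivAt (hF.1.hasFDerivAt.sub hF₁.1.hasFDerivAt) (by simp [hF.2, hF₁.2])

theorem neg (hF : HasDerivAlong F x v a) : HasDerivAlong (fun y => -F y) x v (-a) :=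
  of_hasFDerivAt hF.1.hasFDerivAt.neg (by simp [hF.2])

theorem sum {ι : Type*} {s : Finset ι} {F : ι → E → G} {a : ι → G}
    (h : ∀ i ∈ s, HasDerivAlong (F i) x v (a i)) :
    HasDerivAlong (fun y => ∑ i ∈ s, F i y) x v (∑ i ∈ s, a i) :=
  of_hasFDerivAt (HasFDerivAt.fun_sum fun i hi => (h i hi).1.hasFDerivAt) <| by
    rw [sum_apply]
    exact Finset.sum_congr rfl fun i hi => (h i hi).2

theorem prodMk {F₂ : E → G'} {c : G'} (hF : HasDerivAlong F x v a)
    (hF₂ : HasDerivAlong F₂ x v c) : HasDerivAlong (fun y => (F y, F₂ y)) x v (a, c) :=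
  of_hasFDerivAt (hF.1.hasFDerivAt.prodMk hF₂.1.hasFDerivAt) (Prod.ext hF.2 hF₂.2)

theorem pi {ι : Type*} [Fintype ι] {F : E → ι → G} {a : ι → G}
    (h : ∀ i, HasDerivAlong (fun y => F y i) x v (a i)) : HasDerivAlong F x v a :=
  of_hasFDerivAt (hasFDerivAt_pi.2 fun i => (h i).1.hasFDerivAt) (funext fun i => (h i).2)

theorem comp_fst {F : E → G} {x v : E × E'} (hF : HasDerivAlong F x.1 v.1 a) :
    HasDerivAlong (fun y : E × E' => F y.1) x v a :=
  of_hasFDerivAt (hF.1.hasFDerivAt.comp x hasFDerivAt_fst) hF.2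

end Normed

section Real

variable {F F₁ : E → ℝ} {x v : E} {a b : ℝ}

theorem mul (hF : HasDerivAlong F x v a) (hF₁ : HasDerivAlong F₁ x v b) :
    HasDerivAlong (fun y => F y * F₁ y) x v (a * F₁ x + F x * b) :=
  of_hasFDerivAt (hF.1.hasFDerivAt.fun_mul hF₁.1.hasFDerivAt) (by simp [hF.2, hF₁.2]; ring)

theorem sq (hF : HasDerivAlong F x v a) : HasDerivAlong (fun y => F y ^ 2) x v (2 * F x * a) := by
  simpa only [pow_two] using (hF.mul hF).congr (by ring)

theorem comp_hasDerivAt {f : ℝ → ℝ} {f' : ℝ} (hf : HasDerivAt f f' (F x))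
    (hF : HasDerivAlong F x v a) : HasDerivAlong (fun y => f (F y)) x v (f' * a) :=
  of_hasFDerivAt (hf.comp_hasFDerivAt x hF.1.hasFDerivAt) (by simp [hF.2])

theorem inv (hF : HasDerivAlong F x v a) (h0 : F x ≠ 0) :
    HasDerivAlong (fun y => (F y)⁻¹) x v (-a / F x ^ 2) :=
  (comp_hasDerivAt (hasDerivAt_inv h0) hF).congr (by ring)

theorem div (hF : HasDerivAlong F x v a) (hF₁ : HasDerivAlong F₁ x v b) (h0 : F₁ x ≠ 0) :
    HasDerivAlong (fun y => F y / F₁ y) x v ((a * F₁ x - F x * b) / F₁ x ^ 2) := by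
  simpa only [div_eq_mul_inv] using (hF.mul (hF₁.inv h0)).congr (by field_simp; ring)

theorem sqrt_abs (hF : HasDerivAlong F x v a) (h0 : F x ≠ 0) :
    HasDerivAlong (fun y => √|F y|) x v (a / (2 * F x) * √|F x|) := by
  refine (comp_hasDerivAt ((hasDerivAt_abs h0).sqrt (abs_ne_zero.2 h0)) hF).congr ?_
  have hroot : √|F x| ≠ 0 := (Real.sqrt_pos.2 (abs_pos.2 h0)).ne'
  have hsq : √|F x| * √|F x| = (SignType.sign (F x) : ℝ) * F x := by
    rw [Real.mul_self_sqrt (abs_nonneg _), sign_mul_self]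
  rw [div_mul_eq_mul_div, div_mul_eq_mul_div, div_eq_div_iff
    (mul_ne_zero two_ne_zero hroot) (mul_ne_zero two_ne_zero h0)]
  linear_combination (-2 * a) * hsq

end Real

end HasDerivAlong

/- Both iterated derivatives contain the second derivative of `f` along `w` and `T x`, which cancels
by symmetry. -/
theorem HasDerivAlong.fderiv_comm {E E' : Type*} [NormedAddCommGroup E] [NormedSpace ℝ E]
    [NormedAddCommGroup E'] [NormedSpace ℝ E'] {f : E → ℝ} {p : E' →L[ℝ] E} {T : E' → E}
    {L : E → E} {x w : E'} {τ l : E} (hf : ContDiffAt ℝ 2 f (p x)) (hT : HasDerivAlong T x w τ)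
    (hL : HasDerivAlong L (p x) (T x) l) (hw : p w = L (p x)) :
    HasDerivAlong (fun y => fderiv ℝ f (p y) (T y)) x w
      (fderiv ℝ (fun y => fderiv ℝ f y (L y)) (p x) (T x) + fderiv ℝ f (p x) (τ - l)) := by
  have hf' : HasFDerivAt (fderiv ℝ f) (fderiv ℝ (fderiv ℝ f) (p x)) (p x) :=
    ((hf.fderiv_right (m := 1) le_rfl).differentiableAt one_ne_zero).hasFDerivAt
  have hsymm : IsSymmSndFDerivAt ℝ f (p x) :=
    hf.isSymmSndFDerivAt (by simp [minSmoothness_of_isRCLikeNormedField])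
  have hLf := (hf'.clm_apply hL.1.hasFDerivAt).fderiv
  refine .of_hasFDerivAt ((hf'.comp x p.hasFDerivAt).clm_apply hT.1.hasFDerivAt) ?_
  simp only [hLf, add_apply, ContinuousLinearMap.comp_apply, Function.comp_apply,
    ContinuousLinearMap.flip_apply, hT.2, hL.2, hw, map_sub, hsymm.eq (L (p x))]
  ring

/-! ### Jet coordinates -/

/-- The label of the coefficient `g̃_ij`. -/
abbrev gI (i j : Fin 2) : FibreIdx := Sum.inl s(i, j)

/-- The label of the coefficient `fᵏ_i`. -/
abbrev fI (i k : Fin 2) : FibreIdx := Sum.inr (Sum.inl (i, k))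

/-- The label of the coefficient `h_kl`. -/
abbrev hI (k l : Fin 2) : FibreIdx := Sum.inr (Sum.inr s(k, l))

theorem FibreIdx.cases {p : FibreIdx → Prop} (hg : ∀ i j, p (gI i j)) (hf : ∀ i k, p (fI i k))
    (hh : ∀ k l, p (hI k l)) (a : FibreIdx) : p a := by
  rcases a with a | ⟨i, k⟩ | a
  · induction a with | _ i j => exact hg i j
  · exact hf i k
  · induction a with | _ i j => exact hh i j

theorem gI_comm (i j : Fin 2) : gI i j = gI j i := by rw [gI, Sym2.eq_swap]

theorem hI_comm (k l : Fin 2) : hI k l = hI l k := by rw [hI, Sym2.eq_swap]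

theorem gt_comm (i j : Fin 2) (x : Jet0) : gt i j x = gt j i x := congrArg x.2.2 (gI_comm i j)

theorem hh_comm (k l : Fin 2) (x : Jet0) : hh k l x = hh l k x := congrArg x.2.2 (hI_comm k l)

theorem hasDerivAlong_coord (a : FibreIdx) (x v : Jet0) :
    HasDerivAlong (fun y : Jet0 => y.2.2 a) x v (v.2.2 a) :=
  (HasDerivAlong.id x v).snd.snd.apply a

theorem hasDerivAlong_coord_totalVec0 (a : FibreIdx) (s : Fin 2) (x : Jet1) :
    HasDerivAlong (fun y : Jet0 => y.2.2 a) x.1 (totalVec0 s x) (x.2 s a) :=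
  hasDerivAlong_coord a _ _

theorem hasDerivAlong_coord_totalVec1 (a : FibreIdx) (s : Fin 2) (x : Jet2) :
    HasDerivAlong (fun y : Jet1 => y.1.2.2 a) x.1 (totalVec1 s x) (x.1.2 s a) :=
  .comp_fst (F := fun y : Jet0 => y.2.2 a) (hasDerivAlong_coord_totalVec0 a s x.1)

theorem hasDerivAlong_coord₁ (r : Fin 2) (a : FibreIdx) (x v : Jet1) :
    HasDerivAlong (fun y : Jet1 => y.2 r a) x v (v.2 r a) :=
  ((HasDerivAlong.id x v).snd.apply r).apply a

theorem hasDerivAlong_coord₁_totalVec1 (r : Fin 2) (a : FibreIdx) (s : Fin 2) (x : Jet2) :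
    HasDerivAlong (fun y : Jet1 => y.2 r a) x.1 (totalVec1 s x) (x.2 s(r, s) a) :=
  hasDerivAlong_coord₁ r a _ _

theorem hasDerivAlong_coord₂ (p : Sym2 (Fin 2)) (a : FibreIdx) (x v : Jet2) :
    HasDerivAlong (fun y : Jet2 => y.2 p a) x v (v.2 p a) :=
  ((HasDerivAlong.id x v).snd.apply p).apply a

@[simp] theorem D0_gt (s i j : Fin 2) (x : Jet1) : D0 s (gt i j) x = x.2 s (gI i j) :=
  (hasDerivAlong_coord_totalVec0 _ s x).fderiv_eq

@[simp] theorem D0_ff (s i k : Fin 2) (x : Jet1) : D0 s (ff i k) x = x.2 s (fI i k) :=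
  (hasDerivAlong_coord_totalVec0 _ s x).fderiv_eq

@[simp] theorem hd_eq (k l s : Fin 2) (x : Jet1) : hd k l s x = x.2 s (hI k l) :=
  (hasDerivAlong_coord_totalVec0 _ s x).fderiv_eq

theorem contDiff_pd {φ : (Fin 2 → ℝ) → ℝ} (hφ : ContDiff ℝ ∞ φ) (s : Fin 2) :
    ContDiff ℝ ∞ (pd s φ) :=
  (hφ.fderiv_right (m := ∞) (by simp)).clm_apply contDiff_const

theorem pd_comm {φ : (Fin 2 → ℝ) → ℝ} (hφ : ContDiff ℝ 2 φ) (r s : Fin 2) (t : Fin 2 → ℝ) :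
    pd r (pd s φ) t = pd s (pd r φ) t := by
  have hsymm : IsSymmSndFDerivAt ℝ φ t :=
    hφ.contDiffAt.isSymmSndFDerivAt (by simp [minSmoothness_of_isRCLikeNormedField])
  have hdiff : Differentiable ℝ (fderiv ℝ φ) :=
    (hφ.fderiv_right (m := 1) le_rfl).differentiable one_ne_zero
  have hpd : ∀ r s : Fin 2, pd r (pd s φ) t =
      fderiv ℝ (fderiv ℝ φ) t (Pi.single r 1) (Pi.single s 1) := by
    intro r s
    unfold pd
    rw [fderiv_clm_apply (hdiff t) (differentiableAt_const _)]
    simp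
  rw [hpd, hpd, hsymm.eq]

theorem hasDerivAlong_time_totalVec0 {φ : (Fin 2 → ℝ) → ℝ} (hφ : ContDiff ℝ ∞ φ) (s : Fin 2)
    (x : Jet1) :
    HasDerivAlong (fun y : Jet0 => φ y.1) x.1 (totalVec0 s x) (pd s φ x.1.1) :=
  .comp_fst ⟨hφ.differentiable (by simp) _, rfl⟩

theorem hasDerivAlong_time_totalVec1 {φ : (Fin 2 → ℝ) → ℝ} (hφ : ContDiff ℝ ∞ φ) (s : Fin 2)
    (x : Jet2) :
    HasDerivAlong (fun y : Jet1 => φ y.1.1) x.1 (totalVec1 s x) (pd s φ x.1.1.1) :=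
  .comp_fst (F := fun y : Jet0 => φ y.1) (hasDerivAlong_time_totalVec0 hφ s x.1)

theorem contDiffAt_D0 {F : Jet0 → ℝ} {x : Jet1} (hF : ContDiffAt ℝ ∞ F x.1) (s : Fin 2) :
    ContDiffAt ℝ ∞ (D0 s F) x := by
  have hfderiv : ContDiffAt ℝ ∞ (fun y : Jet1 => fderiv ℝ F y.1) x :=
    (hF.fderiv_right (m := ∞) (by simp)).comp x contDiffAt_fst
  refine hfderiv.clm_apply ?_
  unfold totalVec0
  fun_prop

theorem contDiffAt_D1 {F : Jet1 → ℝ} {x : Jet2} (hF : ContDiffAt ℝ ∞ F x.1) (s : Fin 2) :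
    ContDiffAt ℝ ∞ (D1 s F) x := by
  have hfderiv : ContDiffAt ℝ ∞ (fun y : Jet2 => fderiv ℝ F y.1) x :=
    (hF.fderiv_right (m := ∞) (by simp)).comp x contDiffAt_fst
  refine hfderiv.clm_apply ?_
  unfold totalVec1 totalVec0
  fun_prop

/-! ### Prolongation of the generating fields -/

section Components

variable (Φ Ψ : Fin 2 → (Fin 2 → ℝ) → ℝ) (A : Matrix (Fin 2) (Fin 2) ℝ)

theorem liftComp_gI (i j : Fin 2) (x : Jet0) : liftComp Φ Ψ A (gI i j) x =
    -∑ s, (gt i s x * pd j (Φ s) x.1 + gt j s x * pd i (Φ s) x.1) := by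
  fin_cases i <;> fin_cases j <;> simp [liftComp, gt_comm 1 0]
  ring

theorem liftComp_fI (i k : Fin 2) (x : Jet0) : liftComp Φ Ψ A (fI i k) x =
    ∑ s, ff i s x * A k s - pd i (Ψ k) x.1 - ∑ s, ff s k x * pd i (Φ s) x.1 := rfl

theorem liftComp_hI (k l : Fin 2) (x : Jet0) : liftComp Φ Ψ A (hI k l) x =
    -∑ s, (A s l * hh k s x + A s k * hh s l x) := by
  fin_cases k <;> fin_cases l <;> simp [liftComp, hh_comm 1 0]
  ring

end Components

/-- A generating field `U = Φⁱ ∂/∂tⁱ + (Aᵏ_l zˡ + Ψᵏ) ∂/∂zᵏ` of the pseudogroup, with smooth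
`Φ` and `Ψ`. -/
structure GeneratingField where
  Φ : Fin 2 → (Fin 2 → ℝ) → ℝ
  Ψ : Fin 2 → (Fin 2 → ℝ) → ℝ
  A : Matrix (Fin 2) (Fin 2) ℝ
  contDiff_Φ : ∀ i, ContDiff ℝ ∞ (Φ i)
  contDiff_Ψ : ∀ k, ContDiff ℝ ∞ (Ψ k)

namespace GeneratingField

variable (U : GeneratingField)

/-- The lift of `U` to the bundle of metrics. -/
def lift0 (x : Jet0) : Jet0 :=
  (fun i => U.Φ i x.1, fun k => ∑ l, U.A k l * x.2.1 l + U.Ψ k x.1,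
    fun a => liftComp U.Φ U.Ψ U.A a x)

/-- The prolongation of `U` to the first jets. -/
def lift1 (x : Jet1) : Jet1 := (U.lift0 x.1, fun s a => prolongComp1 U.Φ U.Ψ U.A a s x)

/-- The prolongation of `U` to the second jets. -/
abbrev lift2 (x : Jet2) : Jet2 := prolongedField U.Φ U.Ψ U.A x

theorem prolongComp1_gI (i j s : Fin 2) (x : Jet1) :
    prolongComp1 U.Φ U.Ψ U.A (gI i j) s x =
      -∑ r, (x.2 s (gI i r) * pd j (U.Φ r) x.1.1 + gt i r x.1 * pd s (pd j (U.Φ r)) x.1.1 +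
        (x.2 s (gI j r) * pd i (U.Φ r) x.1.1 + gt j r x.1 * pd s (pd i (U.Φ r)) x.1.1)) -
      ∑ r, pd s (U.Φ r) x.1.1 * x.2 r (gI i j) := by
  unfold prolongComp1
  rw [funext (liftComp_gI U.Φ U.Ψ U.A i j)]
  have hterm := fun i j r => (hasDerivAlong_coord_totalVec0 (gI i r) s x).mul
    (hasDerivAlong_time_totalVec0 (contDiff_pd (U.contDiff_Φ r) j) s x)
  exact congrArg (· - _)
    (HasDerivAlong.neg (.sum fun r _ => (hterm i j r).add (hterm j i r))).fderiv_eq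

theorem prolongComp1_fI (i k s : Fin 2) (x : Jet1) :
    prolongComp1 U.Φ U.Ψ U.A (fI i k) s x =
      ∑ r, x.2 s (fI i r) * U.A k r - pd s (pd i (U.Ψ k)) x.1.1 -
      ∑ r, (x.2 s (fI r k) * pd i (U.Φ r) x.1.1 + ff r k x.1 * pd s (pd i (U.Φ r)) x.1.1) -
      ∑ r, pd s (U.Φ r) x.1.1 * x.2 r (fI i k) := by
  unfold prolongComp1
  rw [funext (liftComp_fI U.Φ U.Ψ U.A i k)]
  have hA := fun r => ((hasDerivAlong_coord_totalVec0 (fI i r) s x).mul (.const (U.A k r))).congr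
    (b := x.2 s (fI i r) * U.A k r) (by simp)
  exact congrArg (· - _) (HasDerivAlong.sub (.sub (.sum fun r _ => hA r)
    (hasDerivAlong_time_totalVec0 (contDiff_pd (U.contDiff_Ψ k) i) s x))
    (.sum fun r _ => (hasDerivAlong_coord_totalVec0 (fI r k) s x).mul
      (hasDerivAlong_time_totalVec0 (contDiff_pd (U.contDiff_Φ r) i) s x))).fderiv_eq

theorem prolongComp1_hI (k l s : Fin 2) (x : Jet1) :
    prolongComp1 U.Φ U.Ψ U.A (hI k l) s x =
      -∑ r, (U.A r l * x.2 s (hI k r) + U.A r k * x.2 s (hI r l)) -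
      ∑ r, pd s (U.Φ r) x.1.1 * x.2 r (hI k l) := by
  unfold prolongComp1
  rw [funext (liftComp_hI U.Φ U.Ψ U.A k l)]
  have hterm := fun c a => ((HasDerivAlong.const c).mul (hasDerivAlong_coord_totalVec0 a s x)).congr
    (b := c * x.2 s a) (by simp)
  exact congrArg (· - _) (HasDerivAlong.neg
    (.sum fun r _ => (hterm (U.A r l) (hI k r)).add (hterm (U.A r k) (hI r l)))).fderiv_eq

theorem prolongComp2_gI (i j r s : Fin 2) (x : Jet2) :
    prolongComp2 U.Φ U.Ψ U.A (gI i j) r s x =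
      -∑ q, (x.2 s(r, s) (gI i q) * pd j (U.Φ q) x.1.1.1 +
          x.1.2 r (gI i q) * pd s (pd j (U.Φ q)) x.1.1.1 +
          (x.1.2 s (gI i q) * pd r (pd j (U.Φ q)) x.1.1.1 +
            gt i q x.1.1 * pd s (pd r (pd j (U.Φ q))) x.1.1.1) +
        (x.2 s(r, s) (gI j q) * pd i (U.Φ q) x.1.1.1 +
          x.1.2 r (gI j q) * pd s (pd i (U.Φ q)) x.1.1.1 +
          (x.1.2 s (gI j q) * pd r (pd i (U.Φ q)) x.1.1.1 +
            gt j q x.1.1 * pd s (pd r (pd i (U.Φ q))) x.1.1.1))) -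
      ∑ q, (pd s (pd r (U.Φ q)) x.1.1.1 * x.1.2 q (gI i j) +
        pd r (U.Φ q) x.1.1.1 * x.2 s(q, s) (gI i j)) -
      ∑ q, pd s (U.Φ q) x.1.1.1 * x.2 s(r, q) (gI i j) := by
  unfold prolongComp2
  rw [funext (U.prolongComp1_gI i j r)]
  have htime := fun {φ} hφ => hasDerivAlong_time_totalVec1 (φ := φ) hφ s x
  have hterm := fun i j q => ((hasDerivAlong_coord₁_totalVec1 r (gI i q) s x).mul
      (htime (contDiff_pd (U.contDiff_Φ q) j))).add
    ((hasDerivAlong_coord_totalVec1 (gI i q) s x).mul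
      (htime (contDiff_pd (contDiff_pd (U.contDiff_Φ q) j) r)))
  exact congrArg (· - _) (HasDerivAlong.sub
    (.neg (.sum fun q _ => (hterm i j q).add (hterm j i q)))
    (.sum fun q _ => (htime (contDiff_pd (U.contDiff_Φ q) r)).mul
      (hasDerivAlong_coord₁_totalVec1 q (gI i j) s x))).fderiv_eq

theorem prolongComp2_fI (i k r s : Fin 2) (x : Jet2) :
    prolongComp2 U.Φ U.Ψ U.A (fI i k) r s x =
      ∑ q, x.2 s(r, s) (fI i q) * U.A k q - pd s (pd r (pd i (U.Ψ k))) x.1.1.1 -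
      ∑ q, (x.2 s(r, s) (fI q k) * pd i (U.Φ q) x.1.1.1 +
          x.1.2 r (fI q k) * pd s (pd i (U.Φ q)) x.1.1.1 +
        (x.1.2 s (fI q k) * pd r (pd i (U.Φ q)) x.1.1.1 +
          ff q k x.1.1 * pd s (pd r (pd i (U.Φ q))) x.1.1.1)) -
      ∑ q, (pd s (pd r (U.Φ q)) x.1.1.1 * x.1.2 q (fI i k) +
        pd r (U.Φ q) x.1.1.1 * x.2 s(q, s) (fI i k)) -
      ∑ q, pd s (U.Φ q) x.1.1.1 * x.2 s(r, q) (fI i k) := by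
  unfold prolongComp2
  rw [funext (U.prolongComp1_fI i k r)]
  have htime := fun {φ} hφ => hasDerivAlong_time_totalVec1 (φ := φ) hφ s x
  have hA := fun q => ((hasDerivAlong_coord₁_totalVec1 r (fI i q) s x).mul
    (.const (U.A k q))).congr (b := x.2 s(r, s) (fI i q) * U.A k q) (by simp)
  exact congrArg (· - _) (HasDerivAlong.sub (.sub (.sub (.sum fun q _ => hA q)
    (htime (contDiff_pd (contDiff_pd (U.contDiff_Ψ k) i) r)))
    (.sum fun q _ => ((hasDerivAlong_coord₁_totalVec1 r (fI q k) s x).mul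
        (htime (contDiff_pd (U.contDiff_Φ q) i))).add
      ((hasDerivAlong_coord_totalVec1 (fI q k) s x).mul
        (htime (contDiff_pd (contDiff_pd (U.contDiff_Φ q) i) r)))))
    (.sum fun q _ => (htime (contDiff_pd (U.contDiff_Φ q) r)).mul
      (hasDerivAlong_coord₁_totalVec1 q (fI i k) s x))).fderiv_eq

theorem prolongComp2_hI (k l r s : Fin 2) (x : Jet2) :
    prolongComp2 U.Φ U.Ψ U.A (hI k l) r s x =
      -∑ q, (U.A q l * x.2 s(r, s) (hI k q) + U.A q k * x.2 s(r, s) (hI q l)) -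
      ∑ q, (pd s (pd r (U.Φ q)) x.1.1.1 * x.1.2 q (hI k l) +
        pd r (U.Φ q) x.1.1.1 * x.2 s(q, s) (hI k l)) -
      ∑ q, pd s (U.Φ q) x.1.1.1 * x.2 s(r, q) (hI k l) := by
  unfold prolongComp2
  rw [funext (U.prolongComp1_hI k l r)]
  have hterm := fun c a => ((HasDerivAlong.const c).mul
    (hasDerivAlong_coord₁_totalVec1 r a s x)).congr (b := c * x.2 s(r, s) a) (by simp)
  exact congrArg (· - _) (HasDerivAlong.sub
    (.neg (.sum fun q _ => (hterm (U.A q l) (hI k q)).add (hterm (U.A q k) (hI q l))))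
    (.sum fun q _ => (hasDerivAlong_time_totalVec1 (contDiff_pd (U.contDiff_Φ q) r) s x).mul
      (hasDerivAlong_coord₁_totalVec1 q (hI k l) s x))).fderiv_eq

theorem prolongComp2_comm (a : FibreIdx) (r s : Fin 2) (x : Jet2) :
    prolongComp2 U.Φ U.Ψ U.A a r s x = prolongComp2 U.Φ U.Ψ U.A a s r x := by
  have hle : (2 : WithTop ℕ∞) ≤ ∞ := WithTop.coe_le_coe.2 le_top
  have hΦ := fun q => pd_comm ((U.contDiff_Φ q).of_le hle) s r
  have hpdΦ := fun q i => pd_comm ((contDiff_pd (U.contDiff_Φ q) i).of_le hle) s r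
  have hpdΨ := fun k i => pd_comm ((contDiff_pd (U.contDiff_Ψ k) i).of_le hle) s r
  have hswap : ∀ p q : Fin 2, (s(p, q) : Sym2 (Fin 2)) = s(q, p) := fun _ _ => Sym2.eq_swap
  induction a using FibreIdx.cases with
  | hg i j =>
    simp only [prolongComp2_gI, hΦ, hpdΦ, Fin.sum_univ_two, hswap s, hswap r 0, hswap r 1]
    ring
  | hf i k =>
    simp only [prolongComp2_fI, hΦ, hpdΦ, hpdΨ, Fin.sum_univ_two, hswap s, hswap r 0, hswap r 1]
    ring
  | hh k l =>
    simp only [prolongComp2_hI, hΦ, Fin.sum_univ_two, hswap s, hswap r 0, hswap r 1]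
    ring

theorem lift2_snd (r s : Fin 2) (a : FibreIdx) (x : Jet2) :
    (U.lift2 x).2 s(r, s) a = prolongComp2 U.Φ U.Ψ U.A a r s x := by
  change prolongComp2 U.Φ U.Ψ U.A a (s(r, s) : Sym2 (Fin 2)).inf (s(r, s) : Sym2 (Fin 2)).sup x = _
  rw [Sym2.inf_mk, Sym2.sup_mk]
  rcases le_total r s with h | h
  · rw [inf_eq_left.2 h, sup_eq_right.2 h]
  · rw [inf_eq_right.2 h, sup_eq_left.2 h, prolongComp2_comm]

theorem contDiff_liftComp (a : FibreIdx) : ContDiff ℝ ∞ (liftComp U.Φ U.Ψ U.A a) := by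
  have hpdΦ : ∀ i j, ContDiff ℝ ∞ (fun x : Jet0 => pd j (U.Φ i) x.1) := fun i j =>
    (contDiff_pd (U.contDiff_Φ i) j).comp contDiff_fst
  have hpdΨ : ∀ i j, ContDiff ℝ ∞ (fun x : Jet0 => pd j (U.Ψ i) x.1) := fun i j =>
    (contDiff_pd (U.contDiff_Ψ i) j).comp contDiff_fst
  induction a using FibreIdx.cases with
  | hg i j => rw [funext (liftComp_gI U.Φ U.Ψ U.A i j)]; unfold gt; fun_prop
  | hf i k => rw [funext (liftComp_fI U.Φ U.Ψ U.A i k)]; unfold ff; fun_prop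
  | hh k l => rw [funext (liftComp_hI U.Φ U.Ψ U.A k l)]; unfold hh; fun_prop

theorem contDiff_prolongComp1 (a : FibreIdx) (s : Fin 2) :
    ContDiff ℝ ∞ (prolongComp1 U.Φ U.Ψ U.A a s) := by
  have hD0 : ContDiff ℝ ∞ (D0 s (liftComp U.Φ U.Ψ U.A a)) := contDiff_iff_contDiffAt.2 fun x =>
    contDiffAt_D0 (U.contDiff_liftComp a).contDiffAt s
  have hpd : ∀ i, ContDiff ℝ ∞ (fun x : Jet1 => pd s (U.Φ i) x.1.1) := fun i =>
    (contDiff_pd (U.contDiff_Φ i) s).comp (contDiff_fst.comp contDiff_fst)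
  unfold prolongComp1
  fun_prop

theorem hasDerivAlong_totalVec1 (s : Fin 2) (x : Jet2) :
    HasDerivAlong (totalVec1 s) x (U.lift2 x)
      ((0, 0, fun a => prolongComp1 U.Φ U.Ψ U.A a s x.1),
        fun r a => prolongComp2 U.Φ U.Ψ U.A a r s x) :=
  ((HasDerivAlong.const _).prodMk ((HasDerivAlong.const _).prodMk
    (.pi fun a => (hasDerivAlong_coord₁ s a x.1 (U.lift2 x).1).comp_fst))).prodMk
    (.pi fun r => .pi fun a => (hasDerivAlong_coord₂ s(r, s) a x _).congr (U.lift2_snd r s a x))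

theorem hasDerivAlong_lift1_totalVec1 (s : Fin 2) (x : Jet2) :
    HasDerivAlong U.lift1 x.1 (totalVec1 s x)
      ((fun i => pd s (U.Φ i) x.1.1.1, fun k => pd s (U.Ψ k) x.1.1.1,
        fun a => D0 s (liftComp U.Φ U.Ψ U.A a) x.1),
        fun r a => D1 s (prolongComp1 U.Φ U.Ψ U.A a r) x) := by
  have hA : ∀ k l, HasDerivAlong (fun y : Jet1 => U.A k l * y.1.2.1 l) x.1 (totalVec1 s x) 0 :=
    fun k l => ((HasDerivAlong.const _).mul ((HasDerivAlong.id _ _).fst.snd.fst.apply l)).congr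
      (by simp [totalVec1, totalVec0])
  have hz : ∀ k, HasDerivAlong (fun y : Jet1 => ∑ l, U.A k l * y.1.2.1 l + U.Ψ k y.1.1) x.1
      (totalVec1 s x) (pd s (U.Ψ k) x.1.1.1) := fun k =>
    ((HasDerivAlong.sum fun l _ => hA k l).add
      (hasDerivAlong_time_totalVec1 (U.contDiff_Ψ k) s x)).congr (by simp)
  have hu : ∀ a, HasDerivAlong (fun y : Jet1 => liftComp U.Φ U.Ψ U.A a y.1) x.1 (totalVec1 s x)
      (D0 s (liftComp U.Φ U.Ψ U.A a) x.1) := fun a =>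
    .comp_fst ⟨(U.contDiff_liftComp a).differentiable (by simp) _, rfl⟩
  exact ((HasDerivAlong.pi fun i => hasDerivAlong_time_totalVec1 (U.contDiff_Φ i) s x).prodMk
    ((HasDerivAlong.pi hz).prodMk (.pi hu))).prodMk
    (.pi fun r => .pi fun a => ⟨(U.contDiff_prolongComp1 a r).differentiable (by simp) _, rfl⟩)

theorem prolongComp_sub_D (s : Fin 2) (x : Jet2) :
    ((((0, 0, fun a => prolongComp1 U.Φ U.Ψ U.A a s x.1),
        fun r a => prolongComp2 U.Φ U.Ψ U.A a r s x) : Jet1) -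
      ((fun i => pd s (U.Φ i) x.1.1.1, fun k => pd s (U.Ψ k) x.1.1.1,
        fun a => D0 s (liftComp U.Φ U.Ψ U.A a) x.1),
        fun r a => D1 s (prolongComp1 U.Φ U.Ψ U.A a r) x)) =
    -(∑ r, pd s (U.Φ r) x.1.1.1 • totalVec1 r x + ((0, fun k => pd s (U.Ψ k) x.1.1.1, 0), 0)) := by
  rw [Fin.sum_univ_two]
  refine Prod.ext (Prod.ext ?_ (Prod.ext ?_ ?_)) ?_
  · ext i
    fin_cases i <;> simp [totalVec1, totalVec0]
  · ext k
    simp [totalVec1, totalVec0]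
  · ext a
    simp [totalVec1, totalVec0, prolongComp1, Fin.sum_univ_two]
  · ext r a
    simp [totalVec1, prolongComp2, Fin.sum_univ_two]

/- The bracket of the prolonged field with `D_s` is `-∑ r, (∂Φʳ/∂tˢ) D_r` up to the `z`-directions,
because the prolongation formulas contain exactly these correction terms. -/
theorem hasDerivAlong_lift2_D1 {F G : Jet1 → ℝ} {x : Jet2} {s : Fin 2} {a : ℝ}
    (hF : ContDiffAt ℝ 2 F x.1) (hz : ∀ v, fderiv ℝ F x.1 ((0, v, 0), 0) = 0)
    (hFG : ∀ᶠ y in 𝓝 x.1, HasDerivAlong F y (U.lift1 y) (G y))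
    (hG : HasDerivAlong G x.1 (totalVec1 s x) a) :
    HasDerivAlong (D1 s F) x (U.lift2 x) (a - ∑ r, pd s (U.Φ r) x.1.1.1 * D1 r F x) := by
  have hlie : (fun y => fderiv ℝ F y (U.lift1 y)) =ᶠ[𝓝 x.1] G := hFG.mono fun y hy => hy.2
  refine (HasDerivAlong.fderiv_comm (p := ContinuousLinearMap.fst ℝ Jet1 _) hF
    (U.hasDerivAlong_totalVec1 s x) (U.hasDerivAlong_lift1_totalVec1 s x) rfl).congr ?_
  simp only [ContinuousLinearMap.coe_fst']
  rw [prolongComp_sub_D, map_neg, map_add, hz, map_sum, add_zero, ← sub_eq_add_neg]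
  simp only [map_smul, smul_eq_mul]
  rw [hlie.fderiv_eq, hG.fderiv_eq]
  rfl

end GeneratingField

/-! ### Bilinear forms transforming under a change of frame -/

/-- The matrix field `M` transforms along `v` at `x` as the components of a bilinear form under
the infinitesimal change of frame `c`: its derivative is `-(c M + M cᵀ)`. -/
def IsCovariantAlong {E : Type*} [NormedAddCommGroup E] [NormedSpace ℝ E]
    (M : E → Matrix (Fin 2) (Fin 2) ℝ) (x v : E) (c : Matrix (Fin 2) (Fin 2) ℝ) : Prop :=
  ∀ a b, HasDerivAlong (fun y => M y a b) x v (-∑ r, (c a r * M x r b + c b r * M x a r))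

namespace IsCovariantAlong

variable {E : Type*} [NormedAddCommGroup E] [NormedSpace ℝ E]
  {M N : E → Matrix (Fin 2) (Fin 2) ℝ} {x v : E} {c : Matrix (Fin 2) (Fin 2) ℝ}

theorem sub (hM : IsCovariantAlong M x v c) (hN : IsCovariantAlong N x v c) :
    IsCovariantAlong (fun y => M y - N y) x v c := fun a b =>
  ((hM a b).sub (hN a b)).congr (by simp only [Fin.sum_univ_two, Matrix.sub_apply]; ring)

theorem const_smul (k : ℝ) (hM : IsCovariantAlong M x v c) :
    IsCovariantAlong (fun y => k • M y) x v c := fun a b =>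
  ((HasDerivAlong.const k).mul (hM a b)).congr
    (by simp only [Fin.sum_univ_two, Matrix.smul_apply, smul_eq_mul]; ring)

theorem det (hM : IsCovariantAlong M x v c) :
    HasDerivAlong (fun y => (M y).det) x v (-2 * c.trace * (M x).det) := by
  simp only [Matrix.det_fin_two, Matrix.trace_fin_two]
  refine (((hM 0 0).mul (hM 1 1)).sub ((hM 0 1).mul (hM 1 0))).congr ?_
  simp only [Fin.sum_univ_two]
  ring

theorem adjugate (hM : IsCovariantAlong M x v c) :
    IsCovariantAlong (fun y => (M y).adjugate) x v c.transpose.adjugate := by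
  intro a b
  simp only [Matrix.adjugate_fin_two, Fin.sum_univ_two]
  fin_cases a <;> fin_cases b
  · exact (hM 1 1).congr (by simp; ring)
  · exact (hM 0 1).neg.congr (by simp)
  · exact (hM 1 0).neg.congr (by simp)
  · exact (hM 0 0).congr (by simp; ring)

theorem inv (hM : IsCovariantAlong M x v c) (h0 : (M x).det ≠ 0) :
    IsCovariantAlong (fun y => (M y)⁻¹) x v (-c.transpose) := by
  intro a b
  simp only [Matrix.inv_def, Ring.inverse_eq_inv', Matrix.smul_apply, smul_eq_mul]
  refine ((hM.det.inv h0).mul (hM.adjugate a b)).congr ?_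
  simp only [Matrix.adjugate_fin_two, Matrix.trace_fin_two, Fin.sum_univ_two]
  fin_cases a <;> fin_cases b <;> simp <;> field_simp <;> ring

theorem pairing (hM : IsCovariantAlong M x v c) (hN : IsCovariantAlong N x v (-c.transpose)) :
    HasDerivAlong (fun y => ∑ i, ∑ j, M y i j * N y i j) x v 0 := by
  refine (HasDerivAlong.sum fun i _ => .sum fun j _ => (hM i j).mul (hN i j)).congr ?_
  simp only [Fin.sum_univ_two, Matrix.neg_apply, Matrix.transpose_apply]
  ring

theorem det_div_det (hM : IsCovariantAlong M x v c) (hN : IsCovariantAlong N x v c)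
    (h0 : (N x).det ≠ 0) : HasDerivAlong (fun y => (M y).det / (N y).det) x v 0 :=
  (hM.det.div hN.det h0).congr (by field_simp; ring)

theorem comp_fst {E' : Type*} [NormedAddCommGroup E'] [NormedSpace ℝ E'] {x v : E × E'}
    (hM : IsCovariantAlong M x.1 v.1 c) : IsCovariantAlong (fun y : E × E' => M y.1) x v c :=
  fun a b => .comp_fst (F := fun y => M y a b) (hM a b)

end IsCovariantAlong

/-! ### First-order quantities in coordinates -/

theorem detG_eq_det (x : Jet0) : detG x = (orbitMetric x).det := by
  simp [detG, orbitMetric, Matrix.det_fin_two, gt_comm 1 0, pow_two]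

theorem gInv_eq_adjugate (i j : Fin 2) (x : Jet0) :
    gInv i j x = (detG x)⁻¹ * (orbitMetric x).adjugate i j := by
  rw [gInv, Matrix.inv_def, Ring.inverse_eq_inv', detG_eq_det, Matrix.smul_apply, smul_eq_mul]

theorem gInv_zero_zero (x : Jet0) : gInv 0 0 x = gt 1 1 x / detG x := by
  simp [gInv_eq_adjugate, Matrix.adjugate_fin_two, orbitMetric, div_eq_inv_mul]

theorem gInv_zero_one (x : Jet0) : gInv 0 1 x = -gt 0 1 x / detG x := by
  simp [gInv_eq_adjugate, Matrix.adjugate_fin_two, orbitMetric, div_eq_inv_mul]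

theorem gInv_one_one (x : Jet0) : gInv 1 1 x = gt 0 0 x / detG x := by
  simp [gInv_eq_adjugate, Matrix.adjugate_fin_two, orbitMetric, div_eq_inv_mul]

theorem orbitMetric_isSymm (x : Jet0) : (orbitMetric x).IsSymm :=
  Matrix.IsSymm.ext fun i j => gt_comm j i x

theorem gInv_comm (i j : Fin 2) (x : Jet0) : gInv i j x = gInv j i x :=
  (orbitMetric_isSymm x).inv.apply j i

theorem sum_gInv_mul_gt {x : Jet0} (hx : detG x ≠ 0) (k r : Fin 2) :
    ∑ l, gInv k l x * gt l r x = (1 : Matrix (Fin 2) (Fin 2) ℝ) k r := by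
  have hdet : IsUnit (orbitMetric x).det := by rwa [isUnit_iff_ne_zero, ← detG_eq_det]
  exact congrFun₂ (Matrix.nonsing_inv_mul _ hdet) k r

theorem sigma_eq (s : Fin 2) (x : Jet1) : sigma s x = (x.2 s (hI 0 0) * hh 1 1 x.1 +
    hh 0 0 x.1 * x.2 s (hI 1 1) - 2 * hh 0 1 x.1 * x.2 s (hI 0 1)) / detH x.1 := by
  have h := fun k l => hasDerivAlong_coord_totalVec0 (hI k l) s x
  exact congrArg (· / detH x.1) (((h 0 0).mul (h 1 1)).sub (h 0 1).sq).fderiv_eq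

theorem chi_eq (a b : Fin 2) (x : Jet1) : chi x a b = ((x.2 a (hI 0 0) * x.2 b (hI 1 1) +
    x.2 b (hI 0 0) * x.2 a (hI 1 1)) / 2 - x.2 a (hI 0 1) * x.2 b (hI 0 1)) / detH x.1 := by
  simp [chi]

theorem curv_eq (k : Fin 2) (x : Jet1) :
    curv k x = (x.2 1 (fI 0 k) - x.2 0 (fI 1 k)) / √|detG x.1| := by
  simp [curv]

theorem thetaI_eq (x : Jet1) : thetaI x = (√|detH x.1|)⁻¹ * (√|detG x.1|)⁻¹ *
    ((x.2 0 (hI 0 0) * x.2 1 (hI 0 1) - x.2 0 (hI 0 1) * x.2 1 (hI 0 0)) * curv 0 x ^ 2 +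
    (x.2 0 (hI 0 0) * x.2 1 (hI 1 1) - x.2 0 (hI 1 1) * x.2 1 (hI 0 0)) * (curv 0 x * curv 1 x) +
    (x.2 0 (hI 0 1) * x.2 1 (hI 1 1) - x.2 0 (hI 1 1) * x.2 1 (hI 0 1)) * curv 1 x ^ 2) := by
  simp only [thetaI, Matrix.det_fin_three, hd_eq, Matrix.of_apply, Matrix.cons_val',
    Matrix.cons_val, Matrix.cons_val_zero, Matrix.cons_val_one, one_div, mul_inv]
  ring

theorem sqrt_abs_ne_zero {r : ℝ} (h : r ≠ 0) : √|r| ≠ 0 := (Real.sqrt_pos.2 (abs_pos.2 h)).ne'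

/-! ### Invariance of the first-order invariants -/

namespace GeneratingField

variable (U : GeneratingField)

/-- The Jacobian matrix of `Φ`, with entries `∂Φʳ/∂tˢ` in row `s` and column `r`. -/
def jacobian (t : Fin 2 → ℝ) : Matrix (Fin 2) (Fin 2) ℝ := Matrix.of fun s r => pd s (U.Φ r) t

theorem isCovariantAlong_orbitMetric (x : Jet1) :
    IsCovariantAlong (fun y : Jet1 => orbitMetric y.1) x (U.lift1 x) (U.jacobian x.1.1) :=
  fun i j => .congr (.comp_fst (F := gt i j) (hasDerivAlong_coord _ _ _)) <| by
    refine (liftComp_gI U.Φ U.Ψ U.A i j x.1).trans ?_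
    simp only [Fin.sum_univ_two, orbitMetric, jacobian, Matrix.of_apply, gt_comm j]
    ring

theorem isCovariantAlong_fibreMetric (x : Jet1) :
    IsCovariantAlong (fun y : Jet1 => Matrix.of fun k l => hh k l y.1) x (U.lift1 x)
      U.A.transpose :=
  fun k l => .congr (.comp_fst (F := hh k l) (hasDerivAlong_coord _ _ _)) <| by
    refine (liftComp_hI U.Φ U.Ψ U.A k l x.1).trans ?_
    simp only [Fin.sum_univ_two, Matrix.transpose_apply, Matrix.of_apply]
    ring

theorem hasDerivAlong_lift1_hh (k l : Fin 2) (x : Jet1) :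
    HasDerivAlong (fun y : Jet1 => hh k l y.1) x (U.lift1 x)
      (-∑ s, (U.A s l * hh k s x.1 + U.A s k * hh s l x.1)) :=
  .congr (.comp_fst (F := hh k l) (hasDerivAlong_coord _ _ _)) (liftComp_hI U.Φ U.Ψ U.A k l x.1)

theorem hasDerivAlong_lift1_dh (s k l : Fin 2) (x : Jet1) :
    HasDerivAlong (fun y : Jet1 => y.2 s (hI k l)) x (U.lift1 x)
      (-∑ r, (U.A r l * x.2 s (hI k r) + U.A r k * x.2 s (hI r l)) -
        ∑ r, U.jacobian x.1.1 s r * x.2 r (hI k l)) :=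
  (hasDerivAlong_coord₁ _ _ _ _).congr (U.prolongComp1_hI k l s x)

theorem hasDerivAlong_lift1_detG (x : Jet1) :
    HasDerivAlong (fun y : Jet1 => detG y.1) x (U.lift1 x)
      (-2 * (U.jacobian x.1.1).trace * detG x.1) := by
  simpa only [detG_eq_det] using (U.isCovariantAlong_orbitMetric x).det

theorem hasDerivAlong_lift1_detH (x : Jet1) :
    HasDerivAlong (fun y : Jet1 => detH y.1) x (U.lift1 x) (-2 * U.A.trace * detH x.1) := by
  simpa [detH, Matrix.det_fin_two, hh_comm 1 0, pow_two] using
    (U.isCovariantAlong_fibreMetric x).det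

theorem isCovariantAlong_gInv {x : Jet1} (hx : detG x.1 ≠ 0) :
    IsCovariantAlong (fun y : Jet1 => Matrix.of fun i j => gInv i j y.1) x (U.lift1 x)
      (-(U.jacobian x.1.1).transpose) :=
  (U.isCovariantAlong_orbitMetric x).inv (detG_eq_det x.1 ▸ hx)

theorem hasDerivAlong_lift1_sigma {x : Jet1} (hx : detH x.1 ≠ 0) (s : Fin 2) :
    HasDerivAlong (sigma s) x (U.lift1 x) (-∑ r, U.jacobian x.1.1 s r * sigma r x) := by
  have hh' := fun k l => U.hasDerivAlong_lift1_hh k l x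
  have dh := fun k l => U.hasDerivAlong_lift1_dh s k l x
  rw [funext (sigma_eq s)]
  refine (HasDerivAlong.div ((((dh 0 0).mul (hh' 1 1)).add ((hh' 0 0).mul (dh 1 1))).sub
    (((HasDerivAlong.const 2).mul (hh' 0 1)).mul (dh 0 1)))
    (U.hasDerivAlong_lift1_detH x) hx).congr ?_
  simp only [Fin.sum_univ_two, hh_comm 1 0, hI_comm 1 0, sigma_eq, Matrix.trace_fin_two]
  field_simp
  ring

theorem isCovariantAlong_rho {x : Jet1} (hx : detH x.1 ≠ 0) :
    IsCovariantAlong rho x (U.lift1 x) (U.jacobian x.1.1) := fun a b =>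
  ((U.hasDerivAlong_lift1_sigma hx a).mul (U.hasDerivAlong_lift1_sigma hx b)).congr <| by
    simp only [Fin.sum_univ_two, rho, Matrix.of_apply]
    ring

theorem isCovariantAlong_chi {x : Jet1} (hx : detH x.1 ≠ 0) :
    IsCovariantAlong chi x (U.lift1 x) (U.jacobian x.1.1) := by
  intro a b
  have dh := fun s k l => U.hasDerivAlong_lift1_dh s k l x
  have hnum := ((((dh a 0 0).mul (dh b 1 1)).add ((dh b 0 0).mul (dh a 1 1))).mul
    (.const (1 / 2))).sub ((dh a 0 1).mul (dh b 0 1))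
  refine ((hnum.div (U.hasDerivAlong_lift1_detH x) hx).congr_of_eventuallyEq
    (.of_forall fun y => ?_)).congr ?_
  · rw [chi_eq, div_eq_mul_one_div (_ + _) (2 : ℝ)]
  · simp only [Fin.sum_univ_two, hI_comm 1 0, chi_eq, Matrix.trace_fin_two]
    field_simp
    ring

theorem isCovariantAlong_gammaForm {x : Jet1} (hx : detH x.1 ≠ 0) :
    IsCovariantAlong gammaForm x (U.lift1 x) (U.jacobian x.1.1) :=
  (U.isCovariantAlong_chi hx).sub ((U.isCovariantAlong_rho hx).const_smul (1 / 4))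

theorem hasDerivAlong_lift1_traceInv {M : Jet1 → Matrix (Fin 2) (Fin 2) ℝ} {x : Jet1}
    (hx : detG x.1 ≠ 0) (hM : IsCovariantAlong M x (U.lift1 x) (U.jacobian x.1.1)) :
    HasDerivAlong (fun y => traceInv (M y) y.1) x (U.lift1 x) 0 :=
  hM.pairing (U.isCovariantAlong_gInv hx)

theorem hasDerivAlong_lift1_detInv {M : Jet1 → Matrix (Fin 2) (Fin 2) ℝ} {x : Jet1}
    (hx : detG x.1 ≠ 0) (hM : IsCovariantAlong M x (U.lift1 x) (U.jacobian x.1.1)) :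
    HasDerivAlong (fun y => detInv (M y) y.1) x (U.lift1 x) 0 := by
  simp only [detInv, detG_eq_det] at hx ⊢
  exact hM.det_div_det (U.isCovariantAlong_orbitMetric x) hx

theorem hasDerivAlong_lift1_curv {x : Jet1} (hx : detG x.1 ≠ 0) (k : Fin 2) :
    HasDerivAlong (curv k) x (U.lift1 x) (∑ l, U.A k l * curv l x) := by
  have hs := sqrt_abs_ne_zero hx
  have hle : (2 : WithTop ℕ∞) ≤ ∞ := WithTop.coe_le_coe.2 le_top
  have df := fun s i => (hasDerivAlong_coord₁ s (fI i k) x (U.lift1 x)).congr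
    (U.prolongComp1_fI i k s x)
  rw [funext (curv_eq k)]
  refine (HasDerivAlong.div ((df 1 0).sub (df 0 1))
    ((U.hasDerivAlong_lift1_detG x).sqrt_abs hx) hs).congr ?_
  simp only [Fin.sum_univ_two, curv_eq, pd_comm ((U.contDiff_Φ _).of_le hle) 1 0,
    pd_comm ((U.contDiff_Ψ _).of_le hle) 1 0, Matrix.trace_fin_two, jacobian, Matrix.of_apply]
  field_simp
  ring

theorem hasDerivAlong_lift1_ellC {x : Jet1} (hx : detG x.1 ≠ 0) :
    HasDerivAlong ellC x (U.lift1 x) 0 := by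
  have hc := U.hasDerivAlong_lift1_curv hx
  refine (HasDerivAlong.sum fun k _ => .sum fun l _ =>
    ((U.hasDerivAlong_lift1_hh k l x).mul (hc k)).mul (hc l)).congr ?_
  simp only [Fin.sum_univ_two, hh_comm 1 0]
  ring

theorem hasDerivAlong_lift1_thetaI {x : Jet1} (hx : detG x.1 ≠ 0) (hx' : detH x.1 ≠ 0) :
    HasDerivAlong thetaI x (U.lift1 x) 0 := by
  have hs := sqrt_abs_ne_zero hx
  have hs' := sqrt_abs_ne_zero hx'
  have hc := U.hasDerivAlong_lift1_curv hx
  have hminor := fun k l m n =>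
    ((U.hasDerivAlong_lift1_dh 0 k l x).mul (U.hasDerivAlong_lift1_dh 1 m n x)).sub
      ((U.hasDerivAlong_lift1_dh 0 m n x).mul (U.hasDerivAlong_lift1_dh 1 k l x))
  have hscale := (((U.hasDerivAlong_lift1_detH x).sqrt_abs hx').inv hs').mul
    (((U.hasDerivAlong_lift1_detG x).sqrt_abs hx).inv hs)
  rw [funext thetaI_eq]
  refine (hscale.mul ((((hminor 0 0 0 1).mul (hc 0).sq).add
    ((hminor 0 0 1 1).mul ((hc 0).mul (hc 1)))).add ((hminor 0 1 1 1).mul (hc 1).sq))).congr ?_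
  simp only [Fin.sum_univ_two, hI_comm 1 0, Matrix.trace_fin_two]
  field_simp
  ring

theorem hasDerivAlong_lift1_firstOrder {x : Jet1} (hx : detG x.1 ≠ 0) (hx' : detH x.1 ≠ 0)
    (a : Fin 6) : HasDerivAlong (firstOrder a) x (U.lift1 x) 0 := by
  fin_cases a
  · exact U.hasDerivAlong_lift1_traceInv hx (U.isCovariantAlong_rho hx')
  · exact U.hasDerivAlong_lift1_traceInv hx (U.isCovariantAlong_chi hx')
  · exact U.hasDerivAlong_lift1_detInv hx (U.isCovariantAlong_chi hx')
  · exact U.hasDerivAlong_lift1_detInv hx (U.isCovariantAlong_gammaForm hx')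
  · exact U.hasDerivAlong_lift1_ellC hx
  · exact (U.hasDerivAlong_lift1_thetaI hx hx').sq.congr (mul_zero _)

end GeneratingField

/-! ### Smoothness of the first-order invariants -/

theorem contDiff_gt (i j : Fin 2) : ContDiff ℝ ∞ (gt i j) := by
  unfold gt
  fun_prop

theorem contDiff_hh (k l : Fin 2) : ContDiff ℝ ∞ (hh k l) := by
  unfold hh
  fun_prop

theorem contDiff_detG : ContDiff ℝ ∞ detG := by
  have := contDiff_gt
  unfold detG
  fun_prop

theorem contDiff_detH : ContDiff ℝ ∞ detH := by
  have := contDiff_hh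
  unfold detH
  fun_prop

/-- The points of the bundle of metrics at which the metric and its restriction to the Killing
leaves are nondegenerate. -/
def regular0 : Set Jet0 := {x | detG x ≠ 0 ∧ detH x ≠ 0}

theorem isOpen_regular0 : IsOpen regular0 :=
  (isOpen_ne_fun contDiff_detG.continuous continuous_const).inter
    (isOpen_ne_fun contDiff_detH.continuous continuous_const)

theorem isOpen_regular : IsOpen regular :=
  isOpen_regular0.preimage (continuous_fst.comp continuous_fst)

theorem eventually_regular0 {x : Jet1} (hx : x.1 ∈ regular0) : ∀ᶠ y in 𝓝 x, y.1 ∈ regular0 :=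
  continuous_fst.continuousAt.eventually (isOpen_regular0.eventually_mem hx)

theorem contDiffAt_sqrt_abs {E : Type*} [NormedAddCommGroup E] [NormedSpace ℝ E] {F : E → ℝ}
    {x : E} (h : ContDiffAt ℝ ∞ F x) (h0 : F x ≠ 0) : ContDiffAt ℝ ∞ (fun y => √|F y|) x :=
  (ContDiffAt.comp x (contDiffAt_abs h0) h).sqrt (abs_ne_zero.2 h0)

theorem contDiffAt_gInv {x : Jet0} (hx : detG x ≠ 0) (i j : Fin 2) :
    ContDiffAt ℝ ∞ (gInv i j) x := by
  have hg := fun i j => (contDiff_gt i j).contDiffAt (x := x)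
  have hd := contDiff_detG.contDiffAt (x := x)
  have h01 : ContDiffAt ℝ ∞ (gInv 0 1) x := funext gInv_zero_one ▸ (hg 0 1).neg.div hd hx
  fin_cases i <;> fin_cases j
  · exact funext gInv_zero_zero ▸ (hg 1 1).div hd hx
  · exact h01
  · exact funext (gInv_comm 0 1) ▸ h01
  · exact funext gInv_one_one ▸ (hg 0 0).div hd hx

theorem contDiffAt_sigma {x : Jet1} (hx : detH x.1 ≠ 0) (s : Fin 2) :
    ContDiffAt ℝ ∞ (sigma s) x :=
  (contDiffAt_D0 contDiff_detH.contDiffAt s).div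
    (contDiff_detH.contDiffAt.comp x contDiffAt_fst) hx

theorem contDiffAt_rho {x : Jet1} (hx : detH x.1 ≠ 0) (a b : Fin 2) :
    ContDiffAt ℝ ∞ (fun y => rho y a b) x :=
  (contDiffAt_sigma hx a).mul (contDiffAt_sigma hx b)

theorem contDiffAt_chi {x : Jet1} (hx : detH x.1 ≠ 0) (a b : Fin 2) :
    ContDiffAt ℝ ∞ (fun y => chi y a b) x := by
  rw [funext (chi_eq a b)]
  exact ContDiffAt.div (by fun_prop) (contDiff_detH.contDiffAt.comp x contDiffAt_fst) hx

theorem contDiffAt_gammaForm {x : Jet1} (hx : detH x.1 ≠ 0) (a b : Fin 2) :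
    ContDiffAt ℝ ∞ (fun y => gammaForm y a b) x :=
  (contDiffAt_chi hx a b).sub (contDiffAt_const.mul (contDiffAt_rho hx a b))

theorem contDiffAt_traceInv {E : Type*} [NormedAddCommGroup E] [NormedSpace ℝ E] {p : E → Jet0}
    {M : E → Matrix (Fin 2) (Fin 2) ℝ} {x : E} (hp : ContDiffAt ℝ ∞ p x) (hx : detG (p x) ≠ 0)
    (hM : ∀ a b, ContDiffAt ℝ ∞ (fun y => M y a b) x) :
    ContDiffAt ℝ ∞ (fun y => traceInv (M y) (p y)) x :=
  ContDiffAt.sum fun i _ => ContDiffAt.sum fun j _ =>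
    (hM i j).mul ((contDiffAt_gInv hx i j).comp x hp)

theorem contDiffAt_detInv {E : Type*} [NormedAddCommGroup E] [NormedSpace ℝ E] {p : E → Jet0}
    {M : E → Matrix (Fin 2) (Fin 2) ℝ} {x : E} (hp : ContDiffAt ℝ ∞ p x) (hx : detG (p x) ≠ 0)
    (hM : ∀ a b, ContDiffAt ℝ ∞ (fun y => M y a b) x) :
    ContDiffAt ℝ ∞ (fun y => detInv (M y) (p y)) x := by
  simp only [detInv, Matrix.det_fin_two]
  exact (((hM 0 0).mul (hM 1 1)).sub ((hM 0 1).mul (hM 1 0))).div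
    (contDiff_detG.contDiffAt.comp x hp) hx

theorem contDiffAt_curv {x : Jet1} (hx : detG x.1 ≠ 0) (k : Fin 2) :
    ContDiffAt ℝ ∞ (curv k) x := by
  rw [funext (curv_eq k)]
  exact ContDiffAt.div (by fun_prop)
    (contDiffAt_sqrt_abs (contDiff_detG.contDiffAt.comp x contDiffAt_fst) hx) (sqrt_abs_ne_zero hx)

theorem contDiffAt_ellC {x : Jet1} (hx : detG x.1 ≠ 0) : ContDiffAt ℝ ∞ ellC x := by
  have hcurv := contDiffAt_curv hx
  have hhh : ∀ k l, ContDiffAt ℝ ∞ (fun y : Jet1 => hh k l y.1) x := fun k l =>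
    (contDiff_hh k l).contDiffAt.comp x contDiffAt_fst
  unfold ellC
  fun_prop

theorem contDiffAt_thetaI {x : Jet1} (hx : x.1 ∈ regular0) : ContDiffAt ℝ ∞ thetaI x := by
  have hcurv := contDiffAt_curv hx.1
  have hG := (contDiffAt_sqrt_abs (contDiff_detG.contDiffAt.comp x contDiffAt_fst) hx.1).inv
    (sqrt_abs_ne_zero hx.1)
  have hH := (contDiffAt_sqrt_abs (contDiff_detH.contDiffAt.comp x contDiffAt_fst) hx.2).inv
    (sqrt_abs_ne_zero hx.2)
  rw [funext thetaI_eq]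
  exact (hH.mul hG).mul (by fun_prop)

theorem contDiffAt_firstOrder {x : Jet1} (hx : x.1 ∈ regular0) (a : Fin 6) :
    ContDiffAt ℝ ∞ (firstOrder a) x := by
  fin_cases a
  · exact contDiffAt_traceInv contDiffAt_fst hx.1 (contDiffAt_rho hx.2)
  · exact contDiffAt_traceInv contDiffAt_fst hx.1 (contDiffAt_chi hx.2)
  · exact contDiffAt_detInv contDiffAt_fst hx.1 (contDiffAt_chi hx.2)
  · exact contDiffAt_detInv contDiffAt_fst hx.1 (contDiffAt_gammaForm hx.2)
  · exact contDiffAt_ellC hx.1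
  · exact (contDiffAt_thetaI hx).pow 2

/-! ### Christoffel symbols -/

/-- Twice the Christoffel symbols of the first kind of the orbit metric. -/
def christoffelFirst (l i j : Fin 2) (x : Jet1) : ℝ :=
  x.2 i (gI j l) + x.2 j (gI i l) - x.2 l (gI i j)

theorem christoffel_eq (k i j : Fin 2) (x : Jet1) :
    christoffel k i j x = (1 / 2) * ∑ l, gInv k l x.1 * christoffelFirst l i j x := by
  simp [christoffel, christoffelFirst]

theorem christoffel_comm (k i j : Fin 2) (x : Jet1) :
    christoffel k i j x = christoffel k j i x := by
  simp only [christoffel_eq, christoffelFirst, gI_comm i j, Fin.sum_univ_two]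
  ring

theorem contDiffAt_christoffel {x : Jet1} (hx : detG x.1 ≠ 0) (k i j : Fin 2) :
    ContDiffAt ℝ ∞ (christoffel k i j) x := by
  have hg := fun l => (contDiffAt_gInv hx k l).comp x contDiffAt_fst
  rw [funext (christoffel_eq k i j)]
  unfold christoffelFirst
  exact contDiffAt_const.mul (ContDiffAt.sum fun l _ => (hg l).mul (by fun_prop))

theorem pd_zero (s : Fin 2) : pd s 0 = 0 := by
  ext t
  simp [pd]

theorem pd_const (s : Fin 2) (c : ℝ) : (pd s fun _ => c) = 0 := by
  ext t
  simp [pd]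

namespace GeneratingField

variable (U : GeneratingField)

theorem hasDerivAlong_lift1_christoffelFirst (l i j : Fin 2) (x : Jet1) :
    HasDerivAlong (christoffelFirst l i j) x (U.lift1 x)
      (-∑ r, (U.jacobian x.1.1 l r * christoffelFirst r i j x +
          U.jacobian x.1.1 i r * christoffelFirst l r j x +
          U.jacobian x.1.1 j r * christoffelFirst l i r x) -
        2 * ∑ r, gt l r x.1 * pd i (pd j (U.Φ r)) x.1.1) := by
  have dg := fun s i j => (hasDerivAlong_coord₁ s (gI i j) x (U.lift1 x)).congr
    (U.prolongComp1_gI i j s x)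
  have hpd := fun r => pd_comm ((U.contDiff_Φ r).of_le (WithTop.coe_le_coe.2 le_top)) 1 0
  refine (((dg i j l).add (dg j i l)).sub (dg l i j)).congr ?_
  simp only [Fin.sum_univ_two, christoffelFirst, jacobian, Matrix.of_apply]
  fin_cases l <;> fin_cases i <;> fin_cases j <;>
    simp only [Fin.zero_eta, Fin.mk_one, gI_comm 1 0, gt_comm 1 0, hpd] <;> ring

/- Raising the index of `hasDerivAlong_lift1_christoffelFirst` turns the metric in front of the
second derivatives of `Φ` into the identity, which gives the affine transformation law. -/
theorem hasDerivAlong_lift1_christoffel {x : Jet1} (hx : detG x.1 ≠ 0) (k i j : Fin 2) :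
    HasDerivAlong (christoffel k i j) x (U.lift1 x)
      (∑ s, (U.jacobian x.1.1 s k * christoffel s i j x -
          U.jacobian x.1.1 i s * christoffel k s j x -
          U.jacobian x.1.1 j s * christoffel k i s x) - pd i (pd j (U.Φ k)) x.1.1) := by
  rw [funext (christoffel_eq k i j)]
  refine ((HasDerivAlong.const (1 / 2)).mul (.sum fun l _ => (U.isCovariantAlong_gInv hx k l).mul
    (U.hasDerivAlong_lift1_christoffelFirst l i j x))).congr ?_
  have hone : pd i (pd j (U.Φ k)) x.1.1 =
      ∑ r, (1 : Matrix (Fin 2) (Fin 2) ℝ) k r * pd i (pd j (U.Φ r)) x.1.1 := by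
    simp [Matrix.one_apply]
  simp only [hone, ← sum_gInv_mul_gt hx, christoffel_eq, Fin.sum_univ_two, Matrix.of_apply,
    Matrix.neg_apply, Matrix.transpose_apply]
  ring

/-- The translation of the Killing leaves by `v`. -/
def translation (v : Fin 2 → ℝ) : GeneratingField where
  Φ := 0
  Ψ k _ := v k
  A := 0
  contDiff_Φ _ := contDiff_const
  contDiff_Ψ _ := contDiff_const

theorem jacobian_translation (v t : Fin 2 → ℝ) : (translation v).jacobian t = 0 := by
  ext s r
  simp [jacobian, translation, pd_zero]

theorem lift1_translation (v : Fin 2 → ℝ) (x : Jet1) :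
    (translation v).lift1 x = ((0, v, 0), 0) := by
  refine Prod.ext (Prod.ext rfl (Prod.ext ?_ ?_)) ?_
  · ext k
    simp [lift1, lift0, translation]
  · ext a
    induction a using FibreIdx.cases <;>
      simp [lift1, lift0, translation, liftComp_gI, liftComp_fI, liftComp_hI, pd_zero, pd_const]
  · ext s a
    induction a using FibreIdx.cases <;>
      simp [lift1, prolongComp1_gI, prolongComp1_fI, prolongComp1_hI] <;>
      simp [translation, pd_zero, pd_const]

end GeneratingField

/-! ### Second-order covariants -/

theorem D0_log_detH {x : Jet1} (hx : detH x.1 ≠ 0) (s : Fin 2) :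
    D0 s (fun y => Real.log |detH y|) x = sigma s x := by
  have hdiff : DifferentiableAt ℝ detH x.1 := contDiff_detH.differentiable (by simp) _
  simp only [D0, sigma, Real.log_abs, fderiv.log hdiff hx, div_eq_inv_mul]
  rfl

theorem hessian_eq {x : Jet2} (hx : detH x.1.1 ≠ 0) (i j : Fin 2) :
    hessian x i j = D1 i (sigma j) x - ∑ k, christoffel k i j x.1 * sigma k x.1 := by
  have hlog : (D0 j fun y => Real.log |detH y|) =ᶠ[𝓝 x.1] sigma j := by
    have hne : ∀ᶠ y : Jet1 in 𝓝 x.1, detH y.1 ≠ 0 :=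
      (contDiff_detH.continuous.comp continuous_fst).continuousAt.eventually_ne hx
    filter_upwards [hne] with y hy using D0_log_detH hy j
  simp only [hessian, Matrix.of_apply, D1, hlog.fderiv_eq, D0_log_detH hx]

theorem hasDerivAlong_D1 {F : Jet1 → ℝ} {x : Jet2} (hF : ContDiffAt ℝ ∞ F x.1) (s : Fin 2) :
    HasDerivAlong F x.1 (totalVec1 s x) (D1 s F x) := ⟨hF.differentiableAt (by simp), rfl⟩

namespace GeneratingField

variable (U : GeneratingField) {x : Jet2}

theorem hasDerivAlong_lift2_D1_firstOrder (hx : x ∈ regular) (a : Fin 6) (s : Fin 2) :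
    HasDerivAlong (D1 s (firstOrder a)) x (U.lift2 x)
      (-∑ r, U.jacobian x.1.1.1 s r * D1 r (firstOrder a) x) :=
  (U.hasDerivAlong_lift2_D1 ((contDiffAt_firstOrder hx a).of_le (WithTop.coe_le_coe.2 le_top))
    (fun v => lift1_translation v x.1 ▸
      ((translation v).hasDerivAlong_lift1_firstOrder hx.1 hx.2 a).fderiv_eq)
    ((eventually_regular0 hx).mono fun _ hy => U.hasDerivAlong_lift1_firstOrder hy.1 hy.2 a)
    (.const 0)).congr (zero_sub _)

theorem hasDerivAlong_lift2_D1_sigma (hx : x ∈ regular) (k s : Fin 2) :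
    HasDerivAlong (D1 s (sigma k)) x (U.lift2 x)
      (-∑ r, (pd s (pd k (U.Φ r)) x.1.1.1 * sigma r x.1 +
          U.jacobian x.1.1.1 k r * D1 s (sigma r) x) -
        ∑ r, U.jacobian x.1.1.1 s r * D1 r (sigma k) x) :=
  U.hasDerivAlong_lift2_D1 ((contDiffAt_sigma hx.2 k).of_le (WithTop.coe_le_coe.2 le_top))
    (fun v => lift1_translation v x.1 ▸
      ((translation v).hasDerivAlong_lift1_sigma hx.2 k).fderiv_eq.trans
        (by simp [jacobian_translation]))
    ((eventually_regular0 hx).mono fun _ hy => U.hasDerivAlong_lift1_sigma hy.2 k)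
    (.neg (.sum fun r _ => (hasDerivAlong_time_totalVec1 (contDiff_pd (U.contDiff_Φ r) k) s x).mul
      (hasDerivAlong_D1 (contDiffAt_sigma hx.2 r) s)))

theorem hasDerivAlong_lift2_D1_christoffel (hx : x ∈ regular) (k i j s : Fin 2) :
    HasDerivAlong (D1 s (christoffel k i j)) x (U.lift2 x)
      (∑ q, (pd s (pd q (U.Φ k)) x.1.1.1 * christoffel q i j x.1 +
            U.jacobian x.1.1.1 q k * D1 s (christoffel q i j) x -
          (pd s (pd i (U.Φ q)) x.1.1.1 * christoffel k q j x.1 +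
            U.jacobian x.1.1.1 i q * D1 s (christoffel k q j) x) -
          (pd s (pd j (U.Φ q)) x.1.1.1 * christoffel k i q x.1 +
            U.jacobian x.1.1.1 j q * D1 s (christoffel k i q) x)) -
        pd s (pd i (pd j (U.Φ k))) x.1.1.1 -
        ∑ r, U.jacobian x.1.1.1 s r * D1 r (christoffel k i j) x) := by
  have hΦ : ∀ v, (translation v).Φ k = 0 := fun _ => rfl
  have hpd := fun q i => hasDerivAlong_time_totalVec1 (contDiff_pd (U.contDiff_Φ q) i) s x
  have hpd' := hasDerivAlong_time_totalVec1 (contDiff_pd (contDiff_pd (U.contDiff_Φ k) j) i) s x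
  have hterm := fun q r k i j => (hpd q r).mul
    (hasDerivAlong_D1 (contDiffAt_christoffel (x := x.1) hx.1 k i j) s)
  exact U.hasDerivAlong_lift2_D1
    ((contDiffAt_christoffel hx.1 k i j).of_le (WithTop.coe_le_coe.2 le_top))
    (fun v => lift1_translation v x.1 ▸
      ((translation v).hasDerivAlong_lift1_christoffel hx.1 k i j).fderiv_eq.trans
        (by simp [jacobian_translation, hΦ, pd_zero]))
    ((eventually_regular0 hx).mono fun _ hy => U.hasDerivAlong_lift1_christoffel hy.1 k i j)
    (.sub (.sum fun q _ => ((hterm _ _ _ _ _).sub (hterm _ _ _ _ _)).sub (hterm _ _ _ _ _)) hpd')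

theorem isCovariantAlong_ricci (hx : x ∈ regular) :
    IsCovariantAlong ricci x (U.lift2 x) (U.jacobian x.1.1.1) := by
  intro i j
  have hD := fun k i j s => U.hasDerivAlong_lift2_D1_christoffel hx k i j s
  have hC := fun k i j => HasDerivAlong.comp_fst (v := U.lift2 x)
    (U.hasDerivAlong_lift1_christoffel (x := x.1) hx.1 k i j)
  refine (HasDerivAlong.add (.sum fun k _ => (hD k i j k).sub (hD k i k j))
    (.sum fun k _ => .sum fun l _ => ((hC k k l).mul (hC l i j)).sub
      ((hC k j l).mul (hC l i k)))).congr ?_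
  have hle : (2 : WithTop ℕ∞) ≤ ∞ := WithTop.coe_le_coe.2 le_top
  have hΓ : ∀ k, christoffel k 1 0 = christoffel k 0 1 := fun k => funext (christoffel_comm k 1 0)
  have hΦ : ∀ k, pd 1 (pd 0 (U.Φ k)) = pd 0 (pd 1 (U.Φ k)) := fun k =>
    funext (pd_comm ((U.contDiff_Φ k).of_le hle) 1 0)
  have hpdΦ : ∀ k s, pd 1 (pd 0 (pd s (U.Φ k))) = pd 0 (pd 1 (pd s (U.Φ k))) := fun k s =>
    funext (pd_comm ((contDiff_pd (U.contDiff_Φ k) s).of_le hle) 1 0)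
  simp only [ricci, jacobian, Matrix.of_apply, Fin.sum_univ_two]
  fin_cases i <;> fin_cases j <;>
    simp only [Fin.zero_eta, Fin.mk_one, hΓ, hpdΦ, hΦ] <;> ring

theorem isCovariantAlong_hessian (hx : x ∈ regular) :
    IsCovariantAlong hessian x (U.lift2 x) (U.jacobian x.1.1.1) := by
  intro i j
  have hC := fun k => HasDerivAlong.comp_fst (v := U.lift2 x)
    (U.hasDerivAlong_lift1_christoffel (x := x.1) hx.1 k i j)
  have hσ := fun k => HasDerivAlong.comp_fst (v := U.lift2 x)
    (U.hasDerivAlong_lift1_sigma (x := x.1) hx.2 k)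
  refine (((U.hasDerivAlong_lift2_D1_sigma hx j i).sub
    (.sum (s := Finset.univ) fun k _ => (hC k).mul (hσ k))).congr_of_eventuallyEq ?_).congr ?_
  · filter_upwards [isOpen_regular.mem_nhds hx] with y hy using hessian_eq hy.2 i j
  · simp only [hessian_eq (x := x) hx.2, Fin.sum_univ_two]
    ring

theorem hasDerivAlong_lift2_traceInv {M : Jet2 → Matrix (Fin 2) (Fin 2) ℝ} (hx : x ∈ regular)
    (hM : IsCovariantAlong M x (U.lift2 x) (U.jacobian x.1.1.1)) :
    HasDerivAlong (fun y => traceInv (M y) y.1.1) x (U.lift2 x) 0 :=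
  hM.pairing (N := fun y : Jet2 => Matrix.of fun i j => gInv i j y.1.1)
    (.comp_fst (M := fun y : Jet1 => Matrix.of fun i j => gInv i j y.1)
      (U.isCovariantAlong_gInv (x := x.1) hx.1))

theorem hasDerivAlong_lift2_XD (hx : x ∈ regular) (a : Fin 6) :
    HasDerivAlong (XD (firstOrder a)) x (U.lift2 x) 0 := by
  have hg := fun i s => (U.isCovariantAlong_gInv (x := x.1) hx.1).comp_fst (v := U.lift2 x) i s
  have hσ := fun s => HasDerivAlong.comp_fst (v := U.lift2 x)
    (U.hasDerivAlong_lift1_sigma (x := x.1) hx.2 s)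
  refine (HasDerivAlong.sum fun i _ => .sum fun s _ =>
    ((hg i s).mul (hσ s)).mul (U.hasDerivAlong_lift2_D1_firstOrder hx a i)).congr ?_
  simp only [Fin.sum_univ_two, Matrix.neg_apply, Matrix.transpose_apply, Matrix.of_apply]
  ring

theorem hasDerivAlong_lift2_XperpD (hx : x ∈ regular) (a : Fin 6) :
    HasDerivAlong (XperpD (firstOrder a)) x (U.lift2 x) 0 := by
  have hs : √|detG x.1.1| ≠ 0 := sqrt_abs_ne_zero hx.1
  have hd : detG x.1.1 ≠ 0 := hx.1
  have hσ := fun s => HasDerivAlong.comp_fst (v := U.lift2 x)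
    (U.hasDerivAlong_lift1_sigma (x := x.1) hx.2 s)
  have hI := U.hasDerivAlong_lift2_D1_firstOrder hx a
  have hG := HasDerivAlong.comp_fst (v := U.lift2 x) ((U.hasDerivAlong_lift1_detG x.1).sqrt_abs hd)
  refine ((((hσ 1).mul (hI 0)).sub ((hσ 0).mul (hI 1))).div hG hs).congr ?_
  simp only [Fin.sum_univ_two, Matrix.trace_fin_two]
  field_simp
  ring

end GeneratingField

/-! ### Smoothness and invariance of the twenty functions -/

theorem contDiffAt_XD {x : Jet2} (hx : x ∈ regular) (a : Fin 6) :
    ContDiffAt ℝ ∞ (XD (firstOrder a)) x := by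
  have hg := fun i s => (contDiffAt_gInv (x := x.1.1) hx.1 i s).comp x
    (f := fun y : Jet2 => y.1.1) (by fun_prop)
  have hσ := fun s => (contDiffAt_sigma (x := x.1) hx.2 s).comp x contDiffAt_fst
  exact ContDiffAt.sum fun i _ => ContDiffAt.sum fun s _ =>
    ((hg i s).mul (hσ s)).mul (contDiffAt_D1 (contDiffAt_firstOrder hx a) i)

theorem contDiffAt_XperpD {x : Jet2} (hx : x ∈ regular) (a : Fin 6) :
    ContDiffAt ℝ ∞ (XperpD (firstOrder a)) x := by
  have hσ := fun s => (contDiffAt_sigma (x := x.1) hx.2 s).comp x contDiffAt_fst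
  have hI := fun i => contDiffAt_D1 (contDiffAt_firstOrder hx a) i
  have hG : ContDiffAt ℝ ∞ (fun y : Jet2 => detG y.1.1) x :=
    contDiff_detG.contDiffAt.comp x (contDiffAt_fst.comp x contDiffAt_fst)
  exact (((hσ 1).mul (hI 0)).sub ((hσ 0).mul (hI 1))).div (contDiffAt_sqrt_abs hG hx.1)
    (sqrt_abs_ne_zero hx.1)

theorem contDiffAt_Cric {x : Jet2} (hx : x ∈ regular) : ContDiffAt ℝ ∞ Cric x := by
  have hC := fun k i j => (contDiffAt_christoffel (x := x.1) hx.1 k i j).comp x contDiffAt_fst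
  have hD := fun k i j s => contDiffAt_D1 (contDiffAt_christoffel (x := x.1) hx.1 k i j) s
  refine contDiffAt_traceInv (p := fun y : Jet2 => y.1.1) (by fun_prop) hx.1 fun i j => ?_
  exact (ContDiffAt.sum fun k _ => (hD k i j k).sub (hD k i k j)).add
    (ContDiffAt.sum fun k _ => ContDiffAt.sum fun l _ => ((hC k k l).mul (hC l i j)).sub
      ((hC k j l).mul (hC l i k)))

theorem contDiffAt_Cnu {x : Jet2} (hx : x ∈ regular) : ContDiffAt ℝ ∞ Cnu x := by
  have hC := fun k i j => (contDiffAt_christoffel (x := x.1) hx.1 k i j).comp x contDiffAt_fst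
  have hσ := fun s => (contDiffAt_sigma (x := x.1) hx.2 s).comp x contDiffAt_fst
  refine contDiffAt_traceInv (p := fun y : Jet2 => y.1.1) (by fun_prop) hx.1 fun i j => ?_
  refine ((contDiffAt_D1 (contDiffAt_sigma hx.2 j) i).sub (ContDiffAt.sum (s := Finset.univ)
    fun k _ => (hC k i j).mul (hσ k))).congr_of_eventuallyEq ?_
  filter_upwards [isOpen_regular.mem_nhds hx] with y hy using hessian_eq hy.2 i j

theorem isInvariantOn_of_hasDerivAlong {F : Jet2 → ℝ} {W : Set Jet2}
    (hF : ∀ x ∈ W, ContDiffAt ℝ ∞ F x)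
    (hU : ∀ (U : GeneratingField), ∀ x ∈ W, HasDerivAlong F x (U.lift2 x) 0) : IsInvariantOn F W :=
  ⟨fun x hx => (hF x hx).contDiffWithinAt,
    fun Φ Ψ A hΦ hΨ x hx => (hU ⟨Φ, Ψ, A, hΦ, hΨ⟩ x hx).fderiv_eq⟩

theorem isInvariantOn_firstOrder (a : Fin 6) :
    IsInvariantOn (fun x => firstOrder a x.1) regular :=
  isInvariantOn_of_hasDerivAlong
    (fun x hx => (contDiffAt_firstOrder (x := x.1) hx a).comp x contDiffAt_fst)
    fun U x hx => .comp_fst (U.hasDerivAlong_lift1_firstOrder (x := x.1) hx.1 hx.2 a)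

theorem isInvariantOn_XD (a : Fin 6) : IsInvariantOn (XD (firstOrder a)) regular :=
  isInvariantOn_of_hasDerivAlong (fun _ hx => contDiffAt_XD hx a)
    fun U _ hx => U.hasDerivAlong_lift2_XD hx a

theorem isInvariantOn_XperpD (a : Fin 6) : IsInvariantOn (XperpD (firstOrder a)) regular :=
  isInvariantOn_of_hasDerivAlong (fun _ hx => contDiffAt_XperpD hx a)
    fun U _ hx => U.hasDerivAlong_lift2_XperpD hx a

theorem isInvariantOn_Cric : IsInvariantOn Cric regular :=
  isInvariantOn_of_hasDerivAlong (fun _ => contDiffAt_Cric)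
    fun U _ hx => U.hasDerivAlong_lift2_traceInv hx (U.isCovariantAlong_ricci hx)

theorem isInvariantOn_Cnu : IsInvariantOn Cnu regular :=
  isInvariantOn_of_hasDerivAlong (fun _ => contDiffAt_Cnu)
    fun U _ hx => U.hasDerivAlong_lift2_traceInv hx (U.isCovariantAlong_hessian hx)

theorem IsInvariantOn.add {F G : Jet2 → ℝ} {W : Set Jet2} (hW : IsOpen W)
    (hF : IsInvariantOn F W) (hG : IsInvariantOn G W) : IsInvariantOn (F + G) W := by
  refine ⟨hF.1.add hG.1, fun Φ Ψ A hΦ hΨ x hx => ?_⟩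
  have hdiff : ∀ {H}, IsInvariantOn H W → DifferentiableAt ℝ H x := fun hH =>
    (hH.1.contDiffAt (hW.mem_nhds hx)).differentiableAt (by simp)
  rw [fderiv_add (hdiff hF) (hdiff hG), add_apply, hF.2 Φ Ψ A hΦ hΨ x hx,
    hG.2 Φ Ψ A hΦ hΨ x hx, add_zero]

theorem IsInvariantOn.const_smul {F : Jet2 → ℝ} {W : Set Jet2} (c : ℝ)
    (hF : IsInvariantOn F W) : IsInvariantOn (c • F) W :=
  ⟨contDiffOn_const.smul hF.1, fun Φ Ψ A hΦ hΨ x hx => by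
    rw [fderiv_const_smul_field, Pi.smul_apply, smul_apply,
      hF.2 Φ Ψ A hΦ hΨ x hx, smul_zero]⟩

theorem isInvariantOn_Cnu' : IsInvariantOn Cnu' regular := by
  have hsum : Cnu' = Cnu + (-2 : ℝ) • (fun x : Jet2 => firstOrder 1 x.1) +
      fun x : Jet2 => firstOrder 0 x.1 := by
    ext x
    simp only [Cnu', firstOrder, Pi.add_apply, Pi.smul_apply, smul_eq_mul, Matrix.cons_val]
    ring
  rw [hsum]
  exact (isInvariantOn_Cnu.add isOpen_regular ((isInvariantOn_firstOrder 1).const_smul _)).add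
    isOpen_regular (isInvariantOn_firstOrder 0)

theorem isInvariantOn_twenty {c : Jet2 → ℝ} (hc : IsInvariantOn c regular)
    (a : Fin 6 ⊕ Fin 6 ⊕ Fin 6 ⊕ Fin 2) : IsInvariantOn (twenty c a) regular := by
  rcases a with a | a | a | b
  · exact isInvariantOn_firstOrder a
  · exact isInvariantOn_XD a
  · exact isInvariantOn_XperpD a
  · fin_cases b
    exacts [isInvariantOn_Cric, hc]

/-! ### Freeness of the prolonged action -/

/-- The function `φ` and its partial derivatives of order at most three vanish at `t`. -/
structure HasZeroThreeJet (φ : (Fin 2 → ℝ) → ℝ) (t : Fin 2 → ℝ) : Prop where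
  apply_eq_zero : φ t = 0
  pd_eq_zero : ∀ i, pd i φ t = 0
  pd_pd_eq_zero : ∀ i j, pd i (pd j φ) t = 0
  pd_pd_pd_eq_zero : ∀ i j k, pd i (pd j (pd k φ)) t = 0

/-- The components `00, 01, 11` of `h` and of its two derivatives along the orbit space. -/
def fibreWronskian (x : Jet1) : Matrix (Fin 3) (Fin 3) ℝ :=
  !![hh 0 0 x.1, hh 0 1 x.1, hh 1 1 x.1;
     x.2 0 (hI 0 0), x.2 0 (hI 0 1), x.2 0 (hI 1 1);
     x.2 1 (hI 0 0), x.2 1 (hI 0 1), x.2 1 (hI 1 1)]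

theorem eq_zero_of_det_eq_zero_of_transpose_mul_eq_neg {K : Type*} [Field K] [CharZero K]
    {B G : Matrix (Fin 2) (Fin 2) K} (hB : B.det = 0) (hG : G.det ≠ 0)
    (h : (B * G).transpose = -(B * G)) : B = 0 := by
  have hskew : ∀ i j, (B * G) j i = -(B * G) i j := fun i j => congrFun₂ h i j
  have hdiag : ∀ i, (B * G) i i = 0 := fun i => self_eq_neg.1 (hskew i i)
  have h01 : (B * G) 0 1 = 0 := by
    have hdet : (B * G).det = 0 := by rw [Matrix.det_mul, hB, zero_mul]
    rw [Matrix.det_fin_two, hdiag, hskew 0 1] at hdet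
    simpa using hdet
  have hzero : B * G = 0 := by
    ext i j
    fin_cases i <;> fin_cases j
    exacts [hdiag 0, h01, (hskew 0 1).trans (by rw [h01, neg_zero]; rfl), hdiag 1]
  calc B = B * (G * G⁻¹) := by rw [Matrix.mul_nonsing_inv G hG.isUnit, mul_one]
    _ = 0 := by rw [← mul_assoc, hzero, zero_mul]

theorem eq_zero_of_det_fibreWronskian_ne_zero {x : Jet1} (hx : (fibreWronskian x).det ≠ 0)
    {A : Matrix (Fin 2) (Fin 2) ℝ} (hA : ∀ k, A 0 k * hh k 0 x.1 + A 1 k * hh k 1 x.1 = 0)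
    (hdA : ∀ s k, A 0 k * x.2 s (hI k 0) + A 1 k * x.2 s (hI k 1) = 0) : A = 0 := by
  have hcol₀ : ![A 0 0, A 1 0, 0] = 0 := by
    refine Matrix.eq_zero_of_mulVec_eq_zero hx (funext fun i => ?_)
    fin_cases i <;> simp [fibreWronskian, Matrix.mulVec, dotProduct, Fin.sum_univ_three]
    · linarith [hA 0]
    · linarith [hdA 0 0]
    · linarith [hdA 1 0]
  have hcol₁ : ![0, A 0 1, A 1 1] = 0 := by
    refine Matrix.eq_zero_of_mulVec_eq_zero hx (funext fun i => ?_)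
    fin_cases i <;> simp [fibreWronskian, Matrix.mulVec, dotProduct, Fin.sum_univ_three]
    · linarith [hh_comm 1 0 x.1 ▸ hA 1]
    · linarith [hI_comm 1 0 ▸ hdA 0 1]
    · linarith [hI_comm 1 0 ▸ hdA 1 1]
  ext k l
  fin_cases k <;> fin_cases l
  exacts [congrFun hcol₀ 0, congrFun hcol₁ 1, congrFun hcol₀ 1, congrFun hcol₁ 2]

namespace GeneratingField

variable {U : GeneratingField}

theorem jacobian_eq_zero {x : Jet1} (hx : x.1 ∈ regular0) (hσ : (fun s => sigma s x) ≠ 0)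
    (hU : U.lift1 x = 0) : U.jacobian x.1.1 = 0 := by
  have hdet : (U.jacobian x.1.1).det = 0 := by
    refine Matrix.exists_mulVec_eq_zero_iff.1 ⟨fun s => sigma s x, hσ, funext fun s => ?_⟩
    have hs := U.hasDerivAlong_lift1_sigma hx.2 s
    rw [hU] at hs
    exact neg_eq_zero.1 hs.eq_zero
  refine eq_zero_of_det_eq_zero_of_transpose_mul_eq_neg hdet (detG_eq_det x.1 ▸ hx.1)
    (Matrix.ext fun i j => ?_)
  have hij := U.isCovariantAlong_orbitMetric x i j
  rw [hU] at hij
  have hzero := hij.eq_zero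
  simp only [Matrix.transpose_apply, Matrix.neg_apply, Matrix.mul_apply, Fin.sum_univ_two,
    (orbitMetric_isSymm x.1).apply i] at hzero ⊢
  linarith

theorem A_eq_zero {x : Jet1} (hx : (fibreWronskian x).det ≠ 0) (hU : U.lift1 x = 0)
    (hJ : U.jacobian x.1.1 = 0) : U.A = 0 := by
  refine eq_zero_of_det_fibreWronskian_ne_zero hx (fun k => ?_) fun s k => ?_
  · have h := U.hasDerivAlong_lift1_hh k k x
    rw [hU] at h
    have hzero := h.eq_zero
    simp only [Fin.sum_univ_two, hh_comm _ k] at hzero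
    linarith
  · have h := U.hasDerivAlong_lift1_dh s k k x
    rw [hU, hJ] at h
    have hzero := h.eq_zero
    simp only [Matrix.zero_apply, zero_mul, Finset.sum_const_zero, sub_zero, neg_eq_zero,
      Fin.sum_univ_two, hI_comm _ k] at hzero
    linarith

theorem pd_pd_Φ_eq_zero {x : Jet1} (hx : detG x.1 ≠ 0) (hU : U.lift1 x = 0)
    (hJ : U.jacobian x.1.1 = 0) (i j k : Fin 2) : pd i (pd j (U.Φ k)) x.1.1 = 0 := by
  have h := U.hasDerivAlong_lift1_christoffel hx k i j
  rw [hU, hJ] at h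
  simpa using h.eq_zero

theorem hasZeroThreeJet_Φ {x : Jet2} (hx : x ∈ regular) (hU : U.lift2 x = 0)
    (hJ : U.jacobian x.1.1.1 = 0) (k : Fin 2) : HasZeroThreeJet (U.Φ k) x.1.1.1 where
  apply_eq_zero := congrArg (fun v : Jet2 => v.1.1.1 k) hU
  pd_eq_zero i := congrFun₂ hJ i k
  pd_pd_eq_zero i j := pd_pd_Φ_eq_zero hx.1 (congrArg Prod.fst hU) hJ i j k
  pd_pd_pd_eq_zero s i j := by
    have h := U.hasDerivAlong_lift2_D1_christoffel hx k i j s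
    rw [hU, hJ] at h
    simpa [pd_pd_Φ_eq_zero hx.1 (congrArg Prod.fst hU) hJ] using h.eq_zero

theorem hasZeroThreeJet_Ψ {x : Jet2} (hU : U.lift2 x = 0) (hA : U.A = 0)
    (hΦ : ∀ i, HasZeroThreeJet (U.Φ i) x.1.1.1) (k : Fin 2) :
    HasZeroThreeJet (U.Ψ k) x.1.1.1 where
  apply_eq_zero := by
    have h : ∑ l, U.A k l * x.1.1.2.1 l + U.Ψ k x.1.1.1 = 0 :=
      congrArg (fun v : Jet2 => v.1.1.2.1 k) hU
    simpa [hA] using h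
  pd_eq_zero i := by
    have h : liftComp U.Φ U.Ψ U.A (fI i k) x.1.1 = 0 :=
      congrArg (fun v : Jet2 => v.1.1.2.2 (fI i k)) hU
    simpa [liftComp_fI, hA, (hΦ _).pd_eq_zero] using h
  pd_pd_eq_zero s i := by
    have h : prolongComp1 U.Φ U.Ψ U.A (fI i k) s x.1 = 0 :=
      congrArg (fun v : Jet2 => v.1.2 s (fI i k)) hU
    rw [prolongComp1_fI] at h
    simpa [hA, (hΦ _).pd_eq_zero, (hΦ _).pd_pd_eq_zero] using h
  pd_pd_pd_eq_zero s r i := by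
    have h : prolongComp2 U.Φ U.Ψ U.A (fI i k) r s x = 0 :=
      (U.lift2_snd r s (fI i k) x).symm.trans (congrArg (fun v : Jet2 => v.2 s(r, s) (fI i k)) hU)
    rw [prolongComp2_fI] at h
    simpa [hA, (hΦ _).pd_eq_zero, (hΦ _).pd_pd_eq_zero,
      (hΦ _).pd_pd_pd_eq_zero] using h

end GeneratingField

/-! ### Cubic fields -/

/-- The cubic polynomial about `t₀` with the given derivatives at `t₀`, listed in the order
`∅, 0, 1, 00, 01, 11, 000, 001, 011, 111`. -/
def cubic (t₀ : Fin 2 → ℝ) (c : Fin 10 → ℝ) (t : Fin 2 → ℝ) : ℝ :=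
  c 0 + (c 1 * (t 0 - t₀ 0) + c 2 * (t 1 - t₀ 1)) +
  (c 3 / 2 * (t 0 - t₀ 0) ^ 2 + c 4 * ((t 0 - t₀ 0) * (t 1 - t₀ 1)) +
    c 5 / 2 * (t 1 - t₀ 1) ^ 2) +
  (c 6 / 6 * ((t 0 - t₀ 0) ^ 2 * (t 0 - t₀ 0)) + c 7 / 2 * ((t 0 - t₀ 0) ^ 2 * (t 1 - t₀ 1)) +
    c 8 / 2 * ((t 0 - t₀ 0) * (t 1 - t₀ 1) ^ 2) + c 9 / 6 * ((t 1 - t₀ 1) ^ 2 * (t 1 - t₀ 1)))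

/-- The coefficients of a partial derivative of a cubic polynomial. -/
def cubicPd (s : Fin 2) : (Fin 10 → ℝ) →ₗ[ℝ] Fin 10 → ℝ where
  toFun c :=
    ![![c 1, c 3, c 4, c 6, c 7, c 8, 0, 0, 0, 0], ![c 2, c 4, c 5, c 7, c 8, c 9, 0, 0, 0, 0]] s
  map_add' c d := by fin_cases s <;> ext i <;> fin_cases i <;> simp
  map_smul' r c := by fin_cases s <;> ext i <;> fin_cases i <;> simp

theorem contDiff_cubic (t₀ : Fin 2 → ℝ) (c : Fin 10 → ℝ) : ContDiff ℝ ∞ (cubic t₀ c) := by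
  unfold cubic
  fun_prop

theorem cubic_self (t₀ : Fin 2 → ℝ) (c : Fin 10 → ℝ) : cubic t₀ c t₀ = c 0 := by
  simp [cubic]

theorem pd_cubic (t₀ : Fin 2 → ℝ) (s : Fin 2) (c : Fin 10 → ℝ) :
    pd s (cubic t₀ c) = cubic t₀ (cubicPd s c) := by
  ext t
  have hu : ∀ i, HasDerivAlong (fun t : Fin 2 → ℝ => t i - t₀ i) t (Pi.single s 1)
      ((Pi.single s 1 : Fin 2 → ℝ) i) := fun i =>
    (((HasDerivAlong.id t _).apply i).sub (.const _)).congr (sub_zero _)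
  have hterm : ∀ {F : (Fin 2 → ℝ) → ℝ} {d : ℝ} (r : ℝ), HasDerivAlong F t (Pi.single s 1) d →
      HasDerivAlong (fun t => r * F t) t (Pi.single s 1) (0 * F t + r * d) := fun r h =>
    (HasDerivAlong.const r).mul h
  refine HasDerivAlong.fderiv_eq (((((HasDerivAlong.const (c 0)).add
    ((hterm (c 1) (hu 0)).add (hterm (c 2) (hu 1)))).add
    (((hterm (c 3 / 2) (hu 0).sq).add (hterm (c 4) ((hu 0).mul (hu 1)))).add
      (hterm (c 5 / 2) (hu 1).sq))).add
    ((((hterm (c 6 / 6) ((hu 0).sq.mul (hu 0))).add (hterm (c 7 / 2) ((hu 0).sq.mul (hu 1)))).add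
      (hterm (c 8 / 2) ((hu 0).mul (hu 1).sq))).add
      (hterm (c 9 / 6) ((hu 1).sq.mul (hu 1))))).congr ?_)
  fin_cases s <;> simp [cubic, cubicPd] <;> ring

theorem HasZeroThreeJet.eq_zero_of_cubic {t₀ : Fin 2 → ℝ} {c : Fin 10 → ℝ}
    (h : HasZeroThreeJet (cubic t₀ c) t₀) : c = 0 := by
  have hval := h.apply_eq_zero
  have hpd := h.pd_eq_zero
  have hpd₂ := h.pd_pd_eq_zero
  have hpd₃ := h.pd_pd_pd_eq_zero
  simp only [pd_cubic, cubic_self] at hval hpd hpd₂ hpd₃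
  ext i
  fin_cases i
  exacts [hval, hpd 0, hpd 1, hpd₂ 0 0, hpd₂ 0 1, hpd₂ 1 1, hpd₃ 0 0 0, hpd₃ 0 0 1, hpd₃ 0 1 1,
    hpd₃ 1 1 1]

/-- The parameters `(Φ, Ψ, A)` of the generating fields with cubic `Φ` and `Ψ`. -/
abbrev CubicParam : Type := (Fin 2 → Fin 10 → ℝ) × (Fin 2 → Fin 10 → ℝ) × (Fin 2 → Fin 2 → ℝ)

/-- The generating field with cubic `Φ` and `Ψ` having the given derivatives at `t₀`. -/
def cubicField (t₀ : Fin 2 → ℝ) (p : CubicParam) : GeneratingField where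
  Φ i := cubic t₀ (p.1 i)
  Ψ k := cubic t₀ (p.2.1 k)
  A := p.2.2
  contDiff_Φ i := contDiff_cubic t₀ (p.1 i)
  contDiff_Ψ k := contDiff_cubic t₀ (p.2.1 k)

namespace GeneratingField

theorem lift2_cubicField_smul_add (x : Jet2) (r : ℝ) (p q : CubicParam) :
    (cubicField x.1.1.1 (r • p + q)).lift2 x =
      r • (cubicField x.1.1.1 p).lift2 x + (cubicField x.1.1.1 q).lift2 x := by
  refine Prod.ext (Prod.ext (Prod.ext (funext fun i => ?_) (Prod.ext (funext fun k => ?_)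
    (funext fun a => ?_))) (funext₂ fun s a => ?_)) (funext₂ fun b a => ?_)
  · simp [prolongedField, cubicField, cubic_self]
  · simp [prolongedField, cubicField, cubic_self]
    ring
  · change liftComp _ _ _ a x.1.1 = r * liftComp _ _ _ a x.1.1 + liftComp _ _ _ a x.1.1
    induction a using FibreIdx.cases <;>
      simp only [liftComp_gI, liftComp_fI, liftComp_hI, Fin.sum_univ_two] <;>
      simp [cubicField, pd_cubic, cubic_self] <;> ring
  · change prolongComp1 _ _ _ a s x.1 = r * prolongComp1 _ _ _ a s x.1 + prolongComp1 _ _ _ a s x.1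
    induction a using FibreIdx.cases <;>
      simp only [prolongComp1_gI, prolongComp1_fI, prolongComp1_hI, Fin.sum_univ_two] <;>
      simp [cubicField, pd_cubic, cubic_self] <;> ring
  · induction b with | _ b s
    simp only [Prod.snd_add, Prod.smul_snd, Pi.add_apply, Pi.smul_apply, smul_eq_mul, lift2_snd]
    induction a using FibreIdx.cases <;>
      simp only [prolongComp2_gI, prolongComp2_fI, prolongComp2_hI, Fin.sum_univ_two] <;>
      simp [cubicField, pd_cubic, cubic_self] <;> ring

theorem lift2_cubicField_injective {x : Jet2} (hx : x ∈ regular)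
    (hW : (fibreWronskian x.1).det ≠ 0) (hσ : (fun s => sigma s x.1) ≠ 0) {p : CubicParam}
    (hp : (cubicField x.1.1.1 p).lift2 x = 0) : p = 0 := by
  have hp₁ : (cubicField x.1.1.1 p).lift1 x.1 = 0 := congrArg Prod.fst hp
  have hJ := jacobian_eq_zero (x := x.1) hx hσ hp₁
  have hA := A_eq_zero hW hp₁ hJ
  have hΦ := hasZeroThreeJet_Φ hx hp hJ
  have hΨ := hasZeroThreeJet_Ψ hp hA hΦ
  exact Prod.ext (funext fun i => (hΦ i).eq_zero_of_cubic)
    (Prod.ext (funext fun k => (hΨ k).eq_zero_of_cubic) hA)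

end GeneratingField

theorem finrank_jet2 : Module.finrank ℝ Jet2 = 64 := by
  have hcard : Fintype.card (Sym2 (Fin 2)) = 3 := by decide
  simp [Module.finrank_pi_fintype, hcard]

theorem finrank_cubicParam : Module.finrank ℝ CubicParam = 44 := by
  simp [Module.finrank_pi_fintype]

/- The orbit of `x` is 44-dimensional, so it has codimension 20 in the space of second jets. -/
theorem exists_lift2_eq {ι : Type} [Fintype ι] (hι : Fintype.card ι = 20) {x : Jet2}
    (hx : x ∈ regular) (hW : (fibreWronskian x.1).det ≠ 0) (hσ : (fun s => sigma s x.1) ≠ 0)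
    {L : ι → Jet2 →ₗ[ℝ] ℝ} (hL : LinearIndependent ℝ L)
    (hLU : ∀ (a : ι) (U : GeneratingField), L a (U.lift2 x) = 0) {v : Jet2}
    (hv : ∀ a, L a v = 0) : ∃ U : GeneratingField, U.lift2 x = v := by
  have hlin := GeneratingField.lift2_cubicField_smul_add x
  have hzero : (cubicField x.1.1.1 0).lift2 x = 0 := by simpa using hlin 1 0 0
  let P : CubicParam →ₗ[ℝ] Jet2 :=
    { toFun := fun p => (cubicField x.1.1.1 p).lift2 x
      map_add' := fun p q => by simpa using hlin 1 p q
      map_smul' := fun r p => by simpa [hzero] using hlin r p 0 }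
  have hP : Function.Injective P := (injective_iff_map_eq_zero P).2 fun p =>
    GeneratingField.lift2_cubicField_injective hx hW hσ
  have hle : P.range ≤ (LinearMap.pi L).ker := by
    rintro _ ⟨p, rfl⟩
    exact funext fun a => hLU a _
  have hfinrank : Module.finrank ℝ (LinearMap.pi L).ker = Module.finrank ℝ P.range := by
    have hker := (LinearMap.pi L).finrank_range_add_finrank_ker
    rw [LinearMap.range_eq_top.2 (pi_surjective_of_linearIndependent hL), finrank_top,
      Module.finrank_fintype_fun_eq_card, hι, finrank_jet2] at hker
    rw [LinearMap.finrank_range_of_inj hP, finrank_cubicParam]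
    omega
  have hmem : v ∈ P.range := by
    rw [Submodule.eq_of_le_of_finrank_eq hle hfinrank.symm]
    exact funext hv
  obtain ⟨p, hp⟩ := hmem
  exact ⟨cubicField x.1.1.1 p, hp⟩

/-! ### Derivatives along the fibres of the jet projections -/

theorem hasDerivAlong_fst_vertical {E E' : Type*} [NormedAddCommGroup E] [NormedSpace ℝ E]
    [NormedAddCommGroup E'] [NormedSpace ℝ E'] {F : E → ℝ} {x : E × E'}
    (hF : DifferentiableAt ℝ F x.1) (w : E') :
    HasDerivAlong (fun y : E × E' => F y.1) x (0, w) 0 :=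
  .comp_fst ⟨hF, map_zero _⟩

theorem hasDerivAlong_totalVec1_vertical (s : Fin 2) (x : Jet2)
    (q : Sym2 (Fin 2) → FibreIdx → ℝ) :
    HasDerivAlong (totalVec1 s) x (0, q) (0, fun r => q s(r, s)) :=
  .prodMk (.prodMk (.const _) (.prodMk (.const _) (.pi fun a =>
    .comp_fst (F := fun y : Jet1 => y.2 s a) (hasDerivAlong_coord₁ s a x.1 0))))
    (.pi fun _ => .pi fun a => hasDerivAlong_coord₂ _ a _ _)

theorem hasDerivAlong_D1_vertical {F : Jet1 → ℝ} {x : Jet2} (hF : ContDiffAt ℝ 2 F x.1)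
    (s : Fin 2) (q : Sym2 (Fin 2) → FibreIdx → ℝ) {d : ℝ}
    (hd : HasDerivAlong F x.1 (0, fun r => q s(r, s)) d) :
    HasDerivAlong (D1 s F) x (0, q) d := by
  have hF' : HasFDerivAt (fderiv ℝ F) (fderiv ℝ (fderiv ℝ F) x.1) x.1 :=
    ((hF.fderiv_right (m := 1) le_rfl).differentiableAt one_ne_zero).hasFDerivAt
  have hT := hasDerivAlong_totalVec1_vertical s x q
  refine .of_hasFDerivAt ((hF'.comp x hasFDerivAt_fst).clm_apply hT.1.hasFDerivAt) ?_
  simp [hT.2, hd.2]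

/-- The polarization of `det h`, as a bilinear form in the fibre coordinates. -/
def mixedDet (m n : FibreIdx → ℝ) : ℝ :=
  (m (hI 0 0) * n (hI 1 1) + n (hI 0 0) * m (hI 1 1)) / 2 - m (hI 0 1) * n (hI 0 1)

theorem mixedDet_comm (m n : FibreIdx → ℝ) : mixedDet m n = mixedDet n m := by
  unfold mixedDet
  ring

theorem mixedDet_eq_zero {n : FibreIdx → ℝ} (hn : ∀ k l, n (hI k l) = 0) (m : FibreIdx → ℝ) :
    mixedDet m n = 0 := by
  simp [mixedDet, hn]

theorem hasDerivAlong_mixedDet {E : Type*} [NormedAddCommGroup E] [NormedSpace ℝ E]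
    {F G : E → FibreIdx → ℝ} {x v : E} {m n : FibreIdx → ℝ} (hF : HasDerivAlong F x v m)
    (hG : HasDerivAlong G x v n) :
    HasDerivAlong (fun y => mixedDet (F y) (G y)) x v (mixedDet m (G x) + mixedDet (F x) n) := by
  refine ((((hF.apply _).mul (hG.apply _)).add ((hG.apply _).mul (hF.apply _))).mul
    (.const (2⁻¹)) |>.sub ((hF.apply _).mul (hG.apply _))).congr ?_
  unfold mixedDet
  ring

theorem sigma_eq_mixedDet (s : Fin 2) (x : Jet1) :
    sigma s x = 2 * mixedDet x.1.2.2 (x.2 s) / detH x.1 := by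
  rw [sigma_eq, mixedDet, hh, hh, hh]
  ring

theorem chi_eq_mixedDet (a b : Fin 2) (x : Jet1) :
    chi x a b = mixedDet (x.2 a) (x.2 b) / detH x.1 := chi_eq a b x

theorem chi_comm (a b : Fin 2) (x : Jet1) : chi x a b = chi x b a := by
  rw [chi_eq_mixedDet, chi_eq_mixedDet, mixedDet_comm]

theorem rho_comm (a b : Fin 2) (x : Jet1) : rho x a b = rho x b a := mul_comm _ _

theorem gammaForm_comm (a b : Fin 2) (x : Jet1) : gammaForm x a b = gammaForm x b a := by
  simp only [gammaForm, Matrix.sub_apply, Matrix.smul_apply, chi_comm a b, rho_comm a b]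

section FirstOrder

variable {x : Jet1} (δ : Fin 2 → FibreIdx → ℝ)

theorem hasDerivAlong_hh_vertical (k l : Fin 2) :
    HasDerivAlong (fun y : Jet1 => hh k l y.1) x (0, δ) 0 :=
  hasDerivAlong_fst_vertical ((contDiff_hh k l).differentiable (by simp) _) δ

theorem hasDerivAlong_detG_vertical : HasDerivAlong (fun y : Jet1 => detG y.1) x (0, δ) 0 :=
  hasDerivAlong_fst_vertical (contDiff_detG.differentiable (by simp) _) δ

theorem hasDerivAlong_detH_vertical : HasDerivAlong (fun y : Jet1 => detH y.1) x (0, δ) 0 :=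
  hasDerivAlong_fst_vertical (contDiff_detH.differentiable (by simp) _) δ

theorem hasDerivAlong_gInv_vertical (hx : detG x.1 ≠ 0) (i j : Fin 2) :
    HasDerivAlong (fun y : Jet1 => gInv i j y.1) x (0, δ) 0 :=
  hasDerivAlong_fst_vertical ((contDiffAt_gInv hx i j).differentiableAt (by simp)) δ

theorem hasDerivAlong_sigma_vertical (hx : detH x.1 ≠ 0) (s : Fin 2) :
    HasDerivAlong (sigma s) x (0, δ) (2 * mixedDet x.1.2.2 (δ s) / detH x.1) := by
  have hu : HasDerivAlong (fun y : Jet1 => y.1.2.2) x (0, δ) 0 :=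
    (HasDerivAlong.id x (0, δ)).fst.snd.snd
  have hd : HasDerivAlong (fun y : Jet1 => y.2 s) x (0, δ) (δ s) :=
    (HasDerivAlong.id x (0, δ)).snd.apply s
  rw [funext (sigma_eq_mixedDet s)]
  refine (((HasDerivAlong.const 2).mul (hasDerivAlong_mixedDet hu hd)).div
    (hasDerivAlong_detH_vertical δ) hx).congr ?_
  rw [mixedDet_comm 0, mixedDet_eq_zero (n := 0) fun _ _ => rfl]
  field_simp
  ring

theorem hasDerivAlong_rho_vertical (hx : detH x.1 ≠ 0) (a b : Fin 2) :
    HasDerivAlong (fun y => rho y a b) x (0, δ)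
      (2 * (mixedDet x.1.2.2 (δ a) * sigma b x + sigma a x * mixedDet x.1.2.2 (δ b)) /
        detH x.1) :=
  ((hasDerivAlong_sigma_vertical δ hx a).mul (hasDerivAlong_sigma_vertical δ hx b)).congr (by ring)

theorem hasDerivAlong_chi_vertical (hx : detH x.1 ≠ 0) (a b : Fin 2) :
    HasDerivAlong (fun y => chi y a b) x (0, δ)
      ((mixedDet (x.2 a) (δ b) + mixedDet (x.2 b) (δ a)) / detH x.1) := by
  have hd : ∀ s, HasDerivAlong (fun y : Jet1 => y.2 s) x (0, δ) (δ s) := fun s =>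
    (HasDerivAlong.id x (0, δ)).snd.apply s
  rw [funext (chi_eq_mixedDet a b)]
  refine ((hasDerivAlong_mixedDet (hd a) (hd b)).div (hasDerivAlong_detH_vertical δ) hx).congr ?_
  rw [mixedDet_comm (δ a)]
  field_simp
  ring

theorem hasDerivAlong_gammaForm_vertical (hx : detH x.1 ≠ 0) (a b : Fin 2) :
    HasDerivAlong (fun y => gammaForm y a b) x (0, δ)
      ((mixedDet (x.2 a) (δ b) + mixedDet (x.2 b) (δ a)) / detH x.1 -
        (mixedDet x.1.2.2 (δ a) * sigma b x + sigma a x * mixedDet x.1.2.2 (δ b)) /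
          (2 * detH x.1)) :=
  ((hasDerivAlong_chi_vertical δ hx a b).sub
    ((HasDerivAlong.const (1 / 4)).mul (hasDerivAlong_rho_vertical δ hx a b))).congr (by ring)

variable {M : Jet1 → Matrix (Fin 2) (Fin 2) ℝ} {M' : Fin 2 → Fin 2 → ℝ}

theorem hasDerivAlong_traceInv_vertical (hx : detG x.1 ≠ 0)
    (hM : ∀ a b, HasDerivAlong (fun y => M y a b) x (0, δ) (M' a b)) :
    HasDerivAlong (fun y => traceInv (M y) y.1) x (0, δ) (∑ i, ∑ j, M' i j * gInv i j x.1) :=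
  (HasDerivAlong.sum fun i _ => .sum fun j _ =>
    (hM i j).mul (hasDerivAlong_gInv_vertical δ hx i j)).congr (by simp)

theorem hasDerivAlong_detInv_vertical (hx : detG x.1 ≠ 0)
    (hM : ∀ a b, HasDerivAlong (fun y => M y a b) x (0, δ) (M' a b)) :
    HasDerivAlong (fun y => detInv (M y) y.1) x (0, δ)
      ((∑ i, ∑ j, M' i j * (M x).adjugate j i) / detG x.1) := by
  unfold detInv
  simp only [Matrix.det_fin_two]
  refine (HasDerivAlong.div (((hM 0 0).mul (hM 1 1)).sub ((hM 0 1).mul (hM 1 0)))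
    (hasDerivAlong_detG_vertical δ) hx).congr ?_
  simp only [Fin.sum_univ_two, Matrix.adjugate_fin_two, Matrix.of_apply, Matrix.cons_val',
    Matrix.cons_val_zero, Matrix.cons_val_one, Matrix.cons_val_fin_one]
  field_simp
  ring

/-- The derivative of `∑ₐ bₐ Iₐ` along the fibre direction `δ` of first jets, where the `Iₐ` are
the six first-order invariants. -/
def firstOrderDiff (x : Jet1) (b : Fin 6 → ℝ) (δ : Fin 2 → FibreIdx → ℝ) : ℝ :=
  ∑ a, b a * fderiv ℝ (firstOrder a) x (0, δ)

/-- The coefficients of `dχ` in a combination of the differentials of `C_ρ, C_χ, Q_χ, Q_γ`, where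
`γ = χ - ρ / 4`. -/
def chiCoeff (x : Jet1) (b : Fin 6 → ℝ) : Matrix (Fin 2) (Fin 2) ℝ :=
  (detG x.1)⁻¹ • (b 1 • orbitMetric x.1 + b 2 • chi x + b 3 • gammaForm x).adjugate

/-- The coefficients of `dρ` in a combination of the differentials of `C_ρ, C_χ, Q_χ, Q_γ`, where
`γ = χ - ρ / 4`. -/
def rhoCoeff (x : Jet1) (b : Fin 6 → ℝ) : Matrix (Fin 2) (Fin 2) ℝ :=
  (detG x.1)⁻¹ • (b 0 • orbitMetric x.1 - (b 3 / 4) • gammaForm x).adjugate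

theorem firstOrderDiff_of_curvature_coeff_eq_zero (hx : x.1 ∈ regular0) {b : Fin 6 → ℝ}
    (hb₄ : b 4 = 0) (hb₅ : b 5 = 0) :
    firstOrderDiff x b δ = 2 / detH x.1 * ∑ j, (∑ i, chiCoeff x b i j * mixedDet (x.2 i) (δ j) +
      2 * (∑ i, rhoCoeff x b i j * sigma i x) * mixedDet x.1.2.2 (δ j)) := by
  have hρ : HasDerivAlong (firstOrder 0) x (0, δ) _ :=
    hasDerivAlong_traceInv_vertical δ hx.1 (hasDerivAlong_rho_vertical δ hx.2)
  have hχ : HasDerivAlong (firstOrder 1) x (0, δ) _ :=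
    hasDerivAlong_traceInv_vertical δ hx.1 (hasDerivAlong_chi_vertical δ hx.2)
  have hQχ : HasDerivAlong (firstOrder 2) x (0, δ) _ :=
    hasDerivAlong_detInv_vertical δ hx.1 (hasDerivAlong_chi_vertical δ hx.2)
  have hQγ : HasDerivAlong (firstOrder 3) x (0, δ) _ :=
    hasDerivAlong_detInv_vertical δ hx.1 (hasDerivAlong_gammaForm_vertical δ hx.2)
  rw [firstOrderDiff, Fin.sum_univ_six, hb₄, hb₅, hρ.fderiv_eq, hχ.fderiv_eq, hQχ.fderiv_eq,
    hQγ.fderiv_eq]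
  simp only [Fin.sum_univ_two, chiCoeff, rhoCoeff, gInv_eq_adjugate, Matrix.smul_apply,
    Matrix.add_apply, Matrix.sub_apply, Matrix.adjugate_fin_two, Matrix.of_apply,
    Matrix.cons_val', Matrix.cons_val_zero, Matrix.cons_val_one, Matrix.cons_val_fin_one,
    smul_eq_mul, gammaForm_comm 1 0, chi_comm 1 0, (orbitMetric_isSymm x.1).apply 0 1]
  ring

/-- The derivative of `𝒞ᵏ` along the fibre direction `δ` of first jets. -/
def dCurv (x : Jet0) (δ : Fin 2 → FibreIdx → ℝ) (k : Fin 2) : ℝ :=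
  (δ 1 (fI 0 k) - δ 0 (fI 1 k)) / √|detG x|

theorem hasDerivAlong_curv_vertical (hx : detG x.1 ≠ 0) (k : Fin 2) :
    HasDerivAlong (curv k) x (0, δ) (dCurv x.1 δ k) := by
  have hroot : √|detG x.1| ≠ 0 := sqrt_abs_ne_zero hx
  rw [funext (curv_eq k)]
  refine (((hasDerivAlong_coord₁ _ _ _ _).sub (hasDerivAlong_coord₁ _ _ _ _)).div
    ((hasDerivAlong_detG_vertical δ).sqrt_abs hx) hroot).congr ?_
  unfold dCurv
  field_simp
  ring

/-- The `2 × 2` minors of the matrix with rows `h_{,1}`, `h_{,2}`, arranged as the quadratic form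
in `(𝒞¹, 𝒞²)` that expands the determinant in `Θ_I`. -/
def minorForm (x : Jet1) : Matrix (Fin 2) (Fin 2) ℝ :=
  let m := fun a b => x.2 0 a * x.2 1 b - x.2 0 b * x.2 1 a
  !![m (hI 0 0) (hI 0 1), m (hI 0 0) (hI 1 1) / 2; m (hI 0 0) (hI 1 1) / 2, m (hI 0 1) (hI 1 1)]

/-- `Θ_I` as a quadratic form in `𝒞`, the first jet of `h` being fixed. -/
def thetaForm (x : Jet1) : Matrix (Fin 2) (Fin 2) ℝ :=
  ((√|detH x.1|)⁻¹ * (√|detG x.1|)⁻¹) • minorForm x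

theorem thetaForm_comm (k l : Fin 2) (x : Jet1) : thetaForm x k l = thetaForm x l k := by
  fin_cases k <;> fin_cases l <;> simp [thetaForm, minorForm]

theorem thetaI_eq_sum (x : Jet1) :
    thetaI x = ∑ k, ∑ l, thetaForm x k l * curv k x * curv l x := by
  simp only [thetaI_eq, thetaForm, minorForm, Fin.sum_univ_two, Matrix.smul_apply, Matrix.of_apply,
    Matrix.cons_val', Matrix.cons_val_zero, Matrix.cons_val_one, Matrix.cons_val_fin_one,
    smul_eq_mul]
  ring

theorem hasDerivAlong_thetaForm_vertical (hx : x.1 ∈ regular0) {δ : Fin 2 → FibreIdx → ℝ}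
    (hδ : ∀ s k l, δ s (hI k l) = 0) (k l : Fin 2) :
    HasDerivAlong (fun y => thetaForm y k l) x (0, δ) 0 := by
  have hd := fun s k l => (hasDerivAlong_coord₁ s (hI k l) x ((0 : Jet0), δ)).congr (hδ s k l)
  have hminor := fun k l m n : Fin 2 =>
    ((hd 0 k l).mul (hd 1 m n)).sub ((hd 0 m n).mul (hd 1 k l))
  have hscale := (((hasDerivAlong_detH_vertical δ).sqrt_abs hx.2).inv (sqrt_abs_ne_zero hx.2)).mul
    (((hasDerivAlong_detG_vertical δ).sqrt_abs hx.1).inv (sqrt_abs_ne_zero hx.1))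
  have hhalf := ((hminor 0 0 1 1).mul (.const 2⁻¹))
  fin_cases k <;> fin_cases l
  · exact (hscale.mul (hminor 0 0 0 1)).congr (by simp)
  · exact (hscale.mul hhalf).congr (by simp)
  · exact (hscale.mul hhalf).congr (by simp)
  · exact (hscale.mul (hminor 0 1 1 1)).congr (by simp)

theorem hasDerivAlong_sum_curv_vertical (hx : detG x.1 ≠ 0)
    (hM : ∀ k l, HasDerivAlong (fun y => M y k l) x (0, δ) 0) (hsymm : ∀ k l, M x k l = M x l k) :
    HasDerivAlong (fun y => ∑ k, ∑ l, M y k l * curv k y * curv l y) x (0, δ)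
      (2 * ∑ k, (∑ l, M x k l * curv l x) * dCurv x.1 δ k) := by
  have hcurv := hasDerivAlong_curv_vertical δ hx
  refine (HasDerivAlong.sum fun k _ => .sum fun l _ =>
    ((hM k l).mul (hcurv k)).mul (hcurv l)).congr ?_
  simp only [Fin.sum_univ_two, hsymm 1 0]
  ring

/-- The coefficients of `d𝒞` in a combination of the differentials of `ℓ_𝒞` and `Θ_I²`, up to a
factor `2`. -/
def curvCoeff (x : Jet1) (b : Fin 6 → ℝ) (k : Fin 2) : ℝ :=
  ∑ l, (b 4 * hh k l x.1 + 2 * b 5 * thetaI x * thetaForm x k l) * curv l x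

theorem firstOrderDiff_of_h_eq_zero (hx : x.1 ∈ regular0) (b : Fin 6 → ℝ)
    {δ : Fin 2 → FibreIdx → ℝ} (hδ : ∀ s k l, δ s (hI k l) = 0) :
    firstOrderDiff x b δ = 2 * ∑ k, curvCoeff x b k * dCurv x.1 δ k := by
  have hell : HasDerivAlong (firstOrder 4) x (0, δ) _ :=
    hasDerivAlong_sum_curv_vertical δ (M := fun y => .of fun k l => hh k l y.1) hx.1
      (hasDerivAlong_hh_vertical δ) (hh_comm · · x.1)
  have htheta : HasDerivAlong (firstOrder 5) x (0, δ) _ :=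
    (show HasDerivAlong thetaI x (0, δ) _ from funext thetaI_eq_sum ▸
      hasDerivAlong_sum_curv_vertical δ hx.1 (hasDerivAlong_thetaForm_vertical hx hδ)
        (thetaForm_comm · · x)).sq
  have hfour : firstOrderDiff x ![b 0, b 1, b 2, b 3, 0, 0] δ = 0 := by
    rw [firstOrderDiff_of_curvature_coeff_eq_zero δ hx rfl rfl]
    simp [mixedDet_eq_zero (hδ _)]
  have hsplit : firstOrderDiff x b δ = firstOrderDiff x ![b 0, b 1, b 2, b 3, 0, 0] δ +
      (b 4 * fderiv ℝ (firstOrder 4) x (0, δ) + b 5 * fderiv ℝ (firstOrder 5) x (0, δ)) := by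
    simp [firstOrderDiff, Fin.sum_univ_six]
    ring
  rw [hsplit, hfour, hell.fderiv_eq, htheta.fderiv_eq]
  simp only [curvCoeff, Fin.sum_univ_two, Matrix.of_apply]
  ring

theorem hasDerivAlong_christoffel_vertical (hx : detG x.1 ≠ 0) (k i j : Fin 2) :
    HasDerivAlong (christoffel k i j) x (0, δ) (1 / 2 * ∑ l, gInv k l x.1 *
      (δ i (gI j l) + δ j (gI i l) - δ l (gI i j))) := by
  rw [funext (christoffel_eq k i j)]
  exact ((HasDerivAlong.const _).mul (.sum fun l _ => (hasDerivAlong_gInv_vertical δ hx k l).mul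
    (((hasDerivAlong_coord₁ _ _ _ _).add (hasDerivAlong_coord₁ _ _ _ _)).sub
      (hasDerivAlong_coord₁ _ _ _ _)))).congr (by simp)

end FirstOrder

section SecondOrder

variable {x : Jet2} (q : Sym2 (Fin 2) → FibreIdx → ℝ)

theorem hasDerivAlong_traceInv_vertical₂ {M : Jet2 → Matrix (Fin 2) (Fin 2) ℝ}
    {M' : Fin 2 → Fin 2 → ℝ} (hx : detG x.1.1 ≠ 0)
    (hM : ∀ a b, HasDerivAlong (fun y => M y a b) x (0, q) (M' a b)) :
    HasDerivAlong (fun y => traceInv (M y) y.1.1) x (0, q)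
      (∑ i, ∑ j, M' i j * gInv i j x.1.1) :=
  (HasDerivAlong.sum fun i _ => .sum fun j _ => (hM i j).mul
    (.comp_fst (F := fun y : Jet1 => gInv i j y.1)
      (hasDerivAlong_gInv_vertical 0 hx i j))).congr (by simp)

/-- The derivative of the scalar curvature `C_ric` along the fibre direction `q` of second jets. -/
def dCric (x : Jet0) (q : Sym2 (Fin 2) → FibreIdx → ℝ) : ℝ :=
  -(q s(1, 1) (gI 0 0) - 2 * q s(0, 1) (gI 0 1) + q s(0, 0) (gI 1 1)) / detG x

theorem hasDerivAlong_Cric_vertical (hx : x ∈ regular) :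
    HasDerivAlong Cric x (0, q) (dCric x.1.1 q) := by
  have hΓ := contDiffAt_christoffel (x := x.1) hx.1
  have hΓ₀ := fun k i j =>
    hasDerivAlong_fst_vertical ((hΓ k i j).differentiableAt (by simp)) q
  have hD := fun k i j l => hasDerivAlong_D1_vertical
    ((hΓ k i j).of_le (WithTop.coe_le_coe.2 le_top)) l q
    (hasDerivAlong_christoffel_vertical _ hx.1 k i j)
  have hricci : ∀ i j, HasDerivAlong (fun y => ricci y i j) x (0, q) _ := fun i j =>
    (HasDerivAlong.sum fun k _ => (hD k i j k).sub (hD k i k j)).add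
      (.sum fun k _ => .sum fun l _ => ((hΓ₀ k k l).mul (hΓ₀ l i j)).sub
        ((hΓ₀ k j l).mul (hΓ₀ l i k)))
  refine (hasDerivAlong_traceInv_vertical₂ q hx.1 hricci).congr ?_
  have hG : detG x.1.1 ≠ 0 := hx.1
  have hdet : detG x.1.1 = gt 0 0 x.1.1 * gt 1 1 x.1.1 - gt 0 1 x.1.1 ^ 2 := rfl
  simp only [Fin.sum_univ_two, zero_mul, mul_zero, add_zero, sub_zero, gInv_comm 1 0,
    gInv_zero_zero, gInv_zero_one, gInv_one_one, dCric, gI_comm 1 0,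
    Sym2.eq_swap (a := (1 : Fin 2)) (b := 0)]
  field_simp
  rw [hdet]
  ring

/-- The derivative of `C_ν` along the fibre direction `q` of second jets. -/
def dCnu (x : Jet0) (q : Sym2 (Fin 2) → FibreIdx → ℝ) : ℝ :=
  2 / detH x * ∑ i, ∑ j, gInv i j x * mixedDet x.2.2 (q s(i, j))

theorem hasDerivAlong_Cnu_vertical (hx : x ∈ regular) :
    HasDerivAlong Cnu x (0, q) (dCnu x.1.1 q) := by
  have hΓ := contDiffAt_christoffel (x := x.1) hx.1
  have hσ := contDiffAt_sigma (x := x.1) hx.2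
  have hΓ₀ := fun k i j =>
    hasDerivAlong_fst_vertical ((hΓ k i j).differentiableAt (by simp)) q
  have hσ₀ := fun k => hasDerivAlong_fst_vertical ((hσ k).differentiableAt (by simp)) q
  have hD := fun j i => hasDerivAlong_D1_vertical ((hσ j).of_le (WithTop.coe_le_coe.2 le_top)) i q
    (hasDerivAlong_sigma_vertical _ hx.2 j)
  have hhess : ∀ i j, HasDerivAlong (fun y => hessian y i j) x (0, q) _ := fun i j =>
    ((hD j i).sub (.sum fun k _ => (hΓ₀ k i j).mul (hσ₀ k))).congr_of_eventuallyEq <| by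
      filter_upwards [isOpen_regular.mem_nhds hx] with y hy using hessian_eq hy.2 i j
  refine (hasDerivAlong_traceInv_vertical₂ q hx.1 hhess).congr ?_
  simp only [Fin.sum_univ_two, zero_mul, mul_zero, add_zero, sub_zero, dCnu,
    Sym2.eq_swap (a := (1 : Fin 2)) (b := 0)]
  ring

theorem hasDerivAlong_Cnu'_vertical (hx : x ∈ regular) :
    HasDerivAlong Cnu' x (0, q) (dCnu x.1.1 q) := by
  have hfirst := fun a => hasDerivAlong_fst_vertical
    ((contDiffAt_firstOrder (x := x.1) hx a).differentiableAt (by simp)) q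
  exact (((hasDerivAlong_Cnu_vertical q hx).sub ((HasDerivAlong.const 2).mul (hfirst 1))).add
    (hfirst 0)).congr (by ring)

/-- The components of `X`, the gradient of `ln |det h|`. -/
def sigmaUp (x : Jet1) (i : Fin 2) : ℝ := ∑ s, gInv i s x.1 * sigma s x

/-- The components of `X^⊥`. -/
def sigmaPerp (x : Jet1) : Fin 2 → ℝ := (√|detG x.1|)⁻¹ • ![sigma 1 x, -sigma 0 x]

theorem hasDerivAlong_XD_vertical (hx : x ∈ regular) (a : Fin 6) :
    HasDerivAlong (XD (firstOrder a)) x (0, q)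
      (∑ i, sigmaUp x.1 i * fderiv ℝ (firstOrder a) x.1 (0, fun r => q s(r, i))) := by
  have hI := contDiffAt_firstOrder (x := x.1) hx a
  have hσ := fun k => hasDerivAlong_fst_vertical
    ((contDiffAt_sigma (x := x.1) hx.2 k).differentiableAt (by simp)) q
  have hg := fun i j => HasDerivAlong.comp_fst (F := fun y : Jet1 => gInv i j y.1) (x := x)
    (v := (0, q)) (hasDerivAlong_gInv_vertical 0 hx.1 i j)
  have hD := fun i => hasDerivAlong_D1_vertical (hI.of_le (WithTop.coe_le_coe.2 le_top)) i q
    ⟨hI.differentiableAt (by simp), rfl⟩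
  refine (HasDerivAlong.sum fun i _ => .sum fun s _ =>
    ((hg i s).mul (hσ s)).mul (hD i)).congr ?_
  simp only [Fin.sum_univ_two, sigmaUp]
  ring

theorem hasDerivAlong_XperpD_vertical (hx : x ∈ regular) (a : Fin 6) :
    HasDerivAlong (XperpD (firstOrder a)) x (0, q)
      (∑ i, sigmaPerp x.1 i * fderiv ℝ (firstOrder a) x.1 (0, fun r => q s(r, i))) := by
  have hroot : √|detG x.1.1| ≠ 0 := sqrt_abs_ne_zero hx.1
  have hI := contDiffAt_firstOrder (x := x.1) hx a
  have hσ := fun k => hasDerivAlong_fst_vertical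
    ((contDiffAt_sigma (x := x.1) hx.2 k).differentiableAt (by simp)) q
  have hD := fun i => hasDerivAlong_D1_vertical (hI.of_le (WithTop.coe_le_coe.2 le_top)) i q
    ⟨hI.differentiableAt (by simp), rfl⟩
  refine ((((hσ 1).mul (hD 0)).sub ((hσ 0).mul (hD 1))).div
    (.comp_fst (F := fun y : Jet1 => √|detG y.1|)
      ((hasDerivAlong_detG_vertical 0).sqrt_abs hx.1)) hroot).congr ?_
  simp only [Fin.sum_univ_two, sigmaPerp, Pi.smul_apply, Matrix.cons_val_zero,
    Matrix.cons_val_one, smul_eq_mul]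
  field_simp
  ring

end SecondOrder

/-! ### Independence of the differentials -/

/-- The matrix whose rows are the components of the forms `g̃`, `χ` and `ρ`. -/
def formsMatrix (x : Jet1) : Matrix (Fin 3) (Fin 3) ℝ :=
  !![gt 0 0 x.1, gt 0 1 x.1, gt 1 1 x.1;
     chi x 0 0, chi x 0 1, chi x 1 1;
     rho x 0 0, rho x 0 1, rho x 1 1]

/-- Half the Jacobian matrix of `(ℓ_𝒞, Θ_I)` with respect to `(𝒞¹, 𝒞²)`. -/
def curvJacobian (x : Jet1) : Matrix (Fin 2) (Fin 2) ℝ :=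
  !![∑ l, hh 0 l x.1 * curv l x, ∑ l, hh 1 l x.1 * curv l x;
     ∑ l, thetaForm x 0 l * curv l x, ∑ l, thetaForm x 1 l * curv l x]

section Coefficients

variable {x : Jet1} {b : Fin 6 → ℝ}

theorem eq_zero_of_curvCoeff_eq_zero (hJ : (curvJacobian x).det ≠ 0) (hΘ : thetaI x ≠ 0)
    (hb : ∀ k, curvCoeff x b k = 0) : b 4 = 0 ∧ b 5 = 0 := by
  have hmul : Matrix.vecMul ![b 4, 2 * b 5 * thetaI x] (curvJacobian x) = 0 := by
    funext k
    refine Eq.trans ?_ (hb k)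
    fin_cases k <;> simp [curvJacobian, curvCoeff, Matrix.vecMul, dotProduct] <;> ring
  have hzero := Matrix.eq_zero_of_vecMul_eq_zero hJ hmul
  have hfour : b 4 = 0 := congrFun hzero 0
  have hfive : 2 * b 5 * thetaI x = 0 := congrFun hzero 1
  exact ⟨hfour, by simpa [hΘ] using hfive⟩

theorem eq_zero_of_chiCoeff_eq_zero (hx : detG x.1 ≠ 0) (hM : (formsMatrix x).det ≠ 0)
    (hb : chiCoeff x b = 0) : b 1 = 0 ∧ b 2 = 0 ∧ b 3 = 0 := by
  have hadj := (smul_eq_zero.1 hb).resolve_left (inv_ne_zero hx)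
  have hform : b 1 • orbitMetric x.1 + b 2 • chi x + b 3 • gammaForm x = 0 := by
    simpa [hadj] using
      (Matrix.adjugate_adjugate' (b 1 • orbitMetric x.1 + b 2 • chi x + b 3 • gammaForm x)).symm
  have hentry := fun i j => congrFun (congrFun hform i) j
  have hmul : Matrix.vecMul ![b 1, b 2 + b 3, -b 3 / 4] (formsMatrix x) = 0 := by
    funext k
    fin_cases k
    · refine Eq.trans ?_ (hentry 0 0)
      simp [formsMatrix, gammaForm, orbitMetric, Matrix.vecMul, dotProduct, Fin.sum_univ_succ]
      ring
    · refine Eq.trans ?_ (hentry 0 1)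
      simp [formsMatrix, gammaForm, orbitMetric, Matrix.vecMul, dotProduct, Fin.sum_univ_succ]
      ring
    · refine Eq.trans ?_ (hentry 1 1)
      simp [formsMatrix, gammaForm, orbitMetric, Matrix.vecMul, dotProduct, Fin.sum_univ_succ]
      ring
  have hzero := Matrix.eq_zero_of_vecMul_eq_zero hM hmul
  have hone : b 1 = 0 := congrFun hzero 0
  have htwo : b 2 + b 3 = 0 := congrFun hzero 1
  have hthree : -b 3 / 4 = 0 := congrFun hzero 2
  exact ⟨hone, by linarith, by linarith⟩

theorem chiCoeff_comm (b : Fin 6 → ℝ) (i j : Fin 2) : chiCoeff x b i j = chiCoeff x b j i := by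
  fin_cases i <;> fin_cases j <;> simp [chiCoeff, Matrix.adjugate_fin_two, orbitMetric,
    chi_comm 1 0, gammaForm_comm 1 0, gt_comm 1 0]

theorem sum_rhoCoeff_mul_sigma (hb : b 3 = 0) (j : Fin 2) :
    ∑ i, rhoCoeff x b i j * sigma i x = b 0 * sigmaUp x j := by
  have hcoeff : ∀ i, rhoCoeff x b i j = b 0 * gInv j i x.1 := fun i => by
    rw [rhoCoeff, hb, gInv_comm, gInv_eq_adjugate]
    simp [Matrix.adjugate_smul]
    ring
  simp only [hcoeff, sigmaUp, Finset.mul_sum, mul_assoc]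

theorem eq_zero_of_sum_mixedDet_eq_zero (hW : (fibreWronskian x).det ≠ 0) {t : Fin 2 → ℝ} {u : ℝ}
    (h : ∀ r, ∑ i, t i * mixedDet (x.2 i) r + u * mixedDet x.1.2.2 r = 0) : t = 0 ∧ u = 0 := by
  have hmul : Matrix.vecMul ![u, t 0, t 1] (fibreWronskian x) = 0 := by
    funext k
    fin_cases k
    · refine Eq.trans ?_ (congrArg (2 * ·) (h (Pi.single (hI 1 1) 1)) |>.trans (mul_zero 2))
      simp [fibreWronskian, Matrix.vecMul, dotProduct, Fin.sum_univ_succ, mixedDet, hh]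
      ring
    · refine Eq.trans ?_ (congrArg (- ·) (h (Pi.single (hI 0 1) 1)) |>.trans neg_zero)
      simp [fibreWronskian, Matrix.vecMul, dotProduct, Fin.sum_univ_succ, mixedDet, hh]
    · refine Eq.trans ?_ (congrArg (2 * ·) (h (Pi.single (hI 0 0) 1)) |>.trans (mul_zero 2))
      simp [fibreWronskian, Matrix.vecMul, dotProduct, Fin.sum_univ_succ, mixedDet, hh]
      ring
  have hzero := Matrix.eq_zero_of_vecMul_eq_zero hW hmul
  refine ⟨funext fun i => ?_, congrFun hzero 0⟩
  fin_cases i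
  exacts [congrFun hzero 1, congrFun hzero 2]

end Coefficients

theorem eq_zero_of_mul_add_mul_eq_zero {K ι : Type*} [Field K] [NeZero (2 : K)] [Fintype ι]
    {σ X b : ι → K} (hσ : ∑ i, σ i * X i ≠ 0) (h : ∀ i j, b i * X j + b j * X i = 0) : b = 0 := by
  have hcontract : ∀ i, b i * ∑ j, σ j * X j + (∑ j, σ j * b j) * X i = 0 := fun i => by
    rw [Finset.mul_sum, Finset.sum_mul, ← Finset.sum_add_distrib]
    exact Finset.sum_eq_zero fun j _ => by linear_combination σ j * h i j
  have hdot : ∑ j, σ j * b j = 0 := by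
    have htwice : 2 * ((∑ j, σ j * b j) * ∑ j, σ j * X j) = 0 := by
      calc 2 * ((∑ j, σ j * b j) * ∑ j, σ j * X j)
          = ∑ i, σ i * (b i * ∑ j, σ j * X j + (∑ j, σ j * b j) * X i) := by
            simp only [mul_add, Finset.sum_add_distrib, ← mul_assoc, ← Finset.sum_mul]
            simp only [mul_right_comm _ (∑ j, σ j * b j), ← Finset.sum_mul]
            ring
        _ = 0 := by simp only [hcontract, mul_zero, Finset.sum_const_zero]
    exact (mul_eq_zero_iff_right hσ).1 ((mul_eq_zero_iff_left two_ne_zero).1 htwice)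
  funext i
  exact (mul_eq_zero_iff_right hσ).1 (by rw [← hcontract i, hdot, zero_mul, add_zero])

theorem sum_sigma_mul_sigmaUp (x : Jet1) :
    ∑ i, sigma i x * sigmaUp x i = traceInv (rho x) x.1 := by
  simp only [sigmaUp, traceInv, rho, Matrix.of_apply, Fin.sum_univ_two]
  ring

theorem eq_zero_of_sigmaUp_add_gInv_eq_zero {x : Jet1} (hx : detG x.1 ≠ 0)
    (hσ : traceInv (rho x) x.1 ≠ 0) {b : Fin 2 → ℝ} {e : ℝ}
    (h : ∀ i j, b i * sigmaUp x j + b j * sigmaUp x i + e * gInv i j x.1 = 0) :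
    b = 0 ∧ e = 0 := by
  rw [← sum_sigma_mul_sigmaUp] at hσ
  have hnorm : gt 1 1 x.1 * sigmaUp x 1 ^ 2 + 2 * gt 0 1 x.1 * sigmaUp x 0 * sigmaUp x 1 +
      gt 0 0 x.1 * sigmaUp x 0 ^ 2 = ∑ i, sigma i x * sigmaUp x i := by
    have hG : detG x.1 = gt 0 0 x.1 * gt 1 1 x.1 - gt 0 1 x.1 ^ 2 := rfl
    simp only [sigmaUp, Fin.sum_univ_two, gInv_comm 1 0, gInv_zero_zero, gInv_zero_one,
      gInv_one_one]
    field_simp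
    rw [hG]
    ring
  have he : e = 0 := by
    refine (mul_eq_zero_iff_left hσ).1 ?_
    rw [← hnorm]
    have h₀₀ := h 0 0
    have h₀₁ := h 0 1
    have h₁₁ := h 1 1
    rw [gInv_zero_zero] at h₀₀
    rw [gInv_zero_one] at h₀₁
    rw [gInv_one_one] at h₁₁
    field_simp at h₀₀ h₀₁ h₁₁
    linear_combination sigmaUp x 1 ^ 2 * h₀₀ - 2 * sigmaUp x 0 * sigmaUp x 1 * h₀₁ +
      sigmaUp x 0 ^ 2 * h₁₁
  exact ⟨eq_zero_of_mul_add_mul_eq_zero hσ fun i j => by simpa [he] using h i j, he⟩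

theorem eq_zero_of_smul_sigmaUp_add_smul_sigmaPerp {x : Jet1} (hx : detG x.1 ≠ 0)
    (hσ : traceInv (rho x) x.1 ≠ 0) {p r : ℝ}
    (h : ∀ i, p * sigmaUp x i + r * sigmaPerp x i = 0) : p = 0 ∧ r = 0 := by
  have hroot := sqrt_abs_ne_zero hx
  rw [← sum_sigma_mul_sigmaUp, Fin.sum_univ_two] at hσ
  have hzero := h 0
  have hone := h 1
  simp only [sigmaPerp, Pi.smul_apply, Matrix.cons_val_zero, Matrix.cons_val_one,
    smul_eq_mul] at hzero hone
  refine ⟨(mul_eq_zero_iff_right hσ).1 ?_,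
    (mul_eq_zero_iff_right (mul_ne_zero (inv_ne_zero hroot) hσ)).1 ?_⟩
  · linear_combination sigma 0 x * hzero + sigma 1 x * hone
  · linear_combination sigmaUp x 1 * hzero - sigmaUp x 0 * hone

/-- The derivative, along the fibre direction `q` of second jets, of a combination of the
second-order invariants in which `D_i I_a` occurs with coefficient `b i a` and `C_ric`, `C_ν` with
coefficients `e 0`, `e 1`. -/
def secondOrderDiff (x : Jet1) (b : Fin 2 → Fin 6 → ℝ) (e : Fin 2 → ℝ)
    (q : Sym2 (Fin 2) → FibreIdx → ℝ) : ℝ :=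
  ∑ i, firstOrderDiff x (b i) (fun r => q s(r, i)) + e 0 * dCric x.1 q + e 1 * dCnu x.1 q

/-- The fibre covector by which the second derivatives `q_ij` enter `secondOrderDiff`, up to a
common factor, when `C_ν` has coefficient `e` and `ℓ_𝒞`, `Θ_I²`, `C_ric` have coefficient `0`. -/
def secondOrderCovector (x : Jet1) (b : Fin 2 → Fin 6 → ℝ) (e : ℝ) (i j : Fin 2)
    (r : FibreIdx → ℝ) : ℝ :=
  ∑ k, chiCoeff x (b i) k j * mixedDet (x.2 k) r +
    (2 * (∑ k, rhoCoeff x (b i) k j * sigma k x) + e * gInv i j x.1) * mixedDet x.1.2.2 r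

theorem add_swap_eq_zero_of_sum_eq_zero {E R : Type*} [Zero E] [AddCommMonoid R]
    {A : Fin 2 → Fin 2 → E → R} (hA : ∀ i j, A i j 0 = 0)
    (h : ∀ q : Sym2 (Fin 2) → E, ∑ i, ∑ j, A i j (q s(i, j)) = 0) (i j : Fin 2) (r : E) :
    A i j r + A j i r = 0 := by
  have hdiag : ∀ i, A i i r = 0 := fun i => by
    have hii := h (Pi.single s(i, i) r)
    fin_cases i <;> simpa [Pi.single_apply, hA] using hii
  have hoff : A 0 1 r + A 1 0 r = 0 := by
    simpa [Pi.single_apply, hA] using h (Pi.single s(0, 1) r)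
  fin_cases i <;> fin_cases j
  exacts [by simp [hdiag], hoff, (add_comm _ _).trans hoff, by simp [hdiag]]

theorem eq_zero_of_symm_of_antisymm {ι R : Type*} [AddCommGroup R] [IsAddTorsionFree R]
    {T : ι → ι → ι → R} (hsymm : ∀ i j k, T i j k = T i k j)
    (hanti : ∀ i j k, T i j k + T k j i = 0) (i j k : ι) : T i j k = 0 := by
  have hrotate : ∀ i j k, T i j k = -T j k i := fun i j k =>
    (hsymm i j k).trans (eq_neg_of_add_eq_zero_left (hanti i k j))
  refine self_eq_neg.1 ((hrotate i j k).trans ?_)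
  rw [hrotate j k i, hrotate k i j, neg_neg]

section SecondOrderCoefficients

variable {x : Jet1} {b : Fin 2 → Fin 6 → ℝ} {e : Fin 2 → ℝ}

theorem secondOrderDiff_of_h_eq_zero (hx : x.1 ∈ regular0) {q : Sym2 (Fin 2) → FibreIdx → ℝ}
    (hq : ∀ p k l, q p (hI k l) = 0) :
    secondOrderDiff x b e q =
      ∑ i, 2 * ∑ k, curvCoeff x (b i) k * dCurv x.1 (fun r => q s(r, i)) k +
        e 0 * dCric x.1 q := by
  simp only [secondOrderDiff, firstOrderDiff_of_h_eq_zero hx _ fun _ => hq _, dCnu,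
    mixedDet_eq_zero (hq _), mul_zero, Finset.sum_const_zero, add_zero]

theorem curvCoeff_eq_zero_of_secondOrderDiff_eq_zero (hx : x.1 ∈ regular0)
    (h : ∀ q, secondOrderDiff x b e q = 0) (i k : Fin 2) : curvCoeff x (b i) k = 0 := by
  have hroot : √|detG x.1| ≠ 0 := sqrt_abs_ne_zero hx.1
  have hik := h (Pi.single s(0, 1) (Pi.single (fI i k) 1))
  rw [secondOrderDiff_of_h_eq_zero hx fun p m n => by rw [Pi.single_apply]; split <;> simp] at hik
  fin_cases i <;> fin_cases k <;> simpa [dCurv, dCric, hroot, Pi.single_apply] using hik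

theorem coeff_Cric_eq_zero_of_secondOrderDiff_eq_zero (hx : x.1 ∈ regular0)
    (h : ∀ q, secondOrderDiff x b e q = 0) : e 0 = 0 := by
  have hG : detG x.1 ≠ 0 := hx.1
  have hg := h (Pi.single s(0, 0) (Pi.single (gI 1 1) 1))
  rw [secondOrderDiff_of_h_eq_zero hx fun p m n => by rw [Pi.single_apply]; split <;> simp] at hg
  simpa [dCurv, dCric, hG, Pi.single_apply] using hg

theorem secondOrderDiff_of_curvature_coeff_eq_zero (hx : x.1 ∈ regular0)
    (hb₄ : ∀ i, b i 4 = 0) (hb₅ : ∀ i, b i 5 = 0) (he : e 0 = 0)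
    (q : Sym2 (Fin 2) → FibreIdx → ℝ) :
    secondOrderDiff x b e q =
      2 / detH x.1 * ∑ i, ∑ j, secondOrderCovector x b (e 1) i j (q s(i, j)) := by
  simp only [secondOrderDiff, firstOrderDiff_of_curvature_coeff_eq_zero _ hx (hb₄ _) (hb₅ _), he,
    dCnu, secondOrderCovector, Fin.sum_univ_two, Sym2.eq_swap (a := (1 : Fin 2)) (b := 0)]
  ring

theorem add_swap_eq_zero_of_secondOrderDiff_eq_zero (hx : x.1 ∈ regular0)
    (hW : (fibreWronskian x).det ≠ 0) (hb₄ : ∀ i, b i 4 = 0) (hb₅ : ∀ i, b i 5 = 0)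
    (he : e 0 = 0) (h : ∀ q, secondOrderDiff x b e q = 0) (i j : Fin 2) :
    (∀ k, chiCoeff x (b i) k j + chiCoeff x (b j) k i = 0) ∧
      ∑ k, rhoCoeff x (b i) k j * sigma k x + ∑ k, rhoCoeff x (b j) k i * sigma k x +
        e 1 * gInv i j x.1 = 0 := by
  have hH : 2 / detH x.1 ≠ 0 := div_ne_zero two_ne_zero hx.2
  have hsum : ∀ q : Sym2 (Fin 2) → FibreIdx → ℝ,
      ∑ i, ∑ j, secondOrderCovector x b (e 1) i j (q s(i, j)) = 0 := fun q =>
    (mul_eq_zero_iff_left hH).1 <|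
      (secondOrderDiff_of_curvature_coeff_eq_zero hx hb₄ hb₅ he q).symm.trans (h q)
  have hswap := add_swap_eq_zero_of_sum_eq_zero
    (fun i j => by simp [secondOrderCovector, mixedDet]) hsum i j
  obtain ⟨hχ, hρ⟩ := eq_zero_of_sum_mixedDet_eq_zero hW
    (t := fun k => chiCoeff x (b i) k j + chiCoeff x (b j) k i)
    (u := 2 * (∑ k, rhoCoeff x (b i) k j * sigma k x + ∑ k, rhoCoeff x (b j) k i * sigma k x +
      e 1 * gInv i j x.1)) fun r => by
        rw [← hswap r, secondOrderCovector, secondOrderCovector, gInv_comm j i]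
        simp only [Fin.sum_univ_two]
        ring
  exact ⟨congrFun hχ, (mul_eq_zero_iff_left two_ne_zero).1 hρ⟩

end SecondOrderCoefficients

theorem sum_mul_fderiv_twenty_vertical {x : Jet2} (hx : x ∈ regular) {c : Jet2 → ℝ}
    (hc : ∀ q, HasDerivAlong c x (0, q) (dCnu x.1.1 q))
    (w : Fin 6 ⊕ Fin 6 ⊕ Fin 6 ⊕ Fin 2 → ℝ) (q : Sym2 (Fin 2) → FibreIdx → ℝ) :
    ∑ a, w a * fderiv ℝ (twenty c a) x (0, q) = secondOrderDiff x.1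
      (fun i a => w (.inr (.inl a)) * sigmaUp x.1 i + w (.inr (.inr (.inl a))) * sigmaPerp x.1 i)
      (fun k => w (.inr (.inr (.inr k)))) q := by
  have hfst : ∀ a, HasDerivAlong (twenty c (.inl a)) x (0, q) 0 := fun a =>
    hasDerivAlong_fst_vertical ((contDiffAt_firstOrder hx a).differentiableAt (by simp)) q
  have hX : ∀ a, HasDerivAlong (twenty c (.inr (.inl a))) x (0, q) _ :=
    hasDerivAlong_XD_vertical q hx
  have hXperp : ∀ a, HasDerivAlong (twenty c (.inr (.inr (.inl a)))) x (0, q) _ :=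
    hasDerivAlong_XperpD_vertical q hx
  have hric : HasDerivAlong (twenty c (.inr (.inr (.inr 0)))) x (0, q) _ :=
    hasDerivAlong_Cric_vertical q hx
  have hnu : HasDerivAlong (twenty c (.inr (.inr (.inr 1)))) x (0, q) _ := hc q
  simp only [Fintype.sum_sum_type, (hfst _).fderiv_eq, (hX _).fderiv_eq, (hXperp _).fderiv_eq,
    Fin.sum_univ_two, hric.fderiv_eq, hnu.fderiv_eq, secondOrderDiff, firstOrderDiff,
    add_mul, mul_add, Finset.sum_add_distrib, mul_zero, Finset.sum_const_zero, mul_assoc]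
  ring

/-- A first jet at which the twenty invariants are independent and the prolonged fields span a
subspace of codimension twenty. -/
structure IsGeneric (x : Jet1) : Prop where
  mem_regular0 : x.1 ∈ regular0
  det_fibreWronskian_ne_zero : (fibreWronskian x).det ≠ 0
  normSq_sigma_ne_zero : traceInv (rho x) x.1 ≠ 0
  det_formsMatrix_ne_zero : (formsMatrix x).det ≠ 0
  thetaI_ne_zero : thetaI x ≠ 0
  det_curvJacobian_ne_zero : (curvJacobian x).det ≠ 0

namespace IsGeneric

theorem eq_zero_of_secondOrderDiff_eq_zero {x : Jet1} (hx : IsGeneric x)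
    {b : Fin 2 → Fin 6 → ℝ} {e : Fin 2 → ℝ} (h : ∀ q, secondOrderDiff x b e q = 0) :
    b = 0 ∧ e = 0 := by
  have hcurv := fun i => eq_zero_of_curvCoeff_eq_zero hx.det_curvJacobian_ne_zero
    hx.thetaI_ne_zero (curvCoeff_eq_zero_of_secondOrderDiff_eq_zero hx.mem_regular0 h i)
  have hric := coeff_Cric_eq_zero_of_secondOrderDiff_eq_zero hx.mem_regular0 h
  have hswap := add_swap_eq_zero_of_secondOrderDiff_eq_zero hx.mem_regular0
    hx.det_fibreWronskian_ne_zero (fun i => (hcurv i).1) (fun i => (hcurv i).2) hric h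
  have hχ : ∀ i, chiCoeff x (b i) = 0 := fun i => Matrix.ext <|
    eq_zero_of_symm_of_antisymm (T := fun i k j => chiCoeff x (b i) k j)
      (fun i => chiCoeff_comm (b i)) (fun i k j => (hswap i j).1 k) i
  have hforms := fun i =>
    eq_zero_of_chiCoeff_eq_zero hx.mem_regular0.1 hx.det_formsMatrix_ne_zero (hχ i)
  obtain ⟨hρ, hν⟩ := eq_zero_of_sigmaUp_add_gInv_eq_zero (b := fun i => b i 0) hx.mem_regular0.1
    hx.normSq_sigma_ne_zero fun i j => by
      rw [← sum_rhoCoeff_mul_sigma (hforms i).2.2, ← sum_rhoCoeff_mul_sigma (hforms j).2.2]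
      exact (hswap i j).2
  refine ⟨funext fun i => funext fun a => ?_, funext fun k => ?_⟩
  · fin_cases a
    exacts [congrFun hρ i, (hforms i).1, (hforms i).2.1, (hforms i).2.2, (hcurv i).1, (hcurv i).2]
  · fin_cases k
    exacts [hric, hν]

theorem eq_zero_of_firstOrderDiff_eq_zero {x : Jet1} (hx : IsGeneric x) {b : Fin 6 → ℝ}
    (h : ∀ δ, firstOrderDiff x b δ = 0) : b = 0 := by
  have hsecond := hx.eq_zero_of_secondOrderDiff_eq_zero (b := fun _ => b) (e := 0) fun q => by
    simp [secondOrderDiff, h]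
  exact congrFun hsecond.1 0

theorem linearIndependent_twenty {x : Jet2} (hx : IsGeneric x.1) {c : Jet2 → ℝ}
    (hc : ∀ q, HasDerivAlong c x (0, q) (dCnu x.1.1 q)) :
    LinearIndependent ℝ fun a => fderiv ℝ (twenty c a) x := by
  have hreg : x ∈ regular := hx.mem_regular0
  refine Fintype.linearIndependent_iff.2 fun w hw => ?_
  have hw_apply : ∀ v, ∑ a, w a * fderiv ℝ (twenty c a) x v = 0 := fun v => by
    simpa using congrArg (· v) hw
  obtain ⟨hframe, hcoeff⟩ := hx.eq_zero_of_secondOrderDiff_eq_zero fun q =>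
    (sum_mul_fderiv_twenty_vertical hreg hc w q).symm.trans (hw_apply (0, q))
  have hX := fun a => eq_zero_of_smul_sigmaUp_add_smul_sigmaPerp hreg.1 hx.normSq_sigma_ne_zero
    fun i => congrFun (congrFun hframe i) a
  have hI := hx.eq_zero_of_firstOrderDiff_eq_zero (b := fun a => w (.inl a)) fun δ => by
    have hfst : ∀ a, HasDerivAlong (twenty c (.inl a)) x ((0, δ), 0)
        (fderiv ℝ (firstOrder a) x.1 (0, δ)) := fun a =>
      .comp_fst ⟨(contDiffAt_firstOrder hreg a).differentiableAt (by simp), rfl⟩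
    have hδ := hw_apply ((0, δ), 0)
    simp only [Fintype.sum_sum_type, hX, congrFun hcoeff _, (hfst _).fderiv_eq] at hδ
    simpa [firstOrderDiff] using hδ
  rintro (a | a | a | k)
  exacts [congrFun hI a, (hX a).1, (hX a).2, congrFun hcoeff k]

end IsGeneric

/-! ### Density of the generic jets -/

theorem dense_ne_zero_of_analyticOnNhd {E F : Type*} [NormedAddCommGroup E] [NormedSpace ℝ E]
    [NormedAddCommGroup F] [NormedSpace ℝ F] {f : E → F} (hf : AnalyticOnNhd ℝ f Set.univ)
    {x₀ : E} (hx₀ : f x₀ ≠ 0) : Dense {x | f x ≠ 0} := by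
  refine interior_eq_empty_iff_dense_compl.1 (Set.eq_empty_of_forall_notMem fun x hx => hx₀ ?_)
  have hzero : f =ᶠ[𝓝 x] 0 := mem_interior_iff_mem_nhds.1 hx
  exact hf.eqOn_zero_of_preconnected_of_eventuallyEq_zero isPreconnected_univ (Set.mem_univ x)
    hzero (Set.mem_univ x₀)

/-- The numerator of `σ_s`. -/
def sigmaNum (s : Fin 2) (x : Jet1) : ℝ := 2 * mixedDet x.1.2.2 (x.2 s)

/-- The numerator of `𝒞ᵏ`. -/
def curvNum (k : Fin 2) (x : Jet1) : ℝ := x.2 1 (fI 0 k) - x.2 0 (fI 1 k)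

/-- The numerator of `C_ρ`. -/
def normSqNum (x : Jet1) : ℝ :=
  gt 1 1 x.1 * sigmaNum 0 x ^ 2 - 2 * gt 0 1 x.1 * (sigmaNum 0 x * sigmaNum 1 x) +
    gt 0 0 x.1 * sigmaNum 1 x ^ 2

/-- The numerator of `formsMatrix`. -/
def formsNum (x : Jet1) : Matrix (Fin 3) (Fin 3) ℝ :=
  !![gt 0 0 x.1, gt 0 1 x.1, gt 1 1 x.1;
     mixedDet (x.2 0) (x.2 0), mixedDet (x.2 0) (x.2 1), mixedDet (x.2 1) (x.2 1);
     sigmaNum 0 x ^ 2, sigmaNum 0 x * sigmaNum 1 x, sigmaNum 1 x ^ 2]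

/-- The numerator of `Θ_I`. -/
def thetaNum (x : Jet1) : ℝ := ∑ k, ∑ l, minorForm x k l * curvNum k x * curvNum l x

/-- The numerator of `curvJacobian`. -/
def curvJacobianNum (x : Jet1) : Matrix (Fin 2) (Fin 2) ℝ :=
  !![∑ l, hh 0 l x.1 * curvNum l x, ∑ l, hh 1 l x.1 * curvNum l x;
     ∑ l, minorForm x 0 l * curvNum l x, ∑ l, minorForm x 1 l * curvNum l x]

/-- The polynomial whose zeros are the jets which are not generic. -/
def genericPoly (x : Jet1) : ℝ :=
  detG x.1 * detH x.1 * (fibreWronskian x).det * normSqNum x * (formsNum x).det * thetaNum x *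
    (curvJacobianNum x).det

section Numerators

variable (x : Jet1)

theorem traceInv_rho_eq_div :
    traceInv (rho x) x.1 = normSqNum x / (detG x.1 * detH x.1 ^ 2) := by
  simp only [traceInv, rho, Matrix.of_apply, Fin.sum_univ_two, gInv_comm 1 0, gInv_zero_zero,
    gInv_zero_one, gInv_one_one, sigma_eq_mixedDet, normSqNum, sigmaNum]
  ring

theorem det_formsMatrix_eq_div : (formsMatrix x).det = (formsNum x).det / detH x.1 ^ 3 := by
  simp [formsMatrix, formsNum, Matrix.det_fin_three, rho, sigma_eq_mixedDet, chi_eq_mixedDet,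
    sigmaNum]
  ring

theorem thetaI_eq_div :
    thetaI x = thetaNum x / (√|detH x.1| * √|detG x.1| ^ 3) := by
  simp only [thetaI_eq_sum, thetaNum, thetaForm, curv_eq, curvNum, Matrix.smul_apply, smul_eq_mul,
    Fin.sum_univ_two]
  ring

theorem det_curvJacobian_eq_div : (curvJacobian x).det =
    (curvJacobianNum x).det / (√|detH x.1| * √|detG x.1| ^ 3) := by
  simp [curvJacobian, curvJacobianNum, thetaForm, curv_eq, curvNum, Matrix.det_fin_two]
  ring

theorem isGeneric_iff : IsGeneric x ↔ genericPoly x ≠ 0 := by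
  have mem_iff : x.1 ∈ regular0 ↔ detG x.1 ≠ 0 ∧ detH x.1 ≠ 0 := Iff.rfl
  have hiff : IsGeneric x ↔ x.1 ∈ regular0 ∧ (fibreWronskian x).det ≠ 0 ∧
      traceInv (rho x) x.1 ≠ 0 ∧ (formsMatrix x).det ≠ 0 ∧ thetaI x ≠ 0 ∧
      (curvJacobian x).det ≠ 0 :=
    ⟨fun ⟨hmem, hfibre, hnorm, hforms, htheta, hcurv⟩ =>
        ⟨hmem, hfibre, hnorm, hforms, htheta, hcurv⟩,
      fun ⟨hmem, hfibre, hnorm, hforms, htheta, hcurv⟩ =>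
        ⟨hmem, hfibre, hnorm, hforms, htheta, hcurv⟩⟩
  rw [hiff, traceInv_rho_eq_div, det_formsMatrix_eq_div, thetaI_eq_div, det_curvJacobian_eq_div,
    mem_iff]
  simp only [genericPoly, ne_eq, div_eq_zero_iff, mul_eq_zero, pow_eq_zero_iff, Real.sqrt_eq_zero',
    abs_nonpos_iff, OfNat.ofNat_ne_zero, not_false_eq_true, not_or]
  tauto

end Numerators

theorem contDiff_genericPoly : ContDiff ℝ ω genericPoly := by
  unfold genericPoly
  simp only [detG, detH, fibreWronskian, normSqNum, formsNum, thetaNum, curvJacobianNum,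
    Matrix.det_fin_two, Matrix.det_fin_three, sigmaNum, curvNum, minorForm, mixedDet, gt, hh,
    Fin.sum_univ_two, Matrix.of_apply, Matrix.cons_val', Matrix.cons_val]
  fun_prop

/-- A generic first jet. -/
def genericJet : Jet1 :=
  ((0, 0, fun a => if a = gI 0 0 ∨ a = gI 1 1 ∨ a = hI 0 0 ∨ a = hI 1 1 then 1 else 0),
    ![fun a => if a = hI 0 0 then 1 else 0,
      fun a => if a = hI 0 0 ∨ a = hI 0 1 ∨ a = fI 0 0 then 1 else if a = hI 1 1 then -1 else
        if a = fI 0 1 then 2 else 0])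

theorem genericPoly_genericJet_ne_zero : genericPoly genericJet ≠ 0 := by
  simp [genericPoly, detG, detH, fibreWronskian, normSqNum, formsNum, thetaNum, curvJacobianNum,
    Matrix.det_fin_three, sigmaNum, curvNum, minorForm, mixedDet, gt, hh, genericJet]

theorem isOpen_isGeneric : IsOpen {x : Jet1 | IsGeneric x} := by
  simp only [isGeneric_iff]
  exact isOpen_ne_fun contDiff_genericPoly.continuous continuous_const

theorem dense_isGeneric : Dense {x : Jet1 | IsGeneric x} := by
  simp only [isGeneric_iff]
  exact dense_ne_zero_of_analyticOnNhd (fun x _ => contDiff_genericPoly.contDiffAt.analyticAt)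
    genericPoly_genericJet_ne_zero

/-! ### Maximality -/

theorem functionallyDependsAt_of_isGeneric {c : Jet2 → ℝ} (hc : IsInvariantOn c regular)
    (hcν : ∀ x ∈ regular, ∀ q, HasDerivAlong c x (0, q) (dCnu x.1.1 q)) {W : Set Jet2}
    {F : Jet2 → ℝ} (hW : IsOpen W) (hF : IsInvariantOn F W) {x₀ : Jet2} (hx₀W : x₀ ∈ W)
    (hx₀ : IsGeneric x₀.1) : FunctionallyDependsAt F (twenty c) x₀ := by
  have hO : IsOpen (W ∩ {x : Jet2 | IsGeneric x.1}) :=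
    hW.inter (isOpen_isGeneric.preimage continuous_fst)
  have hinv := isInvariantOn_twenty hc
  have hsmooth : ∀ a, ∀ x : Jet2, IsGeneric x.1 → ContDiffAt ℝ ∞ (twenty c a) x := fun a x hx =>
    (hinv a).1.contDiffAt (isOpen_regular.mem_nhds hx.mem_regular0)
  have hfderiv : ∀ x : Jet2, IsGeneric x.1 → fderiv ℝ (fun y a => twenty c a y) x =
      .pi fun a => fderiv ℝ (twenty c a) x := fun x hx =>
    fderiv_pi fun a => (hsmooth a x hx).differentiableAt (by simp)
  have hli : ∀ x : Jet2, IsGeneric x.1 →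
      LinearIndependent ℝ fun a => (fderiv ℝ (twenty c a) x).toLinearMap := fun x hx =>
    (hx.linearIndependent_twenty (hcν x hx.mem_regular0)).map'
      (ContinuousLinearMap.coeLM ℝ) (LinearMap.ker_eq_bot.2 ContinuousLinearMap.coe_injective)
  refine exists_contDiffOn_factor (I := fun x a => twenty c a x) (by simp) hO ⟨hx₀W, hx₀⟩
    (contDiffOn_pi.2 fun a x hx => (hsmooth a x hx.2).contDiffWithinAt)
    (hF.1.mono Set.inter_subset_left) ?_ fun x hx v hv => ?_
  · rw [hfderiv x₀ hx₀]
    exact pi_surjective_of_linearIndependent (hli x₀ hx₀)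
  · have hσ : (fun s => sigma s x.1) ≠ 0 := fun hzero => hx.2.normSq_sigma_ne_zero <| by
      simp [← sum_sigma_mul_sigmaUp, congrFun hzero]
    rw [hfderiv x hx.2] at hv
    obtain ⟨U, rfl⟩ := exists_lift2_eq (by simp) hx.2.mem_regular0
      hx.2.det_fibreWronskian_ne_zero hσ (hli x hx.2)
      (fun a U => (hinv a).2 _ _ _ U.contDiff_Φ U.contDiff_Ψ x hx.2.mem_regular0) (congrFun hv)
    exact hF.2 _ _ _ U.contDiff_Φ U.contDiff_Ψ x hx.1

theorem isMaximalSystem_twenty {c : Jet2 → ℝ} (hc : IsInvariantOn c regular)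
    (hcν : ∀ x ∈ regular, ∀ q, HasDerivAlong c x (0, q) (dCnu x.1.1 q)) :
    IsMaximalSystem (twenty c) where
  invariant := isInvariantOn_twenty hc
  generic :=
    ⟨{x | IsGeneric x.1}, isOpen_isGeneric.preimage continuous_fst, fun _ hx => hx.mem_regular0,
      fun x _ => dense_isGeneric.preimage isOpenMap_fst x,
      fun x hx => hx.linearIndependent_twenty (hcν x hx.mem_regular0),
      fun _ _ hW hF _ hj => functionallyDependsAt_of_isGeneric hc hcν hW hF hj.1 hj.2⟩

end KillingJet

end

theorem mainTheorem6 :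
    KillingJet.IsMaximalSystem (KillingJet.twenty KillingJet.Cnu) ∧
      KillingJet.IsMaximalSystem (KillingJet.twenty KillingJet.Cnu') :=
  ⟨KillingJet.isMaximalSystem_twenty KillingJet.isInvariantOn_Cnu
      fun _ hx q => KillingJet.hasDerivAlong_Cnu_vertical q hx,
    KillingJet.isMaximalSystem_twenty KillingJet.isInvariantOn_Cnu'
      fun _ hx q => KillingJet.hasDerivAlong_Cnu'_vertical q hx⟩
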